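/- Let $\mathbb K\in\{\mathbb R,\mathbb C\}$, let $m,p\ge 1$ be fixed, and write $\underline n=\lfloor n/\min(p,m)\rfloor$. Let $\mathcal D$ be a closed continuum (closed, connected, nonempty) contained in the open unit disk $\mathbb D$. For $z,\mu\in\mathbb D$ put $[z,\mu]_{\mathrm h}=\left|\frac{z-\mu}{1-\bar\mu z}\right|$, and let $$\tau(\mathcal D)=\lim_{q\to\infty}\ \min_{\mu_1,\dots,\mu_q\in\mathcal D}\ \max_{z\in\mathcal D}\Big(\prod_{k=1}^q[z,\mu_k]_{\mathrm h}\Big)^{1/q}$$ be its hyperbolic Chebyshev constant. Let $\|\cdot\|$ denote the Frobenius norm of a matrix. Fix $\delta>0$ and constants $\bar R,\gamma,c$ that do not depend on $n$. **True systems.** For every $n$ let $(A,B,C)$ be an $n$-dimensional state-space model over $\mathbb K$ with $m$ inputs and $p$ outputs, $$x_{t+1}=Ax_t+Bu_t,\qquad y_t=Cx_t+v_t,\qquad x_0=0,$$ whose transfer function $G(z)=C(zI-A)^{-1}B$ has no repeated poles and has all its poles in $\mathcal D$, that is, $G(z)=\sum_j R_j/(z-\lambda_j)$ with pairwise distinct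 $\lambda_j\in\mathcal D$ and $R_j\ne0$; assume $\sum_j\|R_j\|\le\bar R$. The noise $v_t$ is i.i.d. $\mathcal N(0,\mathcal R)$ with $\mathcal R\succ0$ and $\|\mathcal R^{-1}\|\le\gamma$ (circularly symmetric complex normal if $\mathbb K=\mathbb C$). The input is produced from time $0$ on by a finite-dimensional causal linear time-invariant feedback of $y_t$ (started in the zero state, and known) plus an external probing signal $\{r_t\}$ that is independent of $\{v_t\}$. The resulting input $\{u_t\}_{t\ge0}$ is (second-order) stationary with a power spectral density $\Phi_u$ satisfying $\operatorname{ess\,sup}_\omega\|\Phi_u(\omega)\|\le c$. The matrices, the noise covariance $\mathcal R$, the feedback and the signals may all depend on $n$. **Surrogate.** Let $\mu_1,\dots,\mu_{\underline n}\in\mathcal D$ be a minimizer of $$\min_{\mu_1,\dots,\mu_{\underline n}\in\mathcal D}\ \max_{z\in\partial\mathcal D}\ \prod_{k=1}^{\underline n}[z,\mu_k]_{\mathrm h},$$ which, if $\mathbb K=\mathbb R$, is invariant (with multiplicities) under complex conjugation. Let $\check G(z)=\sum_{k=1}^{\underline n}\check R_kV_k(z)$, where $V_k(z)=1/(z-\mu_k)$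 if the $\mu_k$ are distinct (for a repeated pole the $l$-th occurrence contributes $V_k(z)=1/(z-\mu_k)^l$), and where $\check R_1,\dots,\check R_{\underline n}\in\mathbb C^{p\times m}$ minimize the $\mathcal H_2$ norm $\|G-\sum_k\check R_kV_k\|_2$. **Claim.** For every $n$ there is an $n$-dimensional state-space realization $(\check A,\check B,\check C)$ over $\mathbb K$ of $\check G$ such that the following holds. Let $N=N(n)\in\mathbb N\cup\{\infty\}$ be the least number of samples for which $$\mathbb E\,D_{\mathrm{KL}}(\mathbb P_0\,\|\,\mathbb P_1)\ \ge\ \delta ,$$ where $\mathbb P_0$ and $\mathbb P_1$ are the conditional distributions of $y_1,\dots,y_N$ given $u_0,\dots,u_{N-1}$ when the samples are generated, with the same feedback, probing signal and noise, by the true system $(A,B,C)$ and by the surrogate system $(\check A,\check B,\check C)$, respectively, and the expectation is over the inputs generated with the true system. Then $$\liminf_{n\to\infty}N^{1/(2\underline n)}\ \ge\ \tau(\mathcal D)^{-1}.$$ -/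

import Mathlib

open MeasureTheory ProbabilityTheory Filter Topology
open scoped ENNReal ComplexOrder ComplexConjugate

noncomputable section

namespace SysId

/-! ### Hyperbolic Chebyshev constant -/

/-- The pseudohyperbolic distance `[z, w]_h = |(z - w) / (1 - conj w * z)|`. -/
def pseudoHyp (z w : ℂ) : ℝ := ‖(z - w) / (1 - conj w * z)‖

/-- The finite hyperbolic Chebyshev constant
`τ_q(D) = min_{μ_1, …, μ_q ∈ D} max_{z ∈ D} (∏ k, [z, μ_k]_h)^(1/q)`. -/
def finiteChebyshev (D : Set ℂ) (q : ℕ) : ℝ :=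
  ⨅ μ : Fin q → D, ⨆ z : D, (∏ k, pseudoHyp z (μ k)) ^ (1 / (q : ℝ))

/-- The hyperbolic Chebyshev constant `τ(D) = lim_q τ_q(D)`. -/
def chebyshev (D : Set ℂ) : ℝ := limUnder atTop (finiteChebyshev D)

/-- The objective `max_{z ∈ ∂D} ∏ k, [z, μ_k]_h` of the minimax pole selection problem. -/
def minimaxObjective (D : Set ℂ) {q : ℕ} (μ : Fin q → ℂ) : ℝ :=
  ⨆ z : frontier D, ∏ k, pseudoHyp z (μ k)

/-- `μ` solves the minimax pole selection problem
`min_{μ_1, …, μ_q ∈ D} max_{z ∈ ∂D} ∏ k, [z, μ_k]_h`. -/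
def IsMinimaxPoles (D : Set ℂ) {q : ℕ} (μ : Fin q → ℂ) : Prop :=
  (∀ k, μ k ∈ D) ∧
    ∀ ν : Fin q → ℂ, (∀ k, ν k ∈ D) → minimaxObjective D μ ≤ minimaxObjective D ν

/-- The monic polynomial with roots `μ_k` has coefficients in `𝕜`. For `𝕜 = ℝ` this says that the
multiset of the `μ_k` is invariant under complex conjugation; for `𝕜 = ℂ` it always holds. -/
def IsDefinedOver (𝕜 : Type*) [RCLike 𝕜] {q : ℕ} (μ : Fin q → ℂ) : Prop :=
  ∀ i, ∃ c : 𝕜, RCLike.map 𝕜 ℂ c = (∏ k, (Polynomial.X - Polynomial.C (μ k))).coeff i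

theorem isDefinedOver_complex {q : ℕ} (μ : Fin q → ℂ) : IsDefinedOver ℂ μ :=
  fun i => ⟨(∏ k, (Polynomial.X - Polynomial.C (μ k))).coeff i, by simp⟩

/-! ### Transfer functions -/

/-- The Frobenius norm. -/
def frob {𝕜 : Type*} [RCLike 𝕜] {a b : ℕ} (M : Matrix (Fin a) (Fin b) 𝕜) : ℝ :=
  Real.sqrt (∑ i, ∑ j, ‖M i j‖ ^ 2)

/-- The `H₂` norm `((2π)⁻¹ ∫_0^{2π} ‖F(e^{iω})‖² dω)^{1/2}`. -/
def h2Norm {p m : ℕ} (F : ℂ → Matrix (Fin p) (Fin m) ℂ) : ℝ :=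
  Real.sqrt ((2 * Real.pi)⁻¹ *
    ∫ w in (0 : ℝ)..(2 * Real.pi), frob (F (Complex.exp (w * Complex.I))) ^ 2)

/-- The parameters `(A, B, C)` of an `n`-dimensional state-space model over `𝕜` with `m` inputs
and `p` outputs. -/
structure StateSpace (𝕜 : Type*) (n m p : ℕ) where
  A : Matrix (Fin n) (Fin n) 𝕜
  B : Matrix (Fin n) (Fin m) 𝕜
  C : Matrix (Fin p) (Fin n) 𝕜

/-- The state matrix with complex entries. -/
def StateSpace.AC {𝕜 : Type*} [RCLike 𝕜] {n m p : ℕ} (S : StateSpace 𝕜 n m p) :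
    Matrix (Fin n) (Fin n) ℂ := S.A.map (RCLike.map 𝕜 ℂ)

/-- The transfer function `C (z I - A)⁻¹ B` (meaningful when `z` is not an eigenvalue of `A`). -/
def StateSpace.transfer {𝕜 : Type*} [RCLike 𝕜] {n m p : ℕ} (S : StateSpace 𝕜 n m p) (z : ℂ) :
    Matrix (Fin p) (Fin m) ℂ :=
  S.C.map (RCLike.map 𝕜 ℂ) * (z • (1 : Matrix (Fin n) (Fin n) ℂ) - S.AC)⁻¹ *
    S.B.map (RCLike.map 𝕜 ℂ)

/-- The transfer function of `S` has no repeated poles: its poles are the pairwise distinct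
`pole j`, with nonzero residues `R j`, that is `G(z) = ∑ j, R_j / (z - pole_j)`. -/
def HasSimplePoles {𝕜 : Type*} [RCLike 𝕜] {n m p κ : ℕ} (S : StateSpace 𝕜 n m p)
    (pole : Fin κ → ℂ) (R : Fin κ → Matrix (Fin p) (Fin m) ℂ) : Prop :=
  Function.Injective pole ∧ (∀ j, R j ≠ 0) ∧
    ∀ z, z ∉ spectrum ℂ S.AC → (∀ j, z ≠ pole j) →
      S.transfer z = ∑ j, (1 / (z - pole j)) • R j

/-- The number of indices `i ≤ k` with `μ_i = μ_k`. -/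
def poleOrder {q : ℕ} (μ : Fin q → ℂ) (k : Fin q) : ℕ :=
  (Finset.univ.filter fun i => i ≤ k ∧ μ i = μ k).card

theorem poleOrder_of_injective {q : ℕ} {μ : Fin q → ℂ} (hμ : Function.Injective μ) (k : Fin q) :
    poleOrder μ k = 1 := by
  unfold poleOrder
  rw [Finset.card_eq_one]
  refine ⟨k, Finset.ext fun i => ?_⟩
  simp only [Finset.mem_filter, Finset.mem_univ, true_and, Finset.mem_singleton]
  exact ⟨fun h => hμ h.2, fun h => by simp [h]⟩

/-- The basis functions with preassigned poles: `V_k(z) = 1 / (z - μ_k)` when the `μ_k` are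
distinct; the `l`-th occurrence of a repeated pole contributes `1 / (z - μ_k) ^ l`, so that the
span is always that of the orthonormal basis functions with these poles. -/
def basisFun {q : ℕ} (μ : Fin q → ℂ) (k : Fin q) (z : ℂ) : ℂ := 1 / (z - μ k) ^ poleOrder μ k

/-- The model `∑ k, Q_k V_k(z)`. -/
def obfModel {q p m : ℕ} (μ : Fin q → ℂ) (Q : Fin q → Matrix (Fin p) (Fin m) ℂ) (z : ℂ) :
    Matrix (Fin p) (Fin m) ℂ :=
  ∑ k, basisFun μ k z • Q k

theorem obfModel_of_injective {q p m : ℕ} {μ : Fin q → ℂ} (hμ : Function.Injective μ)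
    (Q : Fin q → Matrix (Fin p) (Fin m) ℂ) (z : ℂ) :
    obfModel μ Q z = ∑ k, (1 / (z - μ k)) • Q k := by
  simp [obfModel, basisFun, poleOrder_of_injective hμ]

/-- The coefficients `Q` minimize `‖G - ∑ k, Q_k V_k‖_2`. -/
def IsOptimalCoeff {q p m : ℕ} (G : ℂ → Matrix (Fin p) (Fin m) ℂ) (μ : Fin q → ℂ)
    (Q : Fin q → Matrix (Fin p) (Fin m) ℂ) : Prop :=
  ∀ Q' : Fin q → Matrix (Fin p) (Fin m) ℂ,
    h2Norm (fun z => G z - obfModel μ Q z) ≤ h2Norm (fun z => G z - obfModel μ Q' z)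

/-- `S` is a state-space realization of the model `∑ k, Q_k V_k(z)`. -/
def Realizes {𝕜 : Type*} [RCLike 𝕜] {n m p q : ℕ} (S : StateSpace 𝕜 n m p) (μ : Fin q → ℂ)
    (Q : Fin q → Matrix (Fin p) (Fin m) ℂ) : Prop :=
  ∀ z, z ∉ spectrum ℂ S.AC → (∀ k, z ≠ μ k) → S.transfer z = obfModel μ Q z

/-! ### Closed-loop signals -/

/-- A causal linear feedback `φ_{t+1} = F φ_t + L y_t`, `u_t = M φ_t + N y_t + r_t` of order `d`,
where `r` is the external probing signal. -/
structure Controller (𝕜 : Type*) (d m p : ℕ) where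
  F : Matrix (Fin d) (Fin d) 𝕜
  L : Matrix (Fin d) (Fin p) 𝕜
  M : Matrix (Fin m) (Fin d) 𝕜
  N : Matrix (Fin m) (Fin p) 𝕜

section Loop

variable {𝕜 : Type*} [RCLike 𝕜] {n d m p : ℕ}

/-- The output `y_t = C x_t + v_t` as a function of the state `x_t` and the noise `v_t`. -/
def outputOf (S : StateSpace 𝕜 n m p) (x : Fin n → 𝕜) (v : Fin p → 𝕜) : Fin p → 𝕜 :=
  S.C.mulVec x + v

/-- The input `u_t = M φ_t + N y_t + r_t`. -/
def inputOf (K : Controller 𝕜 d m p) (φ : Fin d → 𝕜) (y : Fin p → 𝕜) (r : Fin m → 𝕜) :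
    Fin m → 𝕜 :=
  K.M.mulVec φ + K.N.mulVec y + r

/-- The states `(x_t, φ_t)` of plant and controller, both started at `0` at time `0`, with
`x_{t+1} = A x_t + B u_t`. -/
def loopState (S : StateSpace 𝕜 n m p) (K : Controller 𝕜 d m p)
    (r : ℕ → Fin m → 𝕜) (v : ℕ → Fin p → 𝕜) : ℕ → (Fin n → 𝕜) × (Fin d → 𝕜)
  | 0 => (0, 0)
  | t + 1 =>
    let s := loopState S K r v t
    let y := outputOf S s.1 (v t)
    (S.A.mulVec s.1 + S.B.mulVec (inputOf K s.2 y (r t)), K.F.mulVec s.2 + K.L.mulVec y)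

/-- The output `y_t` of the closed loop. -/
def output (S : StateSpace 𝕜 n m p) (K : Controller 𝕜 d m p)
    (r : ℕ → Fin m → 𝕜) (v : ℕ → Fin p → 𝕜) (t : ℕ) : Fin p → 𝕜 :=
  outputOf S (loopState S K r v t).1 (v t)

/-- The input `u_t` of the closed loop. -/
def input (S : StateSpace 𝕜 n m p) (K : Controller 𝕜 d m p)
    (r : ℕ → Fin m → 𝕜) (v : ℕ → Fin p → 𝕜) (t : ℕ) : Fin m → 𝕜 :=
  inputOf K (loopState S K r v t).2 (output S K r v t) (r t)

variable {Ω : Type*} [MeasurableSpace Ω]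

/-- `{v_t}` is i.i.d. with law `N(0, Γ)`. If `𝕜 = ℂ` this is the circularly symmetric complex
normal law with `E[v vᴴ] = Γ` and `E[v vᵀ] = 0`. -/
structure IsGaussianWhiteNoise (v : ℕ → Ω → Fin p → 𝕜) (Γ : Matrix (Fin p) (Fin p) 𝕜)
    (P : Measure Ω) : Prop where
  measurable : ∀ t, Measurable (v t)
  indep : iIndepFun v P
  gaussian : ∀ t, IsGaussian (P.map (v t))
  mean_zero : ∀ t i, ∫ ω, v t ω i ∂P = 0
  cov : ∀ t i j, ∫ ω, v t ω i * conj (v t ω j) ∂P = Γ i j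
  circular : (RCLike.I : 𝕜) ≠ 0 → ∀ t i j, ∫ ω, v t ω i * v t ω j ∂P = 0

/-- `{u_t}_{t ≥ 0}` is stationary (of second order), with autocovariance `R_u(k) = E[u_t u_{t-k}ᴴ]`
and with a power spectral density `Φ(ω) = ∑ k, R_u(k) e^{ikω}` (the function with these Fourier
coefficients) that satisfies `ess sup ‖Φ(ω)‖ ≤ c`. -/
def IsStationaryWithPSDBound (u : ℕ → Ω → Fin m → 𝕜) (P : Measure Ω) (c : ℝ) : Prop :=
  (∀ t, MemLp (u t) 2 P) ∧
  ∃ Ru : ℤ → Matrix (Fin m) (Fin m) 𝕜,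
    (∀ t s : ℕ, ∀ i j, ∫ ω, u t ω i * conj (u s ω j) ∂P = Ru ((t : ℤ) - (s : ℤ)) i j) ∧
    ∃ Φ : ℝ → Matrix (Fin m) (Fin m) ℂ,
      (∀ i j, AEStronglyMeasurable (fun w => Φ w i j)
        (volume.restrict (Set.Ioc 0 (2 * Real.pi)))) ∧
      (∀ᵐ w ∂(volume.restrict (Set.Ioc 0 (2 * Real.pi))), frob (Φ w) ≤ c) ∧
      ∀ (k : ℤ) (i j : Fin m), RCLike.map 𝕜 ℂ (Ru k i j) =
        (2 * (Real.pi : ℂ))⁻¹ * ∫ w in (0 : ℝ)..(2 * Real.pi),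
          Φ w i j * Complex.exp (-(k : ℂ) * w * Complex.I)

/-- The samples `y_1, …, y_N` generated with the system `S`. -/
def outputSamples (S : StateSpace 𝕜 n m p) (K : Controller 𝕜 d m p)
    (r : ℕ → Ω → Fin m → 𝕜) (v : ℕ → Ω → Fin p → 𝕜) (N : ℕ) (ω : Ω) : Fin N → Fin p → 𝕜 :=
  fun i => output S K (fun t => r t ω) (fun t => v t ω) (i + 1)

/-- The samples `u_0, …, u_{N-1}` generated with the system `S`. -/
def inputSamples (S : StateSpace 𝕜 n m p) (K : Controller 𝕜 d m p)
    (r : ℕ → Ω → Fin m → 𝕜) (v : ℕ → Ω → Fin p → 𝕜) (N : ℕ) (ω : Ω) : Fin N → Fin m → 𝕜 :=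
  fun i => input S K (fun t => r t ω) (fun t => v t ω) i

/-- The expected Kullback-Leibler divergence `E D_KL(P₀ ‖ P₁)`, where `P₀` and `P₁` are the
conditional laws of `y_1, …, y_N` given `u_0, …, u_{N-1}` when the samples come from `S₀` and from
`S₁`, respectively, and the expectation is over the inputs generated with `S₀`. -/
def expectedKL (S₀ S₁ : StateSpace 𝕜 n m p) (K : Controller 𝕜 d m p)
    (r : ℕ → Ω → Fin m → 𝕜) (v : ℕ → Ω → Fin p → 𝕜) (P : Measure Ω) [IsFiniteMeasure P]
    (N : ℕ) : ℝ≥0∞ :=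
  ∫⁻ w, InformationTheory.klDiv
      (condDistrib (outputSamples S₀ K r v N) (inputSamples S₀ K r v N) P w)
      (condDistrib (outputSamples S₁ K r v N) (inputSamples S₁ K r v N) P w)
    ∂(P.map (inputSamples S₀ K r v N))

/-- The sample complexity: the least `N` for which the expected KL divergence is at least `δ`
(`∞` if there is none). -/
def sampleComplexity (S₀ S₁ : StateSpace 𝕜 n m p) (K : Controller 𝕜 d m p)
    (r : ℕ → Ω → Fin m → 𝕜) (v : ℕ → Ω → Fin p → 𝕜) (P : Measure Ω) [IsFiniteMeasure P]
    (δ : ℝ) : ℝ≥0∞ :=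
  ⨅ (N : ℕ) (_ : ENNReal.ofReal δ ≤ expectedKL S₀ S₁ K r v P N), (N : ℝ≥0∞)

end Loop

end SysId

end

open SysId

noncomputable section

namespace SysId

/-! ### The hyperbolic Chebyshev constant -/

section Chebyshev

variable {D : Set ℂ}

/-! The divergence grows at most linearly in the number of samples, with a slope proportional to the
squared H₂ error of the surrogate, and that error is at most a constant times `τ_q ^ q`, where `q =
⌊n / min(p, m)⌋` and `τ_q` is the finite Chebyshev constant. So `N ≥ const * τ_q ^ (-2q)`, and the
`2q`-th root removes the constant.

Approximation. If `b` is the Blaschke product with zeros `μ_k`, then `1 / (z - λ)` minus a suitable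
combination of the `V_k` equals `b(λ) / (b(z) (z - λ))` (`exists_approx_inv_sub`). Since `|b| = 1`
on the circle, only `|b(λ)|` over the distance of `λ` to the circle remains, and the maximum
principle bounds `|b(λ)|` on `D` by the minimax value, hence by `τ_q ^ q`. Submultiplicativity of
`τ_q ^ q` gives convergence of `τ_q` (`tendsto_finiteChebyshev`).

Realization. All entries of the surrogate share a denominator of degree `q`, so a block companion
form of order `q * min p m ≤ n` suffices (`exists_realization`). Over the reals, the conjugate of
the optimal model is optimal too, and uniqueness of the H₂ projection makes the numerators real.

Divergence. Conditional laws are replaced by joint laws, which can only increase the divergence. If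
the noise of the surrogate is shifted by the gap between the noise-free outputs, the surrogate
reproduces every signal of the true loop (`input_replay`, `output_replay`); by data processing it
remains to compare shifted with unshifted noise. The shift is causal, so the chain rule bounds this
divergence by a sum of Gaussian translation costs, each at most `gam * E‖gap_t‖²`
(`klDiv_map_trunc_le`, `klDiv_map_add_le_of_posDef`). The gap is the input filtered by the Markov
parameter differences; the spectral bound and Bessel's inequality give `E‖gap_t‖² ≤ c * ‖G - Ǧ‖₂²`,
uniformly in `t`, so stability of the closed loop formed with the surrogate plays no role. -/

theorem one_sub_conj_mul_ne_zero {z w : ℂ} (hz : ‖z‖ ≤ 1) (hw : ‖w‖ < 1) :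
    1 - conj w * z ≠ 0 := by
  intro h
  have h1 : ‖conj w * z‖ = 1 := by rw [← sub_eq_zero.1 h]; simp
  rw [norm_mul, RCLike.norm_conj] at h1
  nlinarith [norm_nonneg z, norm_nonneg w]

theorem pseudoHyp_nonneg (z w : ℂ) : 0 ≤ pseudoHyp z w := norm_nonneg _

/-- The reason is the identity `|1 - conj w * z|² - |z - w|² = (1 - |z|²)(1 - |w|²)`. -/
theorem pseudoHyp_le_one {z w : ℂ} (hz : ‖z‖ < 1) (hw : ‖w‖ < 1) : pseudoHyp z w ≤ 1 := by
  unfold pseudoHyp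
  rw [norm_div, div_le_one (norm_pos_iff.2 (one_sub_conj_mul_ne_zero hz.le hw))]
  refine le_of_sq_le_sq ?_ (norm_nonneg _)
  rw [← Complex.normSq_eq_norm_sq, ← Complex.normSq_eq_norm_sq]
  rw [← sq_lt_one_iff₀ (norm_nonneg _), ← Complex.normSq_eq_norm_sq] at hz hw
  simp only [Complex.normSq_apply, Complex.sub_re, Complex.sub_im, Complex.mul_re, Complex.mul_im,
    Complex.conj_re, Complex.conj_im, Complex.one_re, Complex.one_im] at *
  nlinarith [mul_nonneg (sub_nonneg.2 hz.le) (sub_nonneg.2 hw.le)]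

/-- The finite Blaschke product with zeros `μ_k`. -/
def blaschke {q : ℕ} (μ : Fin q → ℂ) (z : ℂ) : ℂ := ∏ k, (z - μ k) / (1 - conj (μ k) * z)

theorem norm_blaschke {q : ℕ} (μ : Fin q → ℂ) (z : ℂ) :
    ‖blaschke μ z‖ = ∏ k, pseudoHyp z (μ k) := by
  simp [blaschke, pseudoHyp]

theorem differentiableAt_blaschke {q : ℕ} {μ : Fin q → ℂ} (hμ : ∀ k, ‖μ k‖ < 1) {z : ℂ}
    (hz : ‖z‖ ≤ 1) : DifferentiableAt ℂ (blaschke μ) z := by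
  unfold blaschke
  refine DifferentiableAt.fun_finsetProd fun k _ => ?_
  exact DifferentiableAt.div (by fun_prop) (by fun_prop) (one_sub_conj_mul_ne_zero hz (hμ k))

theorem norm_lt_one_of_mem (hD : D ⊆ Metric.ball (0 : ℂ) 1) {z : ℂ} (hz : z ∈ D) : ‖z‖ < 1 := by
  simpa using hD hz

theorem continuousOn_blaschke (hD : D ⊆ Metric.ball (0 : ℂ) 1) {q : ℕ} {μ : Fin q → ℂ}
    (hμ : ∀ k, μ k ∈ D) : ContinuousOn (blaschke μ) D := fun _ hz =>
  (differentiableAt_blaschke (fun k => norm_lt_one_of_mem hD (hμ k))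
    (norm_lt_one_of_mem hD hz).le).continuousAt.continuousWithinAt

theorem isCompact_of_isClosed_subset_ball (hc : IsClosed D) (hD : D ⊆ Metric.ball (0 : ℂ) 1) :
    IsCompact D :=
  Metric.isCompact_of_isClosed_isBounded hc (Metric.isBounded_ball.subset hD)

theorem prod_pseudoHyp_le_one (hD : D ⊆ Metric.ball (0 : ℂ) 1) {q : ℕ} {μ : Fin q → ℂ}
    (hμ : ∀ k, μ k ∈ D) {z : ℂ} (hz : z ∈ D) : ∏ k, pseudoHyp z (μ k) ≤ 1 :=
  Finset.prod_le_one (fun _ _ => pseudoHyp_nonneg _ _) fun k _ =>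
    pseudoHyp_le_one (norm_lt_one_of_mem hD hz) (norm_lt_one_of_mem hD (hμ k))

theorem prod_pseudoHyp_nonneg {q : ℕ} (μ : Fin q → ℂ) (z : ℂ) : 0 ≤ ∏ k, pseudoHyp z (μ k) :=
  Finset.prod_nonneg fun _ _ => pseudoHyp_nonneg _ _

/-- By the maximum modulus principle, the objective bounds the product on all of `D`. -/
theorem prod_pseudoHyp_le_minimaxObjective (hc : IsClosed D) (hD : D ⊆ Metric.ball (0 : ℂ) 1)
    {q : ℕ} {μ : Fin q → ℂ} (hμ : ∀ k, μ k ∈ D) {z : ℂ} (hz : z ∈ D) :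
    ∏ k, pseudoHyp z (μ k) ≤ minimaxObjective D μ := by
  have hbdd : BddAbove (Set.range fun z : frontier D => ∏ k, pseudoHyp z (μ k)) := by
    refine ⟨1, ?_⟩
    rintro _ ⟨w, rfl⟩
    exact prod_pseudoHyp_le_one hD hμ (hc.frontier_subset w.2)
  have hfr : ∀ w ∈ frontier D, ∏ k, pseudoHyp w (μ k) ≤ minimaxObjective D μ :=
    fun w hw => le_ciSup hbdd ⟨w, hw⟩
  by_cases hi : z ∈ interior D
  · rw [← norm_blaschke]
    have hcl : closure (interior D) ⊆ D := hc.closure_interior_subset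
    refine Complex.norm_le_of_forall_mem_frontier_norm_le (U := interior D)
      (Metric.isBounded_ball.subset (interior_subset.trans hD)) ⟨?_, ?_⟩ ?_ (subset_closure hi)
    · exact fun w hw => (differentiableAt_blaschke (fun k => norm_lt_one_of_mem hD (hμ k))
        (norm_lt_one_of_mem hD (interior_subset hw)).le).differentiableWithinAt
    · exact (continuousOn_blaschke hD hμ).mono hcl
    · intro w hw
      rw [norm_blaschke]
      exact hfr w (frontier_interior_subset hw)
  · exact hfr z (by rw [hc.frontier_eq]; exact ⟨hz, hi⟩)


theorem bddAbove_rpow_prod (hD : D ⊆ Metric.ball (0 : ℂ) 1) {q : ℕ} (μ : Fin q → D) (e : ℝ)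
    (he : 0 ≤ e) : BddAbove (Set.range fun z : D => (∏ k, pseudoHyp z (μ k)) ^ e) := by
  refine ⟨1, ?_⟩
  rintro _ ⟨w, rfl⟩
  exact Real.rpow_le_one (prod_pseudoHyp_nonneg _ _)
    (prod_pseudoHyp_le_one hD (fun k => (μ k).2) w.2) he

theorem iSup_rpow_prod_nonneg {q : ℕ} (μ : Fin q → D) (e : ℝ) :
    0 ≤ ⨆ z : D, (∏ k, pseudoHyp z (μ k)) ^ e :=
  Real.iSup_nonneg fun _ => Real.rpow_nonneg (prod_pseudoHyp_nonneg _ _) _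

theorem finiteChebyshev_nonneg (D : Set ℂ) (q : ℕ) : 0 ≤ finiteChebyshev D q :=
  Real.iInf_nonneg fun _ => iSup_rpow_prod_nonneg _ _

theorem bddBelow_iSup_rpow_prod (D : Set ℂ) (q : ℕ) : BddBelow (Set.range fun μ : Fin q → D =>
    ⨆ z : D, (∏ k, pseudoHyp z (μ k)) ^ (1 / (q : ℝ))) := by
  refine ⟨0, ?_⟩
  rintro _ ⟨μ, rfl⟩
  exact iSup_rpow_prod_nonneg _ _

theorem prod_le_iSup_rpow_pow (hD : D ⊆ Metric.ball (0 : ℂ) 1) {q : ℕ} (μ : Fin q → D) (z : D) :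
    ∏ k, pseudoHyp z (μ k) ≤ (⨆ z : D, (∏ k, pseudoHyp z (μ k)) ^ (1 / (q : ℝ))) ^ q := by
  rcases Nat.eq_zero_or_pos q with rfl | hq
  · simp
  have h := le_ciSup (bddAbove_rpow_prod hD μ (1 / (q : ℝ)) (by positivity)) z
  calc ∏ k, pseudoHyp z (μ k) = ((∏ k, pseudoHyp z (μ k)) ^ (1 / (q : ℝ))) ^ q := by
        rw [one_div, Real.rpow_inv_natCast_pow (prod_pseudoHyp_nonneg _ _) hq.ne']
    _ ≤ _ := pow_le_pow_left₀ (Real.rpow_nonneg (prod_pseudoHyp_nonneg _ _) _) h q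

/-- Minimizing sequences stand in for minimizers, so attainment of the infimum is never needed. -/
theorem exists_seq_tendsto_finiteChebyshev (hne : D.Nonempty) (q : ℕ) : ∃ μ : ℕ → Fin q → D,
    Tendsto (fun i => ⨆ z : D, (∏ k, pseudoHyp z (μ i k)) ^ (1 / (q : ℝ))) atTop
      (𝓝 (finiteChebyshev D q)) := by
  have : Nonempty D := hne.to_subtype
  obtain ⟨u, -, hu, hmem⟩ := exists_seq_tendsto_sInf (Set.range_nonempty fun μ : Fin q → D =>
    ⨆ z : D, (∏ k, pseudoHyp z (μ k)) ^ (1 / (q : ℝ))) (bddBelow_iSup_rpow_prod D q)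
  choose μ hμ using hmem
  refine ⟨μ, ?_⟩
  simp only [hμ]
  exact hu

/-- Every member of a minimizing sequence for the Chebyshev constant competes in the minimax
problem, where the maximum runs only over the frontier, a subset of `D`. -/
theorem minimaxObjective_le_finiteChebyshev_pow (hne : D.Nonempty) (hc : IsClosed D)
    (hD : D ⊆ Metric.ball (0 : ℂ) 1) {q : ℕ} {μ : Fin q → ℂ} (hμ : IsMinimaxPoles D μ) :
    minimaxObjective D μ ≤ finiteChebyshev D q ^ q := by
  obtain ⟨ν, hν⟩ := exists_seq_tendsto_finiteChebyshev hne q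
  refine ge_of_tendsto' (hν.pow q) fun i => (hμ.2 (fun k => ν i k) fun k => (ν i k).2).trans ?_
  have : Nonempty D := hne.to_subtype
  -- On an empty index type the real supremum has the default value `0`.
  rcases isEmpty_or_nonempty (frontier D) with h | h
  · rw [minimaxObjective, Real.iSup_of_isEmpty]
    exact pow_nonneg (iSup_rpow_prod_nonneg _ _) _
  · exact ciSup_le fun z => prod_le_iSup_rpow_pow hD (ν i) ⟨z, hc.frontier_subset z.2⟩

/-- Concatenating nearly optimal tuples of `q` and of `s` points multiplies the two products. -/
theorem finiteChebyshev_add_pow_le (hne : D.Nonempty) (hD : D ⊆ Metric.ball (0 : ℂ) 1) (q s : ℕ) :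
    finiteChebyshev D (q + s) ^ (q + s) ≤ finiteChebyshev D q ^ q * finiteChebyshev D s ^ s := by
  rcases Nat.eq_zero_or_pos (q + s) with h0 | h0
  · obtain ⟨rfl, rfl⟩ : q = 0 ∧ s = 0 := by omega
    simp
  obtain ⟨μ, hμ⟩ := exists_seq_tendsto_finiteChebyshev hne q
  obtain ⟨ν, hν⟩ := exists_seq_tendsto_finiteChebyshev hne s
  refine ge_of_tendsto' ((hμ.pow q).mul (hν.pow s)) fun i => ?_
  have : Nonempty D := hne.to_subtype
  set a := ⨆ z : D, (∏ k, pseudoHyp z (μ i k)) ^ (1 / (q : ℝ)) with ha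
  set b := ⨆ z : D, (∏ k, pseudoHyp z (ν i k)) ^ (1 / (s : ℝ)) with hb
  have ha0 : 0 ≤ a := iSup_rpow_prod_nonneg _ _
  have hb0 : 0 ≤ b := iSup_rpow_prod_nonneg _ _
  have hle : finiteChebyshev D (q + s) ≤ (a ^ q * b ^ s) ^ (((q + s : ℕ) : ℝ)⁻¹) := by
    refine (ciInf_le (bddBelow_iSup_rpow_prod D (q + s)) (Fin.append (μ i) (ν i))).trans ?_
    refine ciSup_le fun z => ?_
    rw [one_div]
    refine Real.rpow_le_rpow (prod_pseudoHyp_nonneg _ _) ?_ (by positivity)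
    rw [Fin.prod_univ_add]
    simp only [Fin.append_left, Fin.append_right]
    exact mul_le_mul (prod_le_iSup_rpow_pow hD (μ i) z) (prod_le_iSup_rpow_pow hD (ν i) z)
      (prod_pseudoHyp_nonneg _ _) (pow_nonneg ha0 _)
  calc finiteChebyshev D (q + s) ^ (q + s)
      ≤ ((a ^ q * b ^ s) ^ (((q + s : ℕ) : ℝ)⁻¹)) ^ (q + s) :=
        pow_le_pow_left₀ (finiteChebyshev_nonneg _ _) hle _
    _ = a ^ q * b ^ s := Real.rpow_inv_natCast_pow (by positivity) h0.ne'

/-- The finite Chebyshev constants converge. -/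
theorem tendsto_finiteChebyshev (hne : D.Nonempty) (hD : D ⊆ Metric.ball (0 : ℂ) 1) :
    Tendsto (finiteChebyshev D) atTop (𝓝 (chebyshev D)) := by
  refine tendsto_nhds_limUnder ⟨⨅ q : ℕ, finiteChebyshev D (q + 1), ?_⟩
  set L := ⨅ q : ℕ, finiteChebyshev D (q + 1) with hL
  have hbdd : BddBelow (Set.range fun q : ℕ => finiteChebyshev D (q + 1)) :=
    ⟨0, by rintro _ ⟨q, rfl⟩; exact finiteChebyshev_nonneg _ _⟩
  have hL0 : 0 ≤ L := Real.iInf_nonneg fun _ => finiteChebyshev_nonneg _ _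
  refine tendsto_order.2 ⟨fun l hl => ?_, fun M hM => ?_⟩
  · filter_upwards [eventually_ge_atTop 1] with q hq
    obtain ⟨q, rfl⟩ := Nat.exists_eq_add_of_le' hq
    exact hl.trans_le (ciInf_le hbdd q)
  · obtain ⟨ε, hε, hεM⟩ := exists_between hM
    have hε0 : 0 < ε := hL0.trans_lt hε
    -- Fekete's lemma is applied after raising the constants to the floor `ε`, with `L < ε < M`:
    -- they may vanish, as they do when `D` is a single point, and then the logarithm would be
    -- useless.
    set u : ℕ → ℝ := fun q => q * Real.log (max (finiteChebyshev D q) ε) with hu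
    have hpos : ∀ q, 0 < max (finiteChebyshev D q) ε := fun q => lt_max_of_lt_right hε0
    have hsub : Subadditive u := by
      intro q s
      simp only [hu]
      rw [← Real.log_pow, ← Real.log_pow, ← Real.log_pow,
        ← Real.log_mul (pow_pos (hpos _) _).ne' (pow_pos (hpos _) _).ne']
      refine Real.log_le_log (pow_pos (hpos _) _) ?_
      rcases le_total (finiteChebyshev D (q + s)) ε with h | h
      · rw [max_eq_right h, pow_add]
        exact mul_le_mul (pow_le_pow_left₀ hε0.le (le_max_right _ _) _)
          (pow_le_pow_left₀ hε0.le (le_max_right _ _) _) (by positivity)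
          (pow_pos (hpos _) _).le
      · rw [max_eq_left h]
        refine (finiteChebyshev_add_pow_le hne hD q s).trans ?_
        exact mul_le_mul (pow_le_pow_left₀ (finiteChebyshev_nonneg _ _) (le_max_left _ _) _)
          (pow_le_pow_left₀ (finiteChebyshev_nonneg _ _) (le_max_left _ _) _)
          (pow_nonneg (finiteChebyshev_nonneg _ _) _) (pow_pos (hpos _) _).le
    obtain ⟨q, hq⟩ := exists_lt_of_ciInf_lt hε
    have hdiv : ∀ s : ℕ, s ≠ 0 → u s / s = Real.log (max (finiteChebyshev D s) ε) := by
      intro s hs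
      have : (s : ℝ) ≠ 0 := by exact_mod_cast hs
      simp only [hu]
      field_simp
    have hqM : u (q + 1) / ((q + 1 : ℕ) : ℝ) < Real.log M := by
      rw [hdiv _ q.succ_ne_zero]
      exact Real.log_lt_log (hpos _) (max_lt (hq.trans hεM) hεM)
    filter_upwards [hsub.eventually_div_lt_of_div_lt q.succ_ne_zero hqM, eventually_ge_atTop 1]
      with s hs hs1
    rw [hdiv s (by omega)] at hs
    exact (le_max_left _ _).trans_lt ((Real.log_lt_log_iff (hpos _) (hε0.trans hεM)).1 hs)

end Chebyshev

/-! ### Partial fractions with preassigned poles -/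

section PartialFractions

open Polynomial

theorem poleOrder_castSucc {q : ℕ} (μ : Fin (q + 1) → ℂ) (k : Fin q) :
    poleOrder μ k.castSucc = poleOrder (fun i => μ i.castSucc) k := by
  unfold poleOrder
  symm
  rw [← Finset.card_map Fin.castSuccEmb]
  refine congrArg Finset.card (Finset.ext fun i => Iff.symm ?_)
  simp only [Finset.mem_filter, Finset.mem_univ, true_and, Finset.mem_map, Fin.coe_castSuccEmb]
  constructor
  · rintro ⟨hi, hμ⟩
    refine ⟨i.castLT (lt_of_le_of_lt hi k.2), ⟨hi, ?_⟩, rfl⟩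
    simpa using hμ
  · rintro ⟨j, ⟨hj, hμ⟩, rfl⟩
    exact ⟨hj, hμ⟩

theorem basisFun_castSucc {q : ℕ} (μ : Fin (q + 1) → ℂ) (k : Fin q) (z : ℂ) :
    basisFun μ k.castSucc z = basisFun (fun i => μ i.castSucc) k z := by
  simp [basisFun, poleOrder_castSucc]

theorem poleOrder_pos {q : ℕ} (μ : Fin q → ℂ) (k : Fin q) : 0 < poleOrder μ k :=
  Finset.card_pos.2 ⟨k, by simp⟩

/-- The product of the factors `X - μ_i` that remain when the first `poleOrder μ k` copies of
`X - μ_k` are removed. -/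
def cofactor {q : ℕ} (μ : Fin q → ℂ) (k : Fin q) : ℂ[X] :=
  ∏ i with ¬ (i ≤ k ∧ μ i = μ k), (X - C (μ i))

theorem pow_mul_eval_cofactor {q : ℕ} (μ : Fin q → ℂ) (k : Fin q) (z : ℂ) :
    (z - μ k) ^ poleOrder μ k * (cofactor μ k).eval z = ∏ i, (z - μ i) := by
  rw [← Finset.prod_filter_mul_prod_filter_not Finset.univ (fun i => i ≤ k ∧ μ i = μ k),
    cofactor, eval_prod, poleOrder, ← Finset.prod_const]
  simp only [eval_sub, eval_X, eval_C]
  congr 1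
  exact Finset.prod_congr rfl fun i hi => by rw [(Finset.mem_filter.1 hi).2.2]

theorem degree_cofactor_lt {q : ℕ} (μ : Fin q → ℂ) (k : Fin q) : (cofactor μ k).degree < q := by
  unfold cofactor
  rw [degree_prod]
  simp only [degree_X_sub_C, Finset.sum_const, nsmul_eq_mul, mul_one]
  have : (Finset.univ.filter fun i => ¬ (i ≤ k ∧ μ i = μ k)).card < q := by
    refine (Finset.card_lt_univ_of_notMem (x := k) (by simp)).trans_eq (Fintype.card_fin q)
  exact_mod_cast this

theorem basisFun_eq_div {q : ℕ} (μ : Fin q → ℂ) (k : Fin q) {z : ℂ} (hz : ∀ i, z ≠ μ i) :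
    basisFun μ k z = (cofactor μ k).eval z / ∏ i, (z - μ i) := by
  have h := pow_mul_eval_cofactor μ k z
  have h0 : ∏ i, (z - μ i) ≠ 0 := Finset.prod_ne_zero_iff.2 fun i _ => sub_ne_zero.2 (hz i)
  rw [basisFun, div_eq_div_iff (pow_ne_zero _ (sub_ne_zero.2 (hz k))) h0, one_mul, ← h, mul_comm]

theorem exists_polynomial_sum_basisFun {q : ℕ} (μ : Fin q → ℂ) (c : Fin q → ℂ) :
    ∃ P : ℂ[X], P.degree < q ∧ ∀ z, (∀ i, z ≠ μ i) →
      ∑ k, basisFun μ k z * c k = P.eval z / ∏ i, (z - μ i) := by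
  refine ⟨∑ k, C (c k) * cofactor μ k, ?_, fun z hz => ?_⟩
  · rw [← mem_degreeLT]
    refine Submodule.sum_mem _ fun k _ => ?_
    rw [← smul_eq_C_mul]
    exact Submodule.smul_mem _ _ (mem_degreeLT.2 (degree_cofactor_lt μ k))
  · rw [eval_finsetSum, Finset.sum_div]
    refine Finset.sum_congr rfl fun k _ => ?_
    rw [basisFun_eq_div μ k hz, eval_mul, eval_C]
    ring

/-- Induction on the number of poles, splitting off the last one. Its cofactor `h` has lost all
copies of the last pole `ν`, so `h(ν) ≠ 0` and `a = P(ν) / h(ν)` makes `P - a h` divisible by `X -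
ν`. -/
theorem exists_sum_basisFun {q : ℕ} (μ : Fin q → ℂ) (P : ℂ[X]) (hP : P.degree < q) :
    ∃ c : Fin q → ℂ, ∀ z, (∀ i, z ≠ μ i) →
      P.eval z / ∏ i, (z - μ i) = ∑ k, basisFun μ k z * c k := by
  induction q generalizing P with
  | zero =>
    refine ⟨fun _ => 0, fun z _ => ?_⟩
    have : P = 0 := by
      rw [← degree_eq_bot]
      simpa [Nat.WithBot.lt_zero_iff] using hP
    simp [this]
  | succ q ih =>
    set ν := μ (Fin.last q) with hν
    set h := cofactor μ (Fin.last q) with hh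
    have hhν : h.eval ν ≠ 0 := by
      rw [hh, cofactor, eval_prod]
      refine Finset.prod_ne_zero_iff.2 fun i hi => ?_
      have := (Finset.mem_filter.1 hi).2
      simp only [Fin.le_last, true_and] at this
      simpa [sub_eq_zero] using fun h => this h.symm
    set a := P.eval ν / h.eval ν with ha
    obtain ⟨P', hP'⟩ : X - C ν ∣ P - C a * h := by
      rw [dvd_iff_isRoot]
      simp [IsRoot, ha, hhν]
    have hdeg : P'.degree < q := by
      rcases eq_or_ne P' 0 with rfl | h0
      · simp
      have h1 : (P - C a * h).degree < ((q + 1 : ℕ) : WithBot ℕ) := by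
        rw [← mem_degreeLT] at hP ⊢
        rw [← smul_eq_C_mul]
        exact Submodule.sub_mem _ hP
          (Submodule.smul_mem _ _ (mem_degreeLT.2 (degree_cofactor_lt μ _)))
      rw [hP', degree_mul, degree_X_sub_C, degree_eq_natDegree h0] at h1
      rw [degree_eq_natDegree h0]
      have h2 : 1 + P'.natDegree < q + 1 := by exact_mod_cast h1
      exact_mod_cast (by omega : P'.natDegree < q)
    obtain ⟨c, hc⟩ := ih (fun i => μ i.castSucc) P' hdeg
    refine ⟨Fin.snoc c a, fun z hz => ?_⟩
    rw [Fin.sum_univ_castSucc]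
    simp only [Fin.snoc_castSucc, Fin.snoc_last, basisFun_castSucc]
    rw [← hc z fun i => hz _, basisFun_eq_div μ _ hz, Fin.prod_univ_castSucc]
    have h1 : ∏ i : Fin q, (z - μ i.castSucc) ≠ 0 :=
      Finset.prod_ne_zero_iff.2 fun i _ => sub_ne_zero.2 (hz _)
    have h2 : z - ν ≠ 0 := sub_ne_zero.2 (hz _)
    have h3 : P.eval z = (z - ν) * P'.eval z + a * h.eval z := by
      have := congrArg (eval z) hP'
      simp only [eval_sub, eval_mul, eval_C, eval_X] at this
      linear_combination this
    rw [h3, ← hν, ← hh]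
    field_simp

/-- The error of approximating `1 / (z - l)` by interpolation. -/
theorem exists_approx_inv_sub {q : ℕ} {μ : Fin q → ℂ} (hμ : ∀ k, ‖μ k‖ < 1) {l : ℂ}
    (hl : ‖l‖ < 1) : ∃ c : Fin q → ℂ, ∀ z, (∀ i, z ≠ μ i) → z ≠ l →
      1 / (z - l) - ∑ k, basisFun μ k z * c k =
        blaschke μ l * (∏ k, (1 - conj (μ k) * z) / (z - μ k)) / (z - l) := by
  set m : ℂ[X] := ∏ k, (X - C (μ k)) with hm
  set n : ℂ[X] := ∏ k, (1 - C (conj (μ k)) * X) with hn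
  have hdm : m.degree = q := by rw [hm, degree_prod]; simp
  have hdn : n.degree ≤ q := by
    rw [hn]
    refine (degree_prod_le _ _).trans ((Finset.sum_le_sum (g := fun _ => 1) fun k _ => ?_).trans ?_)
    · compute_degree
    · simp
  have hmz : ∀ z, m.eval z = ∏ k, (z - μ k) := fun z => by simp [hm, eval_prod]
  have hnz : ∀ z, n.eval z = ∏ k, (1 - conj (μ k) * z) := fun z => by simp [hn, eval_prod]
  have hb : ∀ z, blaschke μ z = m.eval z / n.eval z := fun z => by
    rw [blaschke, hmz, hnz, Finset.prod_div_distrib]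
  have hnl : n.eval l ≠ 0 := by
    rw [hnz]
    exact Finset.prod_ne_zero_iff.2 fun i _ => one_sub_conj_mul_ne_zero hl.le (hμ i)
  -- As `blaschke μ = m / n`, the difference vanishes at `l`. The quotient `P` is the numerator of
  -- the approximant: `1 / (z - l) - P / m = b(l) n / (m (z - l))`.
  obtain ⟨P, hP⟩ : X - C l ∣ m - C (blaschke μ l) * n := by
    rw [dvd_iff_isRoot]
    simp [IsRoot, hb, hnl]
  have hdeg : P.degree < q := by
    rcases eq_or_ne P 0 with rfl | h0
    · simp
    have h1 : (m - C (blaschke μ l) * n).degree ≤ (q : WithBot ℕ) := by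
      rw [← smul_eq_C_mul]
      exact (degree_sub_le _ _).trans (max_le hdm.le ((degree_smul_le _ _).trans hdn))
    rw [hP, degree_mul, degree_X_sub_C, degree_eq_natDegree h0] at h1
    rw [degree_eq_natDegree h0]
    have h2 : 1 + P.natDegree ≤ q := by exact_mod_cast h1
    exact_mod_cast (by omega : P.natDegree < q)
  obtain ⟨c, hc⟩ := exists_sum_basisFun μ P hdeg
  refine ⟨c, fun z hz hzl => ?_⟩
  rw [← hc z hz, Finset.prod_div_distrib, ← hmz, ← hnz]
  have h1 : m.eval z ≠ 0 := by
    rw [hmz]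
    exact Finset.prod_ne_zero_iff.2 fun i _ => sub_ne_zero.2 (hz _)
  have h2 : z - l ≠ 0 := sub_ne_zero.2 hzl
  have h3 := congrArg (eval z) hP
  simp only [eval_sub, eval_mul, eval_C, eval_X] at h3
  field_simp
  linear_combination h3

/-- On the circle `1 - conj w * z = z * conj (z - w)`; this makes Blaschke factors unimodular there.
-/
theorem norm_one_sub_conj_mul_of_norm_eq_one {z w : ℂ} (hz : ‖z‖ = 1) :
    ‖1 - conj w * z‖ = ‖z - w‖ := by
  have h : 1 - conj w * z = z * conj (z - w) := by
    rw [map_sub, mul_sub, Complex.mul_conj, Complex.normSq_eq_norm_sq, hz]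
    push_cast
    ring
  rw [h, norm_mul, hz, one_mul, RCLike.norm_conj]

end PartialFractions

/-! ### The embedding of the scalars into the complex numbers -/

section Embedding

variable {𝕜 : Type*} [RCLike 𝕜]

/-- `RCLike.map 𝕜 ℂ` as a ring homomorphism. -/
def toC (𝕜 : Type*) [RCLike 𝕜] : 𝕜 →+* ℂ where
  toFun := RCLike.map 𝕜 ℂ
  map_one' := by simp
  map_zero' := by simp
  map_add' x y := map_add _ x y
  map_mul' x y := by
    rcases RCLike.I_eq_zero_or_im_I_eq_one (K := 𝕜) with h | h
    · apply Complex.ext <;> simp [RCLike.im_eq_zero h]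
    · apply Complex.ext <;> simp

theorem coe_toC : (toC 𝕜 : 𝕜 → ℂ) = RCLike.map 𝕜 ℂ := rfl

theorem toC_apply (x : 𝕜) : toC 𝕜 x = RCLike.re x + RCLike.im x * Complex.I := rfl

theorem norm_toC (x : 𝕜) : ‖toC 𝕜 x‖ = ‖x‖ := RCLike.norm_to_complex x

theorem toC_conj (x : 𝕜) : toC 𝕜 (conj x) = conj (toC 𝕜 x) := by
  simp [toC_apply]

/-- Whether `RCLike.I` vanishes is the test that separates the real from the complex case
throughout. -/
theorem toC_surjective (h : (RCLike.I : 𝕜) ≠ 0) : Function.Surjective (toC 𝕜) := by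
  have h1 := (RCLike.I_eq_zero_or_im_I_eq_one (K := 𝕜)).resolve_left h
  exact (RCLike.complexLinearIsometryEquiv h1).surjective

theorem mem_range_toC_of_conj_eq {z : ℂ} (hz : conj z = z) : ∃ x, toC 𝕜 x = z :=
  ⟨(z.re : 𝕜), by rw [toC_apply]; simp [Complex.conj_eq_iff_re.1 hz]⟩

theorem conj_toC_of_I_eq_zero (h : (RCLike.I : 𝕜) = 0) (x : 𝕜) : conj (toC 𝕜 x) = toC 𝕜 x := by
  rw [← toC_conj, RCLike.conj_eq_iff_im.2 (RCLike.im_eq_zero h x)]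

end Embedding

/-! ### Realization -/

section Realization

open Matrix

variable {𝕜 : Type*} [RCLike 𝕜] {n m p q : ℕ}

/-- Allows a transfer function to be read off from an explicit state response `X`, without computing
an inverse. -/
theorem transfer_eq_of_mul_eq (S : StateSpace 𝕜 n m p) {z : ℂ} (hz : z ∉ spectrum ℂ S.AC)
    {X : Matrix (Fin n) (Fin m) ℂ}
    (hX : (z • (1 : Matrix (Fin n) (Fin n) ℂ) - S.AC) * X = S.B.map (toC 𝕜)) :
    S.transfer z = S.C.map (toC 𝕜) * X := by
  rw [spectrum.notMem_iff, Algebra.algebraMap_eq_smul_one, Matrix.isUnit_iff_isUnit_det] at hz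
  rw [StateSpace.transfer, ← coe_toC, ← hX, ← Matrix.mul_assoc, Matrix.mul_assoc (S.C.map _),
    Matrix.nonsing_inv_mul _ hz, Matrix.mul_one]

/-- The transposed model. -/
def StateSpace.transpose (S : StateSpace 𝕜 n m p) : StateSpace 𝕜 n p m := ⟨S.Aᵀ, S.Cᵀ, S.Bᵀ⟩

theorem transfer_transpose (S : StateSpace 𝕜 n m p) (z : ℂ) :
    S.transpose.transfer z = (S.transfer z)ᵀ := by
  simp only [StateSpace.transfer, StateSpace.AC, StateSpace.transpose, transpose_mul,
    transpose_nonsing_inv, transpose_sub, transpose_smul, transpose_one, transpose_map]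
  rw [Matrix.mul_assoc]

theorem notMem_spectrum_transpose {S : StateSpace 𝕜 n m p} {z : ℂ}
    (hz : z ∉ spectrum ℂ S.transpose.AC) : z ∉ spectrum ℂ S.AC := by
  rw [spectrum.notMem_iff, Algebra.algebraMap_eq_smul_one, Matrix.isUnit_iff_isUnit_det] at hz ⊢
  rwa [← det_transpose, transpose_sub, transpose_smul, transpose_one]

/-- The companion matrix of `X ^ q + ∑ i, a_i X ^ i`. -/
def companionMatrix (a : Fin q → 𝕜) : Matrix (Fin q) (Fin q) 𝕜 := fun i j =>
  if (i : ℕ) + 1 = q then - a j else if (i : ℕ) + 1 = j then 1 else 0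

/-- The block companion matrix with `m` inputs. -/
def blockCompanion (m : ℕ) (a : Fin q → 𝕜) : Matrix (Fin q × Fin m) (Fin q × Fin m) 𝕜 :=
  fun x y => if x.2 = y.2 then companionMatrix a x.1 y.1 else 0

/-- The input matrix of the block companion form. -/
def blockInput (𝕜 : Type*) [RCLike 𝕜] (q m : ℕ) : Matrix (Fin q × Fin m) (Fin m) 𝕜 :=
  fun x s => if (x.1 : ℕ) + 1 = q ∧ x.2 = s then 1 else 0

/-- The `0`-`1` matrix of a map of index sets. -/
def embedMatrix (R : Type*) [Zero R] [One R] {α β : Type*} [DecidableEq β] (e : α → β) :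
    Matrix β α R := fun x y => if x = e y then 1 else 0

theorem embedMatrix_transpose_mul {α β : Type*} [DecidableEq α] [DecidableEq β] [Fintype β]
    {e : α → β} (he : Function.Injective e) :
    (embedMatrix ℂ e)ᵀ * embedMatrix ℂ e = 1 := by
  ext x y
  rw [Matrix.mul_apply, Finset.sum_eq_single (e x)]
  · simp [embedMatrix, Matrix.one_apply, he.eq_iff]
  · intro b _ hb
    simp [embedMatrix, hb]
  · simp

theorem embedMatrix_map_toC {α β : Type*} [DecidableEq β] (e : α → β) :
    (embedMatrix 𝕜 e).map (toC 𝕜) = embedMatrix ℂ e := by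
  ext x y
  simp only [embedMatrix, Matrix.map_apply]
  split_ifs <;> simp

/-- The state response of the block companion form with denominator value `d`. -/
def blockResponse (q m : ℕ) (z d : ℂ) : Matrix (Fin q × Fin m) (Fin m) ℂ :=
  fun x s => if x.2 = s then z ^ (x.1 : ℕ) / d else 0

theorem sum_companionMatrix_mul (a : Fin q → ℂ) (i : Fin q) (z : ℂ) :
    ∑ j, companionMatrix a i j * z ^ (j : ℕ) =
      if (i : ℕ) + 1 = q then - ∑ j, a j * z ^ (j : ℕ) else z ^ ((i : ℕ) + 1) := by
  unfold companionMatrix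
  split_ifs with h
  · simp
  · have hi : (i : ℕ) + 1 < q := lt_of_le_of_ne i.2 h
    rw [Finset.sum_eq_single (⟨(i : ℕ) + 1, hi⟩ : Fin q)]
    · simp
    · intro j _ hj
      rw [if_neg, zero_mul]
      exact fun h' => hj (Fin.ext h'.symm)
    · simp

/-- The companion matrix shifts the vector of powers of `z`, so all block rows cancel except the
last, where the denominator itself is left and divides out. -/
theorem blockCompanion_mul_eq (a : Fin q → ℂ) {z : ℂ}
    (hz : z ^ q + ∑ i, a i * z ^ (i : ℕ) ≠ 0) :
    (z • (1 : Matrix (Fin q × Fin m) (Fin q × Fin m) ℂ) - blockCompanion m a) *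
      blockResponse q m z (z ^ q + ∑ i, a i * z ^ (i : ℕ)) = blockInput ℂ q m := by
  set d := z ^ q + ∑ i, a i * z ^ (i : ℕ) with hd
  ext ⟨i, s⟩ t
  rw [Matrix.sub_mul, Matrix.sub_apply, Matrix.smul_mul, Matrix.one_mul, Matrix.smul_apply,
    Matrix.mul_apply, Fintype.sum_prod_type]
  have h1 : ∀ j : Fin q, ∑ s', blockCompanion m a (i, s) (j, s') *
      (if s' = t then z ^ (j : ℕ) / d else 0) =
      if s = t then companionMatrix a i j * z ^ (j : ℕ) / d else 0 := by
    intro j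
    rw [Finset.sum_eq_single t]
    · simp only [blockCompanion, if_true]
      split_ifs <;> ring
    · intro s' _ hs'
      simp [hs']
    · simp
  simp only [blockResponse, h1, blockInput]
  by_cases hst : s = t
  · simp only [hst, if_true, and_true]
    rw [← Finset.sum_div, sum_companionMatrix_mul]
    split_ifs with h
    · rw [smul_eq_mul, ← mul_div_assoc, ← pow_succ', h, ← sub_div, sub_neg_eq_add, div_self hz]
    · rw [smul_eq_mul, ← mul_div_assoc, ← pow_succ', sub_self]
  · simp [hst]

/-- A block companion form of order `q * m` with numerator coefficients in the output matrix, padded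
to dimension `n` by zero rows and columns along the embedding `e`. -/
theorem exists_realization_of_mul_le_left (hn : q * m ≤ n) (a : Fin q → 𝕜)
    (N : Fin p → Fin m → Fin q → 𝕜) :
    ∃ T : StateSpace 𝕜 n m p, ∀ z, z ∉ spectrum ℂ T.AC →
      z ^ q + ∑ i, toC 𝕜 (a i) * z ^ (i : ℕ) ≠ 0 → ∀ i j, T.transfer z i j =
        (∑ k, toC 𝕜 (N i j k) * z ^ (k : ℕ)) / (z ^ q + ∑ i, toC 𝕜 (a i) * z ^ (i : ℕ)) := by
  obtain ⟨e⟩ : Nonempty (Fin q × Fin m ↪ Fin n) :=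
    Function.Embedding.nonempty_of_card_le (by simpa using hn)
  have hEE := embedMatrix_transpose_mul e.injective
  have hEmap := embedMatrix_map_toC (𝕜 := 𝕜) e
  have hEt : (embedMatrix 𝕜 e)ᵀ.map (toC 𝕜) = (embedMatrix ℂ e)ᵀ := by rw [← hEmap]; rfl
  have hA : (blockCompanion m a).map (toC 𝕜) = blockCompanion m (fun i => toC 𝕜 (a i)) := by
    ext x y
    simp only [blockCompanion, companionMatrix, Matrix.map_apply]
    split_ifs <;> simp
  have hB : (blockInput 𝕜 q m).map (toC 𝕜) = blockInput ℂ q m := by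
    ext x y
    simp only [blockInput, Matrix.map_apply]
    split_ifs <;> simp
  set C₀ : Matrix (Fin p) (Fin q × Fin m) 𝕜 := fun i x => N i x.2 x.1 with hC₀
  refine ⟨⟨embedMatrix 𝕜 e * blockCompanion m a * (embedMatrix 𝕜 e)ᵀ, embedMatrix 𝕜 e * blockInput 𝕜 q m, C₀ * (embedMatrix 𝕜 e)ᵀ⟩,
    fun z hz hd i j => ?_⟩
  set d := z ^ q + ∑ i, toC 𝕜 (a i) * z ^ (i : ℕ)
  rw [transfer_eq_of_mul_eq _ hz (X := embedMatrix ℂ e * blockResponse q m z d)]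
  · simp only [Matrix.map_mul, hEt]
    rw [Matrix.mul_assoc, ← Matrix.mul_assoc _ (embedMatrix ℂ e), hEE, Matrix.one_mul, Matrix.mul_apply,
      Fintype.sum_prod_type, Finset.sum_div]
    refine Finset.sum_congr rfl fun k _ => ?_
    rw [Finset.sum_eq_single j]
    · rw [Matrix.map_apply]
      simp [blockResponse, hC₀, mul_div_assoc]
    · intro s _ hs
      simp [blockResponse, hs]
    · simp
  · have h := blockCompanion_mul_eq (m := m) (fun i => toC 𝕜 (a i)) hd
    rw [Matrix.sub_mul, Matrix.smul_mul, Matrix.one_mul] at h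
    simp only [StateSpace.AC, ← coe_toC, Matrix.map_mul, hEt, hEmap, hA, hB]
    rw [← h, Matrix.sub_mul, Matrix.smul_mul, Matrix.one_mul, Matrix.mul_assoc (_ * _),
      ← Matrix.mul_assoc _ (embedMatrix ℂ e), hEE, Matrix.one_mul, Matrix.mul_sub,
      Matrix.mul_smul, Matrix.mul_assoc]

/-- With fewer outputs than inputs, the transposed transfer matrix is realized and the model is
dualized, which costs `q * p` states in place of `q * m`. -/
theorem exists_realization (hn : q * min p m ≤ n) (a : Fin q → 𝕜)
    (N : Fin p → Fin m → Fin q → 𝕜) :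
    ∃ T : StateSpace 𝕜 n m p, ∀ z, z ∉ spectrum ℂ T.AC →
      z ^ q + ∑ i, toC 𝕜 (a i) * z ^ (i : ℕ) ≠ 0 → ∀ i j, T.transfer z i j =
        (∑ k, toC 𝕜 (N i j k) * z ^ (k : ℕ)) / (z ^ q + ∑ i, toC 𝕜 (a i) * z ^ (i : ℕ)) := by
  rcases le_total p m with h | h
  · rw [min_eq_left h] at hn
    obtain ⟨T, hT⟩ := exists_realization_of_mul_le_left hn a (fun i j => N j i)
    refine ⟨T.transpose, fun z hz hd i j => ?_⟩
    rw [transfer_transpose, transpose_apply]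
    exact hT z (notMem_spectrum_transpose hz) hd j i
  · rw [min_eq_right h] at hn
    exact exists_realization_of_mul_le_left hn a N

end Realization

/-! ### Fourier coefficients on the unit circle -/

section Fourier

open Complex

/-- The mean over the unit circle, parametrized by the angle. -/
def circleMean {E : Type*} [NormedAddCommGroup E] [NormedSpace ℝ E] (g : ℝ → E) : E :=
  (2 * Real.pi)⁻¹ • ∫ w in (0 : ℝ)..(2 * Real.pi), g w

theorem circleMean_exp_int (k : ℤ) :
    circleMean (fun w => Complex.exp (k * w * I)) = if k = 0 then 1 else 0 := by
  unfold circleMean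
  split_ifs with h
  · simp only [h, Int.cast_zero, zero_mul, Complex.exp_zero, intervalIntegral.integral_const,
      sub_zero, smul_smul]
    rw [inv_mul_cancel₀ Real.two_pi_pos.ne', one_smul]
  · have hk : (k : ℂ) * I ≠ 0 := mul_ne_zero (by exact_mod_cast h) I_ne_zero
    have : ∀ w : ℝ, Complex.exp (k * w * I) = Complex.exp (k * I * w) := fun w => by ring_nf
    simp only [this]
    rw [integral_exp_mul_complex hk]
    have h1 : Complex.exp (k * I * (2 * Real.pi : ℝ)) = 1 := by
      rw [Complex.exp_eq_one_iff]
      exact ⟨k, by push_cast; ring⟩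
    rw [h1]
    simp

theorem circleMean_exp_mul_exp (k l : ℕ) :
    circleMean (fun w => Complex.exp (k * w * I) * Complex.exp (-(l * w * I))) =
      if k = l then 1 else 0 := by
  have : ∀ w : ℝ, Complex.exp (k * w * I) * Complex.exp (-(l * w * I)) =
      Complex.exp (((k : ℤ) - (l : ℤ) : ℤ) * w * I) := fun w => by
    rw [← Complex.exp_add]
    push_cast
    ring_nf
  simp only [this, circleMean_exp_int, sub_eq_zero, Nat.cast_inj]

theorem conj_exp_mul_I (k : ℕ) (w : ℝ) :
    conj (Complex.exp (k * w * I)) = Complex.exp (-(k * w * I)) := by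
  rw [← Complex.exp_conj]
  simp

theorem circleMean_add {E : Type*} [NormedAddCommGroup E] [NormedSpace ℝ E] {f g : ℝ → E}
    (hf : IntervalIntegrable f volume 0 (2 * Real.pi))
    (hg : IntervalIntegrable g volume 0 (2 * Real.pi)) :
    circleMean (fun w => f w + g w) = circleMean f + circleMean g := by
  rw [circleMean, intervalIntegral.integral_add hf hg, smul_add]; rfl

theorem circleMean_sub {E : Type*} [NormedAddCommGroup E] [NormedSpace ℝ E] {f g : ℝ → E}
    (hf : IntervalIntegrable f volume 0 (2 * Real.pi))
    (hg : IntervalIntegrable g volume 0 (2 * Real.pi)) :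
    circleMean (fun w => f w - g w) = circleMean f - circleMean g := by
  rw [circleMean, intervalIntegral.integral_sub hf hg, smul_sub]; rfl

theorem circleMean_sum {E ι : Type*} [NormedAddCommGroup E] [NormedSpace ℝ E] {s : Finset ι}
    {f : ι → ℝ → E} (hf : ∀ i ∈ s, IntervalIntegrable (f i) volume 0 (2 * Real.pi)) :
    circleMean (fun w => ∑ i ∈ s, f i w) = ∑ i ∈ s, circleMean (f i) := by
  rw [circleMean, intervalIntegral.integral_finsetSum hf, Finset.smul_sum]; rfl

theorem circleMean_const_mul (a : ℂ) (f : ℝ → ℂ) :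
    circleMean (fun w => a * f w) = a * circleMean f := by
  rw [circleMean, intervalIntegral.integral_const_mul, ← mul_smul_comm]; rfl

theorem circleMean_nonneg {f : ℝ → ℝ} (hf : ∀ w, 0 ≤ f w) : 0 ≤ circleMean f :=
  mul_nonneg (inv_nonneg.2 Real.two_pi_pos.le)
    (intervalIntegral.integral_nonneg Real.two_pi_pos.le fun w _ => hf w)

theorem circleMean_ofReal (f : ℝ → ℝ) :
    circleMean (fun w => (f w : ℂ)) = ((circleMean f : ℝ) : ℂ) := by
  simp [circleMean, intervalIntegral.integral_ofReal]

theorem circleMean_re {f : ℝ → ℂ} (hf : IntervalIntegrable f volume 0 (2 * Real.pi)) :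
    circleMean (fun w => (f w).re) = (circleMean f).re := by
  rw [circleMean, circleMean, Complex.smul_re]
  congr 1
  exact Complex.reCLM.intervalIntegral_comp_comm hf

theorem circleMean_congr_ae {E : Type*} [NormedAddCommGroup E] [NormedSpace ℝ E] {f g : ℝ → E}
    (h : ∀ᵐ w, f w = g w) : circleMean f = circleMean g := by
  rw [circleMean, circleMean, intervalIntegral.integral_congr_ae (h.mono fun w hw _ => hw)]

/-- The trigonometric polynomial with coefficients `a_k`, `k < t`. -/
def trigPoly (a : ℕ → ℂ) (t : ℕ) (w : ℝ) : ℂ :=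
  ∑ k ∈ Finset.range t, a k * Complex.exp (k * w * I)

theorem continuous_trigPoly (a : ℕ → ℂ) (t : ℕ) : Continuous (trigPoly a t) := by
  unfold trigPoly
  fun_prop

theorem circleMean_mul_conj_trigPoly {g : ℝ → ℂ} (hg : Continuous g) (a : ℕ → ℂ) (t : ℕ) :
    circleMean (fun w => g w * conj (trigPoly a t w)) =
      ∑ k ∈ Finset.range t, conj (a k) * circleMean fun w => g w * Complex.exp (-(k * w * I)) := by
  have : ∀ w, g w * conj (trigPoly a t w) =
      ∑ k ∈ Finset.range t, conj (a k) * (g w * Complex.exp (-(k * w * I))) := fun w => by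
    rw [trigPoly, map_sum, Finset.mul_sum]
    refine Finset.sum_congr rfl fun k _ => ?_
    rw [map_mul, conj_exp_mul_I]
    ring
  simp only [this]
  rw [circleMean_sum fun k _ => (Continuous.intervalIntegrable (by fun_prop) _ _)]
  simp only [circleMean_const_mul]

theorem circleMean_trigPoly_mul_exp (a : ℕ → ℂ) {t k : ℕ} (hk : k < t) :
    circleMean (fun w => trigPoly a t w * Complex.exp (-(k * w * I))) = a k := by
  simp only [trigPoly, Finset.sum_mul, mul_assoc]
  rw [circleMean_sum fun k _ => (Continuous.intervalIntegrable (by fun_prop) _ _)]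
  simp only [circleMean_const_mul]
  have := fun l : ℕ => circleMean_exp_mul_exp l k
  simp only [mul_assoc] at this
  simp only [this]
  simp [hk]

/-- Parseval's identity for trigonometric polynomials. -/
theorem circleMean_norm_trigPoly_sq (a : ℕ → ℂ) (t : ℕ) :
    circleMean (fun w => ‖trigPoly a t w‖ ^ 2) = ∑ k ∈ Finset.range t, ‖a k‖ ^ 2 := by
  have h := circleMean_mul_conj_trigPoly (continuous_trigPoly a t) a t
  rw [Finset.sum_congr rfl fun k hk => by
    rw [circleMean_trigPoly_mul_exp a (Finset.mem_range.1 hk), mul_comm]] at h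
  simp only [Complex.mul_conj, Complex.normSq_eq_norm_sq] at h
  rw [circleMean_ofReal] at h
  exact_mod_cast h

/-- Bessel's inequality. -/
theorem sum_norm_sq_le_circleMean {g : ℝ → ℂ} (hg : Continuous g) (a : ℕ → ℂ)
    (ha : ∀ k, a k = circleMean fun w => g w * Complex.exp (-(k * w * I))) (t : ℕ) :
    ∑ k ∈ Finset.range t, ‖a k‖ ^ 2 ≤ circleMean fun w => ‖g w‖ ^ 2 := by
  have hs := continuous_trigPoly a t
  have h0 : 0 ≤ circleMean fun w => ‖g w - trigPoly a t w‖ ^ 2 :=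
    circleMean_nonneg fun w => by positivity
  have h1 : ∀ w, ‖g w - trigPoly a t w‖ ^ 2 =
      ‖g w‖ ^ 2 + ‖trigPoly a t w‖ ^ 2 - 2 * (g w * conj (trigPoly a t w)).re := fun w => by
    rw [← Complex.normSq_eq_norm_sq, Complex.normSq_sub, Complex.normSq_eq_norm_sq,
      Complex.normSq_eq_norm_sq]
  have hc : Continuous fun w => g w * conj (trigPoly a t w) :=
    hg.mul (Complex.continuous_conj.comp hs)
  have h2 : circleMean (fun w => 2 * (g w * conj (trigPoly a t w)).re) =
      2 * ∑ k ∈ Finset.range t, ‖a k‖ ^ 2 := by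
    rw [circleMean, intervalIntegral.integral_const_mul, ← mul_smul_comm]
    have := circleMean_re (hc.intervalIntegrable 0 (2 * Real.pi))
    rw [circleMean] at this
    rw [this, circleMean_mul_conj_trigPoly hg]
    simp only [← ha]
    simp only [mul_comm (conj _), Complex.mul_conj, Complex.normSq_eq_norm_sq]
    norm_cast
  simp only [h1] at h0
  rw [circleMean_sub (Continuous.intervalIntegrable (by fun_prop) _ _)
    (Continuous.intervalIntegrable (by fun_prop) _ _),
    circleMean_add (Continuous.intervalIntegrable (by fun_prop) _ _)
    (Continuous.intervalIntegrable (by fun_prop) _ _), h2, circleMean_norm_trigPoly_sq] at h0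
  linarith

/-- The power series coefficients of a function that is holomorphic on the closed unit disk are its
Fourier coefficients on the circle. -/
theorem coeff_eq_circleMean {f : ℂ → ℂ} (hf : DifferentiableOn ℂ f (Metric.closedBall 0 1))
    {a : ℕ → ℂ} (ha : ∀ᶠ w in 𝓝 (0 : ℂ), HasSum (fun n => w ^ n * a n) (f w)) (n : ℕ) :
    a n = circleMean fun w => f (Complex.exp (w * I)) * Complex.exp (-(n * w * I)) := by
  -- The Cauchy series of radius `1` and the given series represent `f` near `0`, hence coincide,
  -- and Cauchy's integral over the unit circle is the Fourier integral.
  have h1 : HasFPowerSeriesAt f (cauchyPowerSeries f 0 1) 0 :=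
    (DifferentiableOn.hasFPowerSeriesOnBall (R := 1) (by simpa using hf) one_pos).hasFPowerSeriesAt
  have h2 : HasFPowerSeriesAt f (FormalMultilinearSeries.ofScalars ℂ a) 0 := by
    rw [hasFPowerSeriesAt_iff]
    filter_upwards [ha] with w hw
    simpa [FormalMultilinearSeries.coeff_ofScalars] using hw
  have h3 := h1.eq_formalMultilinearSeries h2
  have h4 := congrArg (fun p => FormalMultilinearSeries.coeff p n) h3
  simp only [FormalMultilinearSeries.coeff_ofScalars] at h4
  rw [← h4]
  have h5 : (cauchyPowerSeries f 0 1).coeff n = cauchyPowerSeries f 0 1 n fun _ => 1 := rfl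
  have h6 : ∀ θ : ℝ, deriv (circleMap 0 1) θ • (1 / (circleMap 0 1 θ - 0)) ^ n •
      (circleMap 0 1 θ - 0)⁻¹ • f (circleMap 0 1 θ) =
      I * (f (Complex.exp (θ * I)) * Complex.exp (-(n * θ * I))) := fun θ => by
    have h7 : Complex.exp (-(n * θ * I)) = (Complex.exp (θ * I))⁻¹ ^ n := by
      rw [← Complex.exp_neg, ← Complex.exp_nat_mul]
      ring_nf
    rw [deriv_circleMap, h7]
    simp only [circleMap, ofReal_one, one_mul, zero_add, sub_zero, one_div, smul_eq_mul]
    have := Complex.exp_ne_zero (θ * I)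
    field_simp
  rw [h5, cauchyPowerSeries_apply, circleIntegral, circleMean]
  simp only [h6]
  rw [intervalIntegral.integral_const_mul, smul_eq_mul, Complex.real_smul, ← mul_assoc]
  congr 1
  push_cast
  field_simp

end Fourier

/-! ### Markov parameters -/

section Markov

variable {𝕜 : Type*} [RCLike 𝕜] {n m p q κ : ℕ}

/-- The Markov parameter `C A ^ k B`. -/
def markov (S : StateSpace 𝕜 n m p) (k : ℕ) : Matrix (Fin p) (Fin m) 𝕜 := S.C * S.A ^ k * S.B

theorem markov_map_toC (S : StateSpace 𝕜 n m p) (k : ℕ) :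
    (markov S k).map (toC 𝕜) = S.C.map (toC 𝕜) * S.AC ^ k * S.B.map (toC 𝕜) := by
  rw [markov, Matrix.map_mul, Matrix.map_mul, StateSpace.AC, ← coe_toC, Matrix.map_pow]

/-- Neumann series for `w⁻¹ - A = w⁻¹ (1 - w A)`. Convergence is phrased through linear functionals
because a norm on matrices is chosen only inside the proof. -/
theorem exists_forall_norm_hasSum_resolvent (A : Matrix (Fin n) (Fin n) ℂ) :
    ∃ ε > 0, ∀ w : ℂ, w ≠ 0 → ‖w‖ < ε → w⁻¹ ∉ spectrum ℂ A ∧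
      ∀ L : Matrix (Fin n) (Fin n) ℂ →ₗ[ℂ] ℂ,
        HasSum (fun k => w ^ (k + 1) * L (A ^ k))
          (L (w⁻¹ • (1 : Matrix (Fin n) (Fin n) ℂ) - A)⁻¹) := by
  let : NormedRing (Matrix (Fin n) (Fin n) ℂ) := Matrix.linftyOpNormedRing
  let : NormedAlgebra ℂ (Matrix (Fin n) (Fin n) ℂ) := Matrix.linftyOpNormedAlgebra
  have : CompleteSpace (Matrix (Fin n) (Fin n) ℂ) := FiniteDimensional.complete ℂ _
  refine ⟨(‖A‖ + 1)⁻¹, by positivity, fun w hw hwε => ?_⟩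
  have h1 : ‖w • A‖ < 1 := by
    rw [norm_smul]
    have h2 : ‖w‖ * (‖A‖ + 1) < 1 := by
      rwa [← lt_inv_mul_iff₀' (by positivity), mul_one]
    have := norm_pos_iff.2 hw
    nlinarith
  have h3 := mul_neg_geom_series (w • A) h1
  set s := ∑' k, (w • A) ^ k with hs
  have h4 : (w⁻¹ • (1 : Matrix (Fin n) (Fin n) ℂ) - A) * (w • s) = 1 := by
    have h5 : w⁻¹ • (1 : Matrix (Fin n) (Fin n) ℂ) - A = w⁻¹ • (1 - w • A) := by
      rw [smul_sub, smul_smul, inv_mul_cancel₀ hw, one_smul]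
    rw [h5, Matrix.mul_smul, Matrix.smul_mul, smul_smul, mul_inv_cancel₀ hw, one_smul]
    exact h3
  refine ⟨?_, fun L => ?_⟩
  · rw [spectrum.notMem_iff, Algebra.algebraMap_eq_smul_one]
    exact (Matrix.isUnit_iff_isUnit_det _).2 (Matrix.isUnit_det_of_right_inverse h4)
  · rw [Matrix.inv_eq_right_inv h4]
    have h5 : HasSum (fun k => (w • A) ^ k) s := (summable_geometric_of_norm_lt_one h1).hasSum
    have h6 := (h5.const_smul w).mapL (LinearMap.toContinuousLinearMap L)
    refine h6.congr_fun fun k => ?_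
    simp [smul_pow, pow_succ', mul_assoc]

theorem exists_forall_norm_hasSum_transfer (S : StateSpace 𝕜 n m p) :
    ∃ ε > 0, ∀ w : ℂ, w ≠ 0 → ‖w‖ < ε → w⁻¹ ∉ spectrum ℂ S.AC ∧
      ∀ i j, HasSum (fun k => w ^ (k + 1) * toC 𝕜 (markov S k i j)) (S.transfer w⁻¹ i j) := by
  obtain ⟨ε, hε, h⟩ := exists_forall_norm_hasSum_resolvent S.AC
  refine ⟨ε, hε, fun w hw hwε => ⟨(h w hw hwε).1, fun i j => ?_⟩⟩
  let L : Matrix (Fin n) (Fin n) ℂ →ₗ[ℂ] ℂ :=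
    { toFun := fun M => (S.C.map (toC 𝕜) * M * S.B.map (toC 𝕜)) i j
      map_add' := fun M N => by rw [Matrix.mul_add, Matrix.add_mul]; rfl
      map_smul' := fun c M => by rw [Matrix.mul_smul, Matrix.smul_mul]; rfl }
  have := (h w hw hwε).2 L
  have h2 : ∀ k, toC 𝕜 (markov S k i j) = L (S.AC ^ k) := fun k => by
    rw [← Matrix.map_apply (f := toC 𝕜), markov_map_toC]; rfl
  simp only [h2]
  exact this

end Markov

/-! ### The `H₂` norm of the approximation error -/

section HTwo

open Complex

variable {𝕜 : Type*} [RCLike 𝕜] {n m p q κ : ℕ}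

/-- The rational function `∑ j, R_j / (z - pole_j)`. -/
def poleSum (pole : Fin κ → ℂ) (R : Fin κ → Matrix (Fin p) (Fin m) ℂ) (z : ℂ) :
    Matrix (Fin p) (Fin m) ℂ := ∑ j, (1 / (z - pole j)) • R j

/-- `F(1 / w)` for `F(z) = ∑ j, R_j / (z - pole_j) - ∑ k, Q_k V_k(z)`, in a form that is holomorphic
on the closed unit disk. -/
def reciprocalError (pole : Fin κ → ℂ) (R : Fin κ → Matrix (Fin p) (Fin m) ℂ) (μ : Fin q → ℂ)
    (Q : Fin q → Matrix (Fin p) (Fin m) ℂ) (i : Fin p) (j : Fin m) (w : ℂ) : ℂ :=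
  ∑ l, w / (1 - pole l * w) * R l i j -
    ∑ k, (w / (1 - μ k * w)) ^ poleOrder μ k * Q k i j

theorem one_sub_mul_ne_zero {a w : ℂ} (ha : ‖a‖ < 1) (hw : ‖w‖ ≤ 1) : 1 - a * w ≠ 0 := by
  simpa using one_sub_conj_mul_ne_zero (w := conj a) hw (by simpa using ha)

theorem differentiableOn_reciprocalError {pole : Fin κ → ℂ} (hpole : ∀ j, ‖pole j‖ < 1)
    (R : Fin κ → Matrix (Fin p) (Fin m) ℂ) {μ : Fin q → ℂ} (hμ : ∀ k, ‖μ k‖ < 1)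
    (Q : Fin q → Matrix (Fin p) (Fin m) ℂ) (i : Fin p) (j : Fin m) :
    DifferentiableOn ℂ (reciprocalError pole R μ Q i j) (Metric.closedBall 0 1) := by
  intro w hw
  have hw1 : ‖w‖ ≤ 1 := by simpa using hw
  refine DifferentiableAt.differentiableWithinAt ?_
  unfold reciprocalError
  have hdiv : ∀ a : ℂ, ‖a‖ < 1 → DifferentiableAt ℂ (fun w => w / (1 - a * w)) w := fun a ha =>
    DifferentiableAt.div (by fun_prop) (by fun_prop) (one_sub_mul_ne_zero ha hw1)
  exact DifferentiableAt.sub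
    (DifferentiableAt.fun_sum fun l _ => (hdiv _ (hpole l)).mul_const _)
    (DifferentiableAt.fun_sum fun k _ => ((hdiv _ (hμ k)).pow _).mul_const _)

theorem reciprocalError_eq (pole : Fin κ → ℂ) (R : Fin κ → Matrix (Fin p) (Fin m) ℂ)
    (μ : Fin q → ℂ) (Q : Fin q → Matrix (Fin p) (Fin m) ℂ) (i : Fin p) (j : Fin m) {w : ℂ}
    (hw : w ≠ 0) :
    reciprocalError pole R μ Q i j w = (poleSum pole R w⁻¹ - obfModel μ Q w⁻¹) i j := by
  have h : ∀ a : ℂ, w / (1 - a * w) = 1 / (w⁻¹ - a) := fun a => by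
    rw [← mul_div_mul_left 1 _ hw, mul_one, mul_sub, mul_inv_cancel₀ hw, mul_comm w a]
  simp only [reciprocalError, poleSum, obfModel, basisFun, Matrix.sub_apply, Matrix.sum_apply,
    Matrix.smul_apply, smul_eq_mul, h, div_pow, one_pow]

/-- Fibres of `w ↦ exp (w * I)` are empty or translates of `2πℤ`, hence countable. -/
theorem ae_exp_mul_I_notMem {s : Set ℂ} (hs : s.Finite) :
    ∀ᵐ w : ℝ, Complex.exp (w * I) ∉ s := by
  have hc : {w : ℝ | Complex.exp (w * I) ∈ s}.Countable := by
    have : {w : ℝ | Complex.exp (w * I) ∈ s} = ⋃ a ∈ s, {w : ℝ | Complex.exp (w * I) = a} := by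
      ext; simp
    rw [this]
    refine hs.countable.biUnion fun a _ => ?_
    rcases Set.eq_empty_or_nonempty {w : ℝ | Complex.exp (w * I) = a} with h | ⟨w₀, h₀⟩
    · simp [h]
    · refine (Set.countable_range fun k : ℤ => w₀ + k * (2 * Real.pi)).mono fun w hw => ?_
      obtain ⟨k, hk⟩ := Complex.exp_eq_exp_iff_exists_int.1 ((hw : _ = a).trans (h₀ : _ = a).symm)
      refine ⟨k, ?_⟩
      have h2 : (w : ℂ) = w₀ + k * (2 * Real.pi) := by
        apply mul_right_cancel₀ I_ne_zero
        linear_combination hk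
      exact_mod_cast h2.symm
  exact hc.ae_notMem _

theorem h2Norm_eq (F : ℂ → Matrix (Fin p) (Fin m) ℂ) :
    h2Norm F = Real.sqrt (circleMean fun w => frob (F (Complex.exp (w * I))) ^ 2) := rfl

theorem h2Norm_sq (F : ℂ → Matrix (Fin p) (Fin m) ℂ) :
    h2Norm F ^ 2 = circleMean fun w => frob (F (Complex.exp (w * I))) ^ 2 := by
  rw [h2Norm_eq, Real.sq_sqrt (circleMean_nonneg fun w => sq_nonneg _)]

theorem h2Norm_congr {F F' : ℂ → Matrix (Fin p) (Fin m) ℂ} {s : Set ℂ} (hs : s.Finite)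
    (h : ∀ z, ‖z‖ = 1 → z ∉ s → F z = F' z) : h2Norm F = h2Norm F' := by
  rw [h2Norm_eq, h2Norm_eq, circleMean_congr_ae]
  filter_upwards [ae_exp_mul_I_notMem hs] with w hw
  rw [h _ (Complex.norm_exp_ofReal_mul_I w) hw]

theorem ne_of_norm_eq_one {z a : ℂ} (hz : ‖z‖ = 1) (ha : ‖a‖ < 1) : z ≠ a := by
  rintro rfl
  linarith

/-- The state matrix may have eigenvalues on the circle that are not poles, where `transfer` is
meaningless. They are finitely many and do not affect the norm. -/
theorem h2Norm_transfer_sub {S : StateSpace 𝕜 n m p} {pole : Fin κ → ℂ}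
    {R : Fin κ → Matrix (Fin p) (Fin m) ℂ} (hS : HasSimplePoles S pole R)
    (hpole : ∀ j, ‖pole j‖ < 1) (F : ℂ → Matrix (Fin p) (Fin m) ℂ) :
    h2Norm (fun z => S.transfer z - F z) = h2Norm (fun z => poleSum pole R z - F z) :=
  h2Norm_congr (Matrix.finite_spectrum S.AC) fun z hz hzs => by
    rw [hS.2.2 z hzs fun j => ne_of_norm_eq_one hz (hpole j), poleSum]

theorem frob_sq {a b : ℕ} (M : Matrix (Fin a) (Fin b) 𝕜) :
    frob M ^ 2 = ∑ i, ∑ j, ‖M i j‖ ^ 2 :=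
  Real.sq_sqrt (Finset.sum_nonneg fun _ _ => Finset.sum_nonneg fun _ _ => sq_nonneg _)

/-- The differences of the Markov parameters are square summable, with sum bounded by the `H₂`
norm of the difference of the transfer functions. -/
theorem sum_frob_markov_sub_sq_le {S T : StateSpace 𝕜 n m p} {pole : Fin κ → ℂ}
    {R : Fin κ → Matrix (Fin p) (Fin m) ℂ} (hS : HasSimplePoles S pole R)
    (hpole : ∀ j, ‖pole j‖ < 1) {μ : Fin q → ℂ} (hμ : ∀ k, ‖μ k‖ < 1)
    {Q : Fin q → Matrix (Fin p) (Fin m) ℂ} (hT : Realizes T μ Q) (t : ℕ) :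
    ∑ k ∈ Finset.range t, frob (markov S k - markov T k) ^ 2 ≤
      h2Norm (fun z => S.transfer z - obfModel μ Q z) ^ 2 := by
  set f := reciprocalError pole R μ Q with hf
  have hd := differentiableOn_reciprocalError hpole R hμ Q
  -- `C A ^ k B` is the coefficient of `w ^ (k + 1)` in the transfer function at `1 / w`, hence the
  -- index shift and the zero constant term.
  set a : Fin p → Fin m → ℕ → ℂ := fun i j k =>
    if k = 0 then 0 else toC 𝕜 (markov S (k - 1) i j - markov T (k - 1) i j) with ha
  have hsum : ∀ i j, ∀ᶠ w in 𝓝 (0 : ℂ), HasSum (fun k => w ^ k * a i j k) (f i j w) := by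
    intro i j
    obtain ⟨ε₁, hε₁, h₁⟩ := exists_forall_norm_hasSum_transfer S
    obtain ⟨ε₂, hε₂, h₂⟩ := exists_forall_norm_hasSum_transfer T
    have hlt : ∀ ε > (0 : ℝ), ∀ᶠ w : ℂ in 𝓝 0, ‖w‖ < ε := fun ε hε =>
      Metric.eventually_nhds_iff.2 ⟨ε, hε, fun y hy => by simpa using hy⟩
    filter_upwards [hlt ε₁ hε₁, hlt ε₂ hε₂, hlt 1 one_pos] with w hw1 hw2 hw3
    rw [hasSum_nat_add_iff' 1 |>.symm]
    simp only [Finset.range_one, Finset.sum_singleton, ha, if_true, mul_zero, sub_zero,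
      Nat.add_eq_zero_iff, one_ne_zero, and_false, if_false, Nat.add_sub_cancel]
    rcases eq_or_ne w 0 with rfl | hw
    · simp [hf, reciprocalError, (poleOrder_pos _ _).ne', hasSum_zero]
    · have hinv : ∀ b : ℂ, ‖b‖ < 1 → w⁻¹ ≠ b := by
        rintro _ hb rfl
        rw [norm_inv] at hb
        have := (one_lt_inv₀ (norm_pos_iff.2 hw)).2 hw3
        linarith
      rw [hf, reciprocalError_eq _ _ _ _ _ _ hw, poleSum,
        ← hS.2.2 w⁻¹ (h₁ w hw hw1).1 fun j => hinv _ (hpole j),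
        ← hT w⁻¹ (h₂ w hw hw2).1 fun k => hinv _ (hμ k), Matrix.sub_apply]
      simp only [map_sub, mul_sub]
      exact ((h₁ w hw hw1).2 i j).sub ((h₂ w hw hw2).2 i j)
  have hcont : ∀ i j, Continuous fun w : ℝ => f i j (Complex.exp (w * I)) := fun i j =>
    (hd i j).continuousOn.comp_continuous (by fun_prop) fun w => by
      simp [Complex.norm_exp_ofReal_mul_I]
  have hbes : ∀ i j, ∑ k ∈ Finset.range t, ‖markov S k i j - markov T k i j‖ ^ 2 ≤
      circleMean fun w => ‖f i j (Complex.exp (w * I))‖ ^ 2 := fun i j => by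
    have := sum_norm_sq_le_circleMean (hcont i j) (a i j)
      (fun k => coeff_eq_circleMean (hd i j) (hsum i j) k) (t + 1)
    rw [Finset.sum_range_succ'] at this
    simpa [ha, norm_toC, ← map_sub] using this
  calc ∑ k ∈ Finset.range t, frob (markov S k - markov T k) ^ 2
      = ∑ i, ∑ j, ∑ k ∈ Finset.range t, ‖markov S k i j - markov T k i j‖ ^ 2 := by
        simp only [frob_sq, Matrix.sub_apply]
        rw [Finset.sum_comm]
        exact Finset.sum_congr rfl fun i _ => Finset.sum_comm
    _ ≤ ∑ i, ∑ j, circleMean fun w => ‖f i j (Complex.exp (w * I))‖ ^ 2 :=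
        Finset.sum_le_sum fun i _ => Finset.sum_le_sum fun j _ => hbes i j
    _ = circleMean fun w => ∑ i, ∑ j, ‖f i j (Complex.exp (w * I))‖ ^ 2 := by
        have hint : ∀ i j, IntervalIntegrable (fun w : ℝ => ‖f i j (Complex.exp (w * I))‖ ^ 2)
          volume 0 (2 * Real.pi) := fun i j =>
            Continuous.intervalIntegrable ((hcont i j).norm.pow 2) _ _
        rw [circleMean_sum (f := fun i w => ∑ j, ‖f i j (Complex.exp (w * I))‖ ^ 2) fun i _ =>
          Continuous.intervalIntegrable
            (continuous_finsetSum _ fun j _ => (hcont i j).norm.pow 2) _ _]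
        exact Finset.sum_congr rfl fun i _ => (circleMean_sum fun j _ => hint i j).symm
    -- The value of `f` at `exp (w * I)` is the error at the inverse point; reflecting the angle
    -- restores the norm.
    _ = circleMean fun w : ℝ => frob (poleSum pole R (Complex.exp ((2 * Real.pi - w : ℝ) * I)) -
          obfModel μ Q (Complex.exp ((2 * Real.pi - w : ℝ) * I))) ^ 2 := by
        congr 1
        ext w
        rw [frob_sq]
        refine Finset.sum_congr rfl fun i _ => Finset.sum_congr rfl fun j _ => ?_
        rw [hf, reciprocalError_eq _ _ _ _ _ _ (Complex.exp_ne_zero _), ← Complex.exp_neg]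
        have : Complex.exp ((2 * Real.pi - w : ℝ) * I) = Complex.exp (-(w * I)) := by
          rw [Complex.exp_eq_exp_iff_exists_int]
          exact ⟨1, by push_cast; ring⟩
        rw [this]
    _ = h2Norm (fun z => S.transfer z - obfModel μ Q z) ^ 2 := by
        rw [h2Norm_transfer_sub hS hpole, h2Norm_sq, circleMean, circleMean,
          intervalIntegral.integral_comp_sub_left (fun w : ℝ => frob (poleSum pole R
            (Complex.exp (w * I)) - obfModel μ Q (Complex.exp (w * I))) ^ 2)]
        simp

end HTwo

/-! ### The frobenius norm -/

section Frobenius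

variable {𝕜 : Type*} [RCLike 𝕜] {a b : ℕ}

theorem frob_nonneg (M : Matrix (Fin a) (Fin b) 𝕜) : 0 ≤ frob M := Real.sqrt_nonneg _

theorem frob_zero : frob (0 : Matrix (Fin a) (Fin b) 𝕜) = 0 := by simp [frob]

theorem frob_smul (c : 𝕜) (M : Matrix (Fin a) (Fin b) 𝕜) : frob (c • M) = ‖c‖ * frob M := by
  simp only [frob, Matrix.smul_apply, norm_smul, mul_pow, ← Finset.mul_sum]
  rw [Real.sqrt_mul (sq_nonneg _), Real.sqrt_sq (norm_nonneg _)]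

theorem frob_eq_norm (M : Matrix (Fin a) (Fin b) 𝕜) :
    frob M = ‖WithLp.toLp 2 fun x : Fin a × Fin b => M x.1 x.2‖ := by
  rw [frob, EuclideanSpace.norm_eq, Fintype.sum_prod_type]

theorem frob_add_le (M N : Matrix (Fin a) (Fin b) 𝕜) : frob (M + N) ≤ frob M + frob N := by
  simp only [frob_eq_norm]
  exact norm_add_le (WithLp.toLp 2 fun x : Fin a × Fin b => M x.1 x.2)
    (WithLp.toLp 2 fun x : Fin a × Fin b => N x.1 x.2)

theorem frob_sum_le {ι : Type*} (s : Finset ι) (M : ι → Matrix (Fin a) (Fin b) 𝕜) :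
    frob (∑ i ∈ s, M i) ≤ ∑ i ∈ s, frob (M i) := by
  classical
  induction s using Finset.induction_on with
  | empty => simp [frob_zero]
  | insert i s hi ih =>
    rw [Finset.sum_insert hi, Finset.sum_insert hi]
    exact (frob_add_le _ _).trans (by gcongr)

end Frobenius

/-! ### The optimal approximation -/

section Approximation

open Complex

variable {𝕜 : Type*} [RCLike 𝕜] {n m p q κ : ℕ}

theorem h2Norm_nonneg (F : ℂ → Matrix (Fin p) (Fin m) ℂ) : 0 ≤ h2Norm F := Real.sqrt_nonneg _

theorem h2Norm_le_of_forall_frob_le {F : ℂ → Matrix (Fin p) (Fin m) ℂ} {B : ℝ} (hB : 0 ≤ B)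
    (h : ∀ z, ‖z‖ = 1 → frob (F z) ≤ B) : h2Norm F ≤ B := by
  rw [h2Norm_eq, Real.sqrt_le_left hB, circleMean, smul_eq_mul,
    inv_mul_le_iff₀ Real.two_pi_pos]
  refine (Real.le_norm_self _).trans ((intervalIntegral.norm_integral_le_of_norm_le_const
    (C := B ^ 2) fun w _ => ?_).trans_eq ?_)
  · rw [norm_pow, Real.norm_of_nonneg (frob_nonneg _)]
    exact pow_le_pow_left₀ (frob_nonneg _) (h _ (Complex.norm_exp_ofReal_mul_I w)) 2
  · rw [sub_zero, abs_of_pos Real.two_pi_pos, mul_comm]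

theorem obfModel_sum_smul (μ : Fin q → ℂ) (c : Fin κ → Fin q → ℂ)
    (R : Fin κ → Matrix (Fin p) (Fin m) ℂ) (z : ℂ) :
    obfModel μ (fun k => ∑ j, c j k • R j) z = ∑ j, (∑ k, basisFun μ k z * c j k) • R j := by
  simp only [obfModel, Finset.smul_sum, Finset.sum_smul, smul_smul]
  rw [Finset.sum_comm]

/-- The `H₂` error of the optimal model with minimax poles. -/
theorem h2Norm_transfer_sub_obfModel_le {D : Set ℂ} (hc : IsClosed D)
    (hD : D ⊆ Metric.ball (0 : ℂ) 1) {ρ : ℝ} (hρ : ρ < 1) (hDρ : ∀ z ∈ D, ‖z‖ ≤ ρ)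
    {S : StateSpace 𝕜 n m p} {pole : Fin κ → ℂ}
    {R : Fin κ → Matrix (Fin p) (Fin m) ℂ} (hS : HasSimplePoles S pole R)
    (hpole : ∀ j, pole j ∈ D) {μ : Fin q → ℂ} (hμ : ∀ k, μ k ∈ D)
    {Q : Fin q → Matrix (Fin p) (Fin m) ℂ} (hQ : IsOptimalCoeff S.transfer μ Q)
    {M : ℝ} (hM : minimaxObjective D μ ≤ M) (hM0 : 0 ≤ M) :
    h2Norm (fun z => S.transfer z - obfModel μ Q z) ≤ M / (1 - ρ) * ∑ j, frob (R j) := by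
  have hμ1 : ∀ k, ‖μ k‖ < 1 := fun k => norm_lt_one_of_mem hD (hμ k)
  have hp1 : ∀ j, ‖pole j‖ < 1 := fun j => norm_lt_one_of_mem hD (hpole j)
  choose c hc' using fun j => exists_approx_inv_sub hμ1 (hp1 j)
  have hρ1 : 0 < 1 - ρ := by linarith
  -- The competitor replaces each partial fraction of the true system by its interpolating
  -- approximant.
  refine (hQ fun k => ∑ j, c j k • R j).trans ?_
  rw [h2Norm_transfer_sub hS hp1]
  refine h2Norm_le_of_forall_frob_le (mul_nonneg (div_nonneg hM0 hρ1.le)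
    (Finset.sum_nonneg fun _ _ => frob_nonneg _)) fun z hz => ?_
  rw [obfModel_sum_smul, poleSum, ← Finset.sum_sub_distrib]
  simp only [← sub_smul]
  refine (frob_sum_le _ _).trans ?_
  rw [Finset.mul_sum]
  refine Finset.sum_le_sum fun j _ => ?_
  rw [frob_smul, hc' j z (fun i => ne_of_norm_eq_one hz (hμ1 i)) (ne_of_norm_eq_one hz (hp1 j))]
  refine mul_le_mul_of_nonneg_right ?_ (frob_nonneg _)
  have h1 : ‖∏ k, (1 - conj (μ k) * z) / (z - μ k)‖ = 1 := by
    rw [norm_prod]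
    refine Finset.prod_eq_one fun k _ => ?_
    rw [norm_div, norm_one_sub_conj_mul_of_norm_eq_one hz, div_self]
    exact norm_ne_zero_iff.2 (sub_ne_zero.2 (ne_of_norm_eq_one hz (hμ1 k)))
  have h2 : 1 - ρ ≤ ‖z - pole j‖ := by
    have := norm_sub_norm_le z (pole j)
    have := hDρ _ (hpole j)
    linarith
  rw [norm_div, norm_mul, h1, mul_one, norm_blaschke]
  exact div_le_div₀ hM0 ((prod_pseudoHyp_le_minimaxObjective hc hD hμ (hpole j)).trans hM) hρ1 h2

/-- Rational functions with poles in the open disk are continuous on the circle. -/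
theorem continuous_poleSum_sub_obfModel {pole : Fin κ → ℂ} (hpole : ∀ j, ‖pole j‖ < 1)
    (R : Fin κ → Matrix (Fin p) (Fin m) ℂ) {μ : Fin q → ℂ} (hμ : ∀ k, ‖μ k‖ < 1)
    (Q : Fin q → Matrix (Fin p) (Fin m) ℂ) :
    Continuous fun w : ℝ => poleSum pole R (Complex.exp (w * I)) -
      obfModel μ Q (Complex.exp (w * I)) := by
  have h : ∀ a : ℂ, ‖a‖ < 1 → Continuous fun w : ℝ => 1 / (Complex.exp (w * I) - a) := fun a ha =>
    continuous_const.div (by fun_prop) fun w =>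
      sub_ne_zero.2 (ne_of_norm_eq_one (Complex.norm_exp_ofReal_mul_I w) ha)
  unfold poleSum obfModel basisFun
  simp only [← one_div_pow]
  exact (continuous_finsetSum _ fun j _ => (h _ (hpole j)).smul continuous_const).sub
    (continuous_finsetSum _ fun j _ => ((h _ (hμ j)).pow _).smul continuous_const)

theorem continuous_frob : Continuous (frob : Matrix (Fin p) (Fin m) ℂ → ℝ) := by
  unfold frob
  refine Real.continuous_sqrt.comp (continuous_finsetSum _ fun i _ => continuous_finsetSum _
    fun j _ => ?_)
  exact (continuous_id.matrix_elem i j).norm.pow 2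

/-- The parallelogram law around the midpoint, entry by entry; it yields uniqueness of the optimal
model. -/
theorem frob_sq_add_frob_sq (M N : Matrix (Fin p) (Fin m) ℂ) :
    frob M ^ 2 + frob N ^ 2 =
      2 * frob ((1 / 2 : ℂ) • (M + N)) ^ 2 + 1 / 2 * frob (M - N) ^ 2 := by
  have h := fun x y : ℂ => parallelogram_law_with_norm ℝ x y
  rw [frob_smul, mul_pow]
  simp only [frob_sq, Finset.mul_sum, ← Finset.sum_add_distrib]
  refine Finset.sum_congr rfl fun i _ => Finset.sum_congr rfl fun j _ => ?_
  have h1 := h (M i j) (N i j)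
  simp only [Matrix.add_apply, Matrix.sub_apply]
  norm_num
  linarith

/-- The optimal model is unique as a function on the circle. -/
theorem IsOptimalCoeff.obfModel_eq {S : StateSpace 𝕜 n m p} {pole : Fin κ → ℂ}
    {R : Fin κ → Matrix (Fin p) (Fin m) ℂ} (hS : HasSimplePoles S pole R)
    (hpole : ∀ j, ‖pole j‖ < 1) {μ : Fin q → ℂ} (hμ : ∀ k, ‖μ k‖ < 1)
    {Q Q' : Fin q → Matrix (Fin p) (Fin m) ℂ} (hQ : IsOptimalCoeff S.transfer μ Q)
    (hQ' : h2Norm (fun z => S.transfer z - obfModel μ Q' z) ≤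
      h2Norm (fun z => S.transfer z - obfModel μ Q z)) {w : ℝ}
    (hw : w ∈ Set.Icc 0 (2 * Real.pi)) :
    obfModel μ Q (Complex.exp (w * I)) = obfModel μ Q' (Complex.exp (w * I)) := by
  -- The midpoint cannot beat the optimum, so the parallelogram law forces the mean square of the
  -- difference to vanish; continuity makes this pointwise.
  have hmid := hQ fun k => (1 / 2 : ℂ) • (Q k + Q' k)
  simp only [h2Norm_transfer_sub hS hpole] at hQ' hmid
  rw [← pow_le_pow_iff_left₀ (h2Norm_nonneg _) (h2Norm_nonneg _) two_ne_zero, h2Norm_sq,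
    h2Norm_sq] at hQ' hmid
  have hcont := fun Q => continuous_poleSum_sub_obfModel hpole R hμ Q
  set F : (Fin q → Matrix (Fin p) (Fin m) ℂ) → ℝ → Matrix (Fin p) (Fin m) ℂ := fun Q w =>
    poleSum pole R (Complex.exp (w * I)) - obfModel μ Q (Complex.exp (w * I)) with hF
  have hcont' : ∀ Q, Continuous fun w => frob (F Q w) ^ 2 :=
    fun Q => (continuous_frob.comp (hcont Q)).pow 2
  have hFm : ∀ w, (1 / 2 : ℂ) • (F Q w + F Q' w) = F (fun k => (1 / 2 : ℂ) • (Q k + Q' k)) w := by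
    intro w
    simp only [hF, obfModel, smul_add, smul_sub, Finset.smul_sum, Finset.sum_add_distrib,
      smul_comm (1 / 2 : ℂ)]
    module
  have hint : ∀ f : ℝ → ℝ, Continuous f → IntervalIntegrable f volume 0 (2 * Real.pi) :=
    fun f hf => hf.intervalIntegrable _ _
  have hd : Continuous fun w => frob (F Q w - F Q' w) ^ 2 :=
    (continuous_frob.comp ((hcont Q).sub (hcont Q'))).pow 2
  have key : circleMean (fun w => frob (F Q w) ^ 2) + circleMean (fun w => frob (F Q' w) ^ 2) =
      2 * circleMean (fun w => frob (F (fun k => (1 / 2 : ℂ) • (Q k + Q' k)) w) ^ 2) +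
        1 / 2 * circleMean (fun w => frob (F Q w - F Q' w) ^ 2) := by
    rw [← circleMean_add (hint _ (hcont' Q)) (hint _ (hcont' Q'))]
    simp only [frob_sq_add_frob_sq, hFm]
    rw [circleMean_add (hint _ ((hcont' _).const_mul 2)) (hint _ (hd.const_mul (1 / 2)))]
    simp only [circleMean, intervalIntegral.integral_const_mul, smul_eq_mul]
    ring
  have hle : circleMean (fun w => frob (F Q w - F Q' w) ^ 2) ≤ 0 := by
    simp only [hF] at key ⊢
    linarith
  have hzero : frob (F Q w - F Q' w) = 0 := by
    by_contra h
    refine absurd hle (not_le.2 (mul_pos (inv_pos.2 Real.two_pi_pos) ?_))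
    exact intervalIntegral.integral_pos Real.two_pi_pos hd.continuousOn (fun _ _ => sq_nonneg _)
      ⟨w, hw, by positivity⟩
  have h0 : F Q w - F Q' w = 0 := by
    have h1 : ∑ i, ∑ j, ‖(F Q w - F Q' w) i j‖ ^ 2 = 0 := by rw [← frob_sq, hzero]; simp
    ext i j
    rw [Finset.sum_eq_zero_iff_of_nonneg fun _ _ => Finset.sum_nonneg fun _ _ => sq_nonneg _] at h1
    have h2 := h1 i (Finset.mem_univ _)
    rw [Finset.sum_eq_zero_iff_of_nonneg fun _ _ => sq_nonneg _] at h2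
    simpa using h2 j (Finset.mem_univ _)
  simp only [hF, sub_sub_sub_cancel_left, sub_eq_zero] at h0
  exact h0.symm

end Approximation

/-! ### Realization of the optimal model over the scalar field -/

section RealModel

open Polynomial

variable {𝕜 : Type*} [RCLike 𝕜] {n m p q κ : ℕ}

theorem eval_eq_sum_fin_of_degree_lt {P : ℂ[X]} (hP : P.degree < q) (z : ℂ) :
    P.eval z = ∑ k : Fin q, P.coeff k * z ^ (k : ℕ) := by
  rcases eq_or_ne P 0 with rfl | h
  · simp
  · rw [Fin.sum_univ_eq_sum_range (fun k => P.coeff k * z ^ k),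
      eval_eq_sum_range' ((natDegree_lt_iff_degree_lt h).2 hP)]

theorem eval_map_conj (P : ℂ[X]) (z : ℂ) :
    (P.map (starRingEnd ℂ)).eval z = conj (P.eval (conj z)) := by
  rw [eval_map, ← Complex.conj_conj z, eval₂_hom, Complex.conj_conj]

/-- The denominator over the scalar field. -/
theorem IsDefinedOver.exists_coeff {μ : Fin q → ℂ} (hμ : IsDefinedOver 𝕜 μ) :
    ∃ a : Fin q → 𝕜, ∀ z, ∏ k, (z - μ k) = z ^ q + ∑ i, toC 𝕜 (a i) * z ^ (i : ℕ) := by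
  choose c hc using hμ
  refine ⟨fun i => c i, fun z => ?_⟩
  set P : ℂ[X] := ∏ k, (X - C (μ k)) with hP
  have hmonic : P.Monic := monic_prod_of_monic _ _ fun k _ => monic_X_sub_C _
  have hdeg : P.natDegree = q := by
    rw [hP, natDegree_prod_of_monic _ _ fun k _ => monic_X_sub_C _]
    simp
  have h1 : ∏ k, (z - μ k) = P.eval z := by simp [hP, eval_prod]
  rw [h1, eval_eq_sum_range, hdeg, Finset.sum_range_succ, ← Fin.sum_univ_eq_sum_range
    (fun k => P.coeff k * z ^ k), add_comm]
  have h2 : P.coeff q = 1 := by rw [← hdeg]; exact hmonic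
  rw [h2, one_mul]
  congr 1
  exact Finset.sum_congr rfl fun i _ => by rw [← hc]; rfl

theorem IsDefinedOver.prod_sub_conj (h𝕜 : (RCLike.I : 𝕜) = 0) {μ : Fin q → ℂ}
    (hμ : IsDefinedOver 𝕜 μ) (z : ℂ) : ∏ k, (conj z - μ k) = conj (∏ k, (z - μ k)) := by
  obtain ⟨a, ha⟩ := hμ.exists_coeff
  rw [ha, ha]
  simp [conj_toC_of_I_eq_zero h𝕜]

theorem transfer_conj (h𝕜 : (RCLike.I : 𝕜) = 0) (S : StateSpace 𝕜 n m p) {z : ℂ}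
    (hz : z ∉ spectrum ℂ S.AC) (hz' : conj z ∉ spectrum ℂ S.AC) :
    S.transfer (conj z) = (S.transfer z).map (starRingEnd ℂ) := by
  have hmap : ∀ {a b : ℕ} (M : Matrix (Fin a) (Fin b) 𝕜),
      (M.map (toC 𝕜)).map (starRingEnd ℂ) = M.map (toC 𝕜) := fun M => by
    ext i j
    exact conj_toC_of_I_eq_zero h𝕜 _
  rw [transfer_eq_of_mul_eq S hz' (X := ((z • (1 : Matrix (Fin n) (Fin n) ℂ) - S.AC)⁻¹ *
    S.B.map (toC 𝕜)).map (starRingEnd ℂ)), StateSpace.transfer, Matrix.mul_assoc,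
    Matrix.map_mul (L := S.C.map _), ← coe_toC, hmap]
  rw [spectrum.notMem_iff, Algebra.algebraMap_eq_smul_one, Matrix.isUnit_iff_isUnit_det] at hz
  have h1 : conj z • (1 : Matrix (Fin n) (Fin n) ℂ) - S.AC =
      (z • (1 : Matrix (Fin n) (Fin n) ℂ) - S.AC).map (starRingEnd ℂ) := by
    ext i j
    have h2 : S.AC i j = conj (S.AC i j) := (conj_toC_of_I_eq_zero h𝕜 _).symm
    simp only [Matrix.sub_apply, Matrix.smul_apply, Matrix.map_apply, map_sub, ← h2, smul_eq_mul,
      map_mul, Matrix.one_apply]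
    split_ifs <;> simp
  rw [h1, ← Matrix.map_mul, ← Matrix.mul_assoc, Matrix.mul_nonsing_inv _ hz, Matrix.one_mul, hmap]

/-- Conjugating the argument reflects the angle, and conjugating the entries preserves their moduli.
-/
theorem h2Norm_conj (F : ℂ → Matrix (Fin p) (Fin m) ℂ) :
    h2Norm (fun z => (F (conj z)).map (starRingEnd ℂ)) = h2Norm F := by
  rw [h2Norm_eq, h2Norm_eq]
  congr 1
  have h1 : ∀ w : ℝ, frob ((F (conj (Complex.exp (w * Complex.I)))).map (starRingEnd ℂ)) ^ 2 =
      frob (F (Complex.exp ((2 * Real.pi - w : ℝ) * Complex.I))) ^ 2 := fun w => by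
    have h2 : conj (Complex.exp (w * Complex.I)) =
        Complex.exp ((2 * Real.pi - w : ℝ) * Complex.I) := by
      rw [← Complex.exp_conj, Complex.exp_eq_exp_iff_exists_int]
      exact ⟨-1, by simp; ring⟩
    rw [h2]
    simp [frob_sq]
  simp only [h1]
  rw [circleMean, circleMean, intervalIntegral.integral_comp_sub_left (fun w : ℝ => frob (F
            (Complex.exp (w * Complex.I))) ^ 2)]
  simp

theorem infinite_image_exp_Icc :
    ((fun w : ℝ => Complex.exp (w * Complex.I)) '' Set.Icc 0 (2 * Real.pi)).Infinite := by
  intro h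
  have h1 := ae_exp_mul_I_notMem h
  have h2 : volume (Set.Icc 0 (2 * Real.pi)) = 0 := by
    refine measure_mono_null (fun w hw => ?_) (ae_iff.1 h1)
    exact not_not.2 ⟨w, hw, rfl⟩
  simp [Real.pi_pos.not_ge] at h2

/-- The numerators of the optimal model have coefficients in the scalar field. -/
theorem IsOptimalCoeff.exists_numerator {S : StateSpace 𝕜 n m p} {pole : Fin κ → ℂ}
    {R : Fin κ → Matrix (Fin p) (Fin m) ℂ} (hS : HasSimplePoles S pole R)
    (hpole : ∀ j, ‖pole j‖ < 1) {μ : Fin q → ℂ} (hμ : ∀ k, ‖μ k‖ < 1)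
    (hμ𝕜 : IsDefinedOver 𝕜 μ)
    {Q : Fin q → Matrix (Fin p) (Fin m) ℂ} (hQ : IsOptimalCoeff S.transfer μ Q) :
    ∃ N : Fin p → Fin m → Fin q → 𝕜, ∀ z, (∀ k, z ≠ μ k) → ∀ i j,
      obfModel μ Q z i j = (∑ k, toC 𝕜 (N i j k) * z ^ (k : ℕ)) / ∏ k, (z - μ k) := by
  choose P hPdeg hP using fun i j => exists_polynomial_sum_basisFun μ (fun k => Q k i j)
  have hobf : ∀ Q : Fin q → Matrix (Fin p) (Fin m) ℂ, ∀ z i j,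
      obfModel μ Q z i j = ∑ k, basisFun μ k z * Q k i j := fun Q z i j => by
    simp [obfModel, Matrix.sum_apply]
  have hcoeff : ∀ i j k, ∃ x, toC 𝕜 x = (P i j).coeff k := by
    -- In the real case conjugating the numerators gives a model `Q'` with the same poles and the
    -- same error. By uniqueness it agrees with the optimal one at infinitely many points, so the
    -- numerators are self-conjugate.
    by_cases h𝕜 : (RCLike.I : 𝕜) = 0
    · have hne : ∀ z, (∀ k, z ≠ μ k) ↔ ∏ k, (z - μ k) ≠ 0 := fun z => by
        simp [Finset.prod_ne_zero_iff, sub_eq_zero]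
      have hconj : ∀ z, (∀ k, z ≠ μ k) → ∀ k, conj z ≠ μ k := fun z hz => by
        rw [hne] at hz ⊢
        rw [hμ𝕜.prod_sub_conj h𝕜]
        exact (_root_.map_ne_zero _).2 hz
      have hdeg' : ∀ i j, ((P i j).map (starRingEnd ℂ)).degree < q := fun i j =>
        degree_map_le.trans_lt (hPdeg i j)
      choose c hc using fun i j => exists_sum_basisFun μ _ (hdeg' i j)
      set Q' : Fin q → Matrix (Fin p) (Fin m) ℂ := fun k => Matrix.of fun i j => c i j k with hQ'
      have hQQ : ∀ z, (∀ k, z ≠ μ k) →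
          obfModel μ Q' z = (obfModel μ Q (conj z)).map (starRingEnd ℂ) := fun z hz => by
        ext i j
        rw [Matrix.map_apply, hobf, hobf, hP i j _ (hconj z hz), map_div₀, ← eval_map_conj,
          hμ𝕜.prod_sub_conj h𝕜, Complex.conj_conj, hc i j z hz]
        simp [hQ']
      have hnorm : h2Norm (fun z => S.transfer z - obfModel μ Q' z) =
          h2Norm (fun z => S.transfer z - obfModel μ Q z) := by
        rw [← h2Norm_conj (fun z => S.transfer z - obfModel μ Q z)]
        have hfin := Matrix.finite_spectrum S.AC
        refine h2Norm_congr (hfin.union (hfin.image (starRingEnd ℂ))) fun z hz hzs => ?_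
        have hz1 : z ∉ spectrum ℂ S.AC := fun h => hzs (Or.inl h)
        have hz2 : conj z ∉ spectrum ℂ S.AC := fun h =>
          hzs (Or.inr ⟨_, h, Complex.conj_conj z⟩)
        rw [hQQ z fun k => ne_of_norm_eq_one hz (hμ k)]
        have h3 := transfer_conj h𝕜 S hz2 (by rwa [Complex.conj_conj])
        rw [Complex.conj_conj] at h3
        rw [h3]
        ext i j
        simp
      intro i j k
      refine mem_range_toC_of_conj_eq ?_
      have heq : (P i j).map (starRingEnd ℂ) = P i j := by
        refine eq_of_infinite_eval_eq _ _ (infinite_image_exp_Icc.mono ?_)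
        rintro _ ⟨w, hw, rfl⟩
        have h1 : ∀ k, Complex.exp (w * Complex.I) ≠ μ k := fun k =>
          ne_of_norm_eq_one (Complex.norm_exp_ofReal_mul_I w) (hμ k)
        have h2 := congrFun₂ (hQ.obfModel_eq hS hpole hμ hnorm.le hw) i j
        rw [hobf, hobf, hP i j _ h1] at h2
        have h3 := hc i j _ h1
        simp only [hQ', Matrix.of_apply] at h2
        rw [← h2] at h3
        exact (div_left_inj' ((hne _).1 h1)).1 h3
      have := congrArg (fun f => f.coeff (k : ℕ)) heq
      simpa using this
    · exact fun i j k => toC_surjective h𝕜 _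
  choose N hN using hcoeff
  refine ⟨fun i j k => N i j k, fun z hz i j => ?_⟩
  rw [hobf, hP i j z hz, eval_eq_sum_fin_of_degree_lt (hPdeg i j)]
  simp only [hN]

/-- The optimal model has a state-space realization over the scalar field. -/
theorem IsOptimalCoeff.exists_realizes {S : StateSpace 𝕜 n m p} {pole : Fin κ → ℂ}
    {R : Fin κ → Matrix (Fin p) (Fin m) ℂ} (hS : HasSimplePoles S pole R)
    (hpole : ∀ j, ‖pole j‖ < 1) {μ : Fin q → ℂ} (hμ : ∀ k, ‖μ k‖ < 1)
    (hμ𝕜 : IsDefinedOver 𝕜 μ) (hq : q * min p m ≤ n)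
    {Q : Fin q → Matrix (Fin p) (Fin m) ℂ} (hQ : IsOptimalCoeff S.transfer μ Q) :
    ∃ T : StateSpace 𝕜 n m p, Realizes T μ Q := by
  obtain ⟨a, ha⟩ := hμ𝕜.exists_coeff
  obtain ⟨N, hN⟩ := hQ.exists_numerator hS hpole hμ hμ𝕜
  obtain ⟨T, hT⟩ := exists_realization hq a N
  refine ⟨T, fun z hz hzμ => ?_⟩
  ext i j
  rw [hN z hzμ, ha]
  refine hT z hz ?_ i j
  rw [← ha]
  exact Finset.prod_ne_zero_iff.2 fun k _ => sub_ne_zero.2 (hzμ k)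

end RealModel

/-! ### Chain rule for the Kullback-Leibler divergence -/

section KL

open InformationTheory

variable {α β γ Ω : Type*} {mα : MeasurableSpace α} {mβ : MeasurableSpace β}
  {mγ : MeasurableSpace γ} {mΩ : MeasurableSpace Ω}

theorem compProd_eq_withDensity_rnDeriv [MeasurableSpace.CountableOrCountablyGenerated α β]
    {μ : Measure α} [IsFiniteMeasure μ]
    {κ η : Kernel α β} [IsFiniteKernel κ] [IsFiniteKernel η] (h : ∀ᵐ a ∂μ, κ a ≪ η a) :
    μ ⊗ₘ κ = (μ ⊗ₘ η).withDensity (fun p => Kernel.rnDeriv κ η p.1 p.2) := by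
  ext s hs
  have hm := Kernel.measurable_rnDeriv κ η
  rw [withDensity_apply _ hs, ← lintegral_indicator hs, Measure.lintegral_compProd
    (hm.indicator hs), Measure.compProd_apply hs]
  refine lintegral_congr_ae ?_
  filter_upwards [h] with a ha
  have hsa : MeasurableSet (Prod.mk a ⁻¹' s) := measurable_prodMk_left hs
  rw [← Kernel.setLIntegral_rnDeriv ha hsa, ← lintegral_indicator hsa]
  rfl

/-- Over a common base measure the joint density is the kernel density. In its `klFun` form the
divergence has a nonnegative integrand, so it disintegrates without integrability assumptions. -/
theorem klDiv_compProd_right [MeasurableSpace.CountableOrCountablyGenerated α β]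
    {μ : Measure α} [IsFiniteMeasure μ]
    {κ η : Kernel α β} [IsFiniteKernel κ] [IsFiniteKernel η] (h : ∀ᵐ a ∂μ, κ a ≪ η a) :
    klDiv (μ ⊗ₘ κ) (μ ⊗ₘ η) = ∫⁻ a, klDiv (κ a) (η a) ∂μ := by
  have hm := Kernel.measurable_rnDeriv κ η
  have h1 : (μ ⊗ₘ κ).rnDeriv (μ ⊗ₘ η) =ᵐ[μ ⊗ₘ η] fun p => Kernel.rnDeriv κ η p.1 p.2 := by
    rw [compProd_eq_withDensity_rnDeriv h]
    exact Measure.rnDeriv_withDensity _ hm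
  rw [klDiv_eq_lintegral_klFun_of_ac (Measure.absolutelyContinuous_compProd_right_iff.2 h),
    lintegral_congr_ae (g := fun p : α × β =>
      ENNReal.ofReal (klFun (Kernel.rnDeriv κ η p.1 p.2).toReal)),
    Measure.lintegral_compProd]
  · refine lintegral_congr_ae ?_
    filter_upwards [h] with a ha
    rw [klDiv_eq_lintegral_klFun_of_ac ha]
    refine lintegral_congr_ae ?_
    filter_upwards [Kernel.rnDeriv_eq_rnDeriv_measure (κ := κ) (η := η) (a := a)] with b hb
    rw [hb]
  · exact (measurable_klFun.comp hm.ennreal_toReal).ennreal_ofReal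
  · filter_upwards [h1] with p hp
    rw [hp]

/-- The expected divergence of the conditional laws is at most the divergence of the joint laws. -/
theorem lintegral_klDiv_condDistrib_le [StandardBorelSpace β] [Nonempty β]
    {P : Measure Ω} [IsProbabilityMeasure P] {X X' : Ω → α} {Y Y' : Ω → β} (hX : Measurable X)
    (hX' : Measurable X') (hY : Measurable Y) (hY' : Measurable Y') :
    ∫⁻ a, klDiv (condDistrib Y X P a) (condDistrib Y' X' P a) ∂(P.map X) ≤
      klDiv (P.map fun ω => (X ω, Y ω)) (P.map fun ω => (X' ω, Y' ω)) := by
  by_cases htop : klDiv (P.map fun ω => (X ω, Y ω)) (P.map fun ω => (X' ω, Y' ω)) = ∞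
  · rw [htop]
    exact le_top
  have := Measure.isProbabilityMeasure_map hX.aemeasurable (μ := P)
  have := Measure.isProbabilityMeasure_map hX'.aemeasurable (μ := P)
  rw [← compProd_map_condDistrib hY.aemeasurable, ← compProd_map_condDistrib hY'.aemeasurable]
    at htop ⊢
  have hac : ∀ᵐ a ∂(P.map X), condDistrib Y X P a ≪ condDistrib Y' X' P a :=
    (klDiv_ne_top_iff.1 htop).1.kernel_of_compProd
  rw [klDiv_compProd_eq_add, klDiv_compProd_right hac]
  -- The chain rule contributes the divergence of the marginals of `X` and `X'` as well; it is
  -- dropped here.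
  exact le_add_self

/-- By independence, conditioning on `X = a` only translates the law of `W` by `D a`. -/
theorem map_prodMk_add_eq_compProd {E : Type*} [MeasurableSpace E] [Add E] [MeasurableAdd₂ E]
    {P : Measure Ω} [IsProbabilityMeasure P] {X : Ω → α} {W : Ω → E} (hX : Measurable X)
    (hW : Measurable W) (hXW : IndepFun X W P) {D : α → E} (hD : Measurable D) :
    P.map (fun ω => (X ω, W ω + D (X ω))) = (P.map X) ⊗ₘ
      (Kernel.id ×ₖ Kernel.const α (P.map W)).map (fun q : α × E => q.2 + D q.1) := by
  have := Measure.isProbabilityMeasure_map hX.aemeasurable (μ := P)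
  have := Measure.isProbabilityMeasure_map hW.aemeasurable (μ := P)
  have hm : Measurable fun q : α × E => q.2 + D q.1 := by fun_prop
  have h1 := (indepFun_iff_map_prod_eq_prod_map_map hX.aemeasurable hW.aemeasurable).1 hXW
  have h2 : P.map (fun ω => (X ω, W ω + D (X ω))) =
      ((P.map X).prod (P.map W)).map fun q => (q.1, q.2 + D q.1) := by
    rw [← h1, Measure.map_map (by fun_prop) (by fun_prop)]
    rfl
  rw [h2]
  ext s hs
  have hm2 : Measurable fun q : α × E => (q.1, q.2 + D q.1) := by fun_prop
  rw [Measure.map_apply hm2 hs, Measure.prod_apply (hm2 hs), Measure.compProd_apply hs]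
  refine lintegral_congr fun a => ?_
  rw [Kernel.map_apply' _ hm _ (measurable_prodMk_left hs), Kernel.prod_apply, Kernel.id_apply,
    Kernel.const_apply, Measure.dirac_prod, Measure.map_apply measurable_prodMk_left]
  · rfl
  · exact hm (measurable_prodMk_left hs)

/-- One step of the chain rule for signals with additive noise. -/
theorem klDiv_map_prodMk_add_le {E : Type*} [MeasurableSpace E] [AddZeroClass E]
    [MeasurableAdd₂ E] [MeasurableSpace.CountableOrCountablyGenerated α E]
    {P : Measure Ω} [IsProbabilityMeasure P] {X X' : Ω → α} {W : Ω → E} (hX : Measurable X)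
    (hX' : Measurable X') (hW : Measurable W) (hXW : IndepFun X W P) (hXW' : IndepFun X' W P)
    {D : α → E} (hD : Measurable D) {J : E → ℝ≥0∞} (hJ : ∀ a, J a ≠ ∞)
    (hJW : ∀ a, klDiv ((P.map W).map (· + a)) (P.map W) ≤ J a) :
    klDiv (P.map fun ω => (X ω, W ω + D (X ω))) (P.map fun ω => (X' ω, W ω)) ≤
      klDiv (P.map X) (P.map X') + ∫⁻ a, J (D a) ∂(P.map X) := by
  have := Measure.isProbabilityMeasure_map hX.aemeasurable (μ := P)
  have := Measure.isProbabilityMeasure_map hX'.aemeasurable (μ := P)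
  have := Measure.isProbabilityMeasure_map hW.aemeasurable (μ := P)
  have hm : ∀ {D : α → E}, Measurable D → Measurable fun q : α × E => q.2 + D q.1 :=
    fun hD => by fun_prop
  have hκ : ∀ {D : α → E}, Measurable D → ∀ a,
      (Kernel.id ×ₖ Kernel.const α (P.map W)).map (fun q : α × E => q.2 + D q.1) a =
        (P.map W).map (· + D a) := fun {D} hD a => by
    rw [Kernel.map_apply _ (hm hD), Kernel.prod_apply, Kernel.id_apply, Kernel.const_apply,
      Measure.dirac_prod, Measure.map_map (hm hD) measurable_prodMk_left]
    rfl
  have h0 : P.map (fun ω => (X' ω, W ω)) = P.map (fun ω => (X' ω, W ω + (fun _ => 0) (X' ω))) := by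
    simp
  have hM : ∀ {D : α → E}, Measurable D → IsMarkovKernel
      ((Kernel.id ×ₖ Kernel.const α (P.map W)).map (fun q : α × E => q.2 + D q.1)) :=
    fun hD => Kernel.IsMarkovKernel.map _ (hm hD)
  have := hM hD
  have := hM (D := fun _ => 0) measurable_const
  -- Finiteness of the majorant `J` is what provides absolute continuity of the translates.
  have hac : ∀ a, (Kernel.id ×ₖ Kernel.const α (P.map W)).map (fun q : α × E => q.2 + D q.1) a ≪
      (Kernel.id ×ₖ Kernel.const α (P.map W)).map (fun q : α × E => q.2 + (fun _ => 0) q.1) a := by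
    intro a
    rw [hκ hD, hκ measurable_const]
    simpa using (klDiv_ne_top_iff.1 (ne_top_of_le_ne_top (hJ _) (hJW (D a)))).1
  rw [h0, map_prodMk_add_eq_compProd hX hW hXW hD,
    map_prodMk_add_eq_compProd hX' hW hXW' (measurable_const (a := (0 : E))),
    klDiv_compProd_eq_add, klDiv_compProd_right (.of_forall hac)]
  gcongr with a
  rw [hκ hD, hκ measurable_const]
  simpa using hJW (D a)

/-- The hypotheses make the joint law a triple product, which is then reassociated. -/
theorem indepFun_prodMk_left {P : Measure Ω} [IsProbabilityMeasure P] {X : Ω → α} {Y : Ω → β}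
    {Z : Ω → γ} (hX : Measurable X) (hY : Measurable Y) (hZ : Measurable Z)
    (hYZ : IndepFun Y Z P) (hXYZ : IndepFun X (fun ω => (Y ω, Z ω)) P) :
    IndepFun (fun ω => (X ω, Y ω)) Z P := by
  have := Measure.isProbabilityMeasure_map hX.aemeasurable (μ := P)
  have := Measure.isProbabilityMeasure_map hY.aemeasurable (μ := P)
  have := Measure.isProbabilityMeasure_map hZ.aemeasurable (μ := P)
  have hXY : IndepFun X Y P := hXYZ.comp measurable_id measurable_fst
  rw [indepFun_iff_map_prod_eq_prod_map_map (by fun_prop) (by fun_prop)] at hXY hYZ hXYZ ⊢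
  rw [hYZ, ← Measure.prodAssoc_prod] at hXYZ
  rw [hXY]
  have h := congrArg (Measure.map MeasurableEquiv.prodAssoc.symm) hXYZ
  rw [Measure.map_map (by fun_prop) (by fun_prop), Measure.map_map (by fun_prop) (by fun_prop)] at h
  have h2 : (MeasurableEquiv.prodAssoc.symm ∘ MeasurableEquiv.prodAssoc :
      (α × β) × γ → (α × β) × γ) = id := by
    ext : 1
    simp
  rw [h2, Measure.map_id] at h
  exact h

end KL

/-! ### Signals with causally shifted noise -/

section Shift

open InformationTheory

/-- The sequence that agrees with `w` before time `t` and vanishes from then on. -/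
def trunc {E : Type*} [Zero E] (t : ℕ) (w : ℕ → E) : ℕ → E := fun s => if s < t then w s else 0

theorem trunc_zero {E : Type*} [Zero E] (w : ℕ → E) : trunc 0 w = 0 := by
  ext s
  simp [trunc]

theorem trunc_succ {E : Type*} [Zero E] (t : ℕ) (w : ℕ → E) :
    trunc (t + 1) w = Function.update (trunc t w) t (w t) := by
  ext s
  rcases lt_trichotomy s t with h | rfl | h
  · simp [trunc, h, h.ne, h.trans (Nat.lt_succ_self t)]
  · simp [trunc]
  · simp [trunc, h.ne', h.not_gt, show ¬ s < t + 1 by omega]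

theorem trunc_apply {E : Type*} [Zero E] {s t : ℕ} (h : s < t) (w : ℕ → E) :
    trunc t w s = w s := if_pos h

theorem trunc_trunc {E : Type*} [Zero E] {s t : ℕ} (h : s ≤ t) (w : ℕ → E) :
    trunc s (trunc t w) = trunc s w := by
  ext i
  simp only [trunc]
  split_ifs <;> first | rfl | omega

theorem measurable_trunc {E : Type*} [MeasurableSpace E] [Zero E] (t : ℕ) :
    Measurable (trunc t : (ℕ → E) → ℕ → E) := by
  refine measurable_pi_lambda _ fun s => ?_
  unfold trunc
  split_ifs
  · exact measurable_pi_apply s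
  · exact measurable_const

variable {Ω 𝓡 E : Type*} [MeasurableSpace 𝓡] [MeasurableSpace E]

theorem indepFun_prodMk_trunc [MeasurableSpace Ω] [Zero E] {P : Measure Ω} [IsProbabilityMeasure P] {r : Ω → 𝓡}
    {v : ℕ → Ω → E} (hr : Measurable r) (hv : ∀ t, Measurable (v t)) (hind : iIndepFun v P)
    (hrv : IndepFun r (fun ω t => v t ω) P) (t : ℕ) :
    IndepFun (fun ω => (r ω, trunc t fun s => v s ω)) (v t) P := by
  have hvm : Measurable fun ω s => v s ω := measurable_pi_lambda _ hv
  have h1 : IndepFun (fun ω => trunc t fun s => v s ω) (v t) P := by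
    have h2 := hind.indepFun_finset (Finset.range t) {t} (by simp) hv
    have h3 : Measurable fun (f : Finset.range t → E) (s : ℕ) =>
        if h : s ∈ Finset.range t then f ⟨s, h⟩ else 0 := by
      refine measurable_pi_lambda _ fun s => ?_
      by_cases h : s ∈ Finset.range t
      · simp only [h, dif_pos]
        exact measurable_pi_apply _
      · simp only [h, dif_neg, not_false_eq_true]
        exact measurable_const
    have h4 := h2.comp h3
      (measurable_pi_apply (⟨t, Finset.mem_singleton_self t⟩ : ({t} : Finset ℕ)))
    convert h4 using 1
    · ext ω s
      by_cases h : s < t <;> simp [trunc, h]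
    · rfl
  refine indepFun_prodMk_left hr ((measurable_trunc t).comp hvm) (hv t) h1 ?_
  exact hrv.comp (φ := id) (ψ := fun w : ℕ → E => (trunc t w, w t)) measurable_id
    ((measurable_trunc t).prodMk (measurable_pi_apply t))

variable [AddZeroClass E] [MeasurableAdd₂ E]

/-- The shift at time `t` uses only earlier values of `v'`, so the recursion is solved forward in
time. Consequently the past of `v'` is independent of `v t`. -/
theorem exists_measurable_trunc_eq {r : Ω → 𝓡} {v v' : ℕ → Ω → E} {D : ℕ → 𝓡 × (ℕ → E) → E}
    (hD : ∀ t, Measurable (D t)) (hDt : ∀ t ρ w, D t (ρ, trunc t w) = D t (ρ, w))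
    (hv' : ∀ t ω, v' t ω = v t ω + D t (r ω, fun s => v' s ω)) (t : ℕ) :
    ∃ g : 𝓡 × (ℕ → E) → ℕ → E, Measurable g ∧
      ∀ ω, (trunc t fun s => v' s ω) = g (r ω, trunc t fun s => v s ω) := by
  induction t with
  | zero => exact ⟨fun _ => 0, measurable_const, fun ω => by rw [trunc_zero]⟩
  | succ t ih =>
    obtain ⟨g, hg, hgv⟩ := ih
    have hg' : Measurable fun q : 𝓡 × (ℕ → E) => g (q.1, trunc t q.2) :=
      hg.comp (measurable_fst.prodMk ((measurable_trunc t).comp measurable_snd))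
    have hx : Measurable fun q : 𝓡 × (ℕ → E) => q.2 t + D t (q.1, g (q.1, trunc t q.2)) :=
      ((measurable_pi_apply t).comp measurable_snd).add
        ((hD t).comp (measurable_fst.prodMk hg'))
    refine ⟨fun q => Function.update (g (q.1, trunc t q.2)) t
      (q.2 t + D t (q.1, g (q.1, trunc t q.2))), measurable_update'.comp (hg'.prodMk hx),
      fun ω => ?_⟩
    simp only [trunc_trunc (Nat.le_succ t), trunc_apply (Nat.lt_succ_self t)]
    rw [trunc_succ, ← hgv, hDt, ← hv']

/-- The divergence between a noise sequence with causal shifts and the noise sequence. -/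
theorem klDiv_map_trunc_le [MeasurableSpace Ω] [MeasurableSpace.CountablyGenerated E]
    {P : Measure Ω} [IsProbabilityMeasure P] {r : Ω → 𝓡} {v v' : ℕ → Ω → E} (hr : Measurable r)
    (hv : ∀ t, Measurable (v t)) (hvm' : ∀ t, Measurable (v' t)) (hind : iIndepFun v P)
    (hrv : IndepFun r (fun ω t => v t ω) P) {D : ℕ → 𝓡 × (ℕ → E) → E}
    (hD : ∀ t, Measurable (D t)) (hDt : ∀ t ρ w, D t (ρ, trunc t w) = D t (ρ, w))
    (hv' : ∀ t ω, v' t ω = v t ω + D t (r ω, fun s => v' s ω))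
    {J : E → ℝ≥0∞} (hJm : Measurable J) (hJ : ∀ a, J a ≠ ∞)
    (hJv : ∀ t a, klDiv ((P.map (v t)).map (· + a)) (P.map (v t)) ≤ J a) (N : ℕ) :
    klDiv (P.map fun ω => (r ω, trunc N fun s => v' s ω))
      (P.map fun ω => (r ω, trunc N fun s => v s ω)) ≤
      ∑ t ∈ Finset.range N, ∫⁻ ω, J (D t (r ω, fun s => v' s ω)) ∂P := by
  have hX : ∀ {v : ℕ → Ω → E}, (∀ t, Measurable (v t)) → ∀ t,
      Measurable fun ω => (r ω, trunc t fun s => v s ω) := fun hv t =>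
    hr.prodMk ((measurable_trunc t).comp (measurable_pi_lambda _ hv))
  induction N with
  | zero =>
    simp only [trunc_zero, Finset.range_zero, Finset.sum_empty, nonpos_iff_eq_zero]
    exact klDiv_self _
  | succ t ih =>
    rw [Finset.sum_range_succ]
    -- Writing the new sample into slot `t` of the truncated past is a measurable map, so data
    -- processing carries the one-step bound over to time `t + 1`.
    have hΦ : Measurable fun q : (𝓡 × (ℕ → E)) × E => (q.1.1, Function.update q.1.2 t q.2) :=
      (measurable_fst.comp measurable_fst).prodMk (measurable_update'.comp
        ((measurable_snd.comp measurable_fst).prodMk measurable_snd))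
    obtain ⟨g, hg, hgv⟩ := exists_measurable_trunc_eq hD hDt hv' t
    have hXW' := indepFun_prodMk_trunc hr hv hind hrv t
    have hXW : IndepFun (fun ω => (r ω, trunc t fun s => v' s ω)) (v t) P := by
      simp only [hgv]
      exact hXW'.comp (φ := fun q : 𝓡 × (ℕ → E) => (q.1, g q)) (ψ := id)
        (measurable_fst.prodMk hg) measurable_id
    have hstep := klDiv_map_prodMk_add_le (hX hvm' t) (hX hv t) (hv t) hXW hXW' (hD t) hJ (hJv t)
    have h1 : ∀ ω, v t ω + D t (r ω, trunc t fun s => v' s ω) = v' t ω := fun ω => by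
      rw [hDt, ← hv']
    simp only [h1] at hstep
    have := Measure.isProbabilityMeasure_map ((hX hvm' t).prodMk (hvm' t)).aemeasurable (μ := P)
    have := Measure.isProbabilityMeasure_map ((hX hv t).prodMk (hv t)).aemeasurable (μ := P)
    have h2 := klDiv_map_le (μ := P.map fun ω => ((r ω, trunc t fun s => v' s ω), v' t ω))
      (ν := P.map fun ω => ((r ω, trunc t fun s => v s ω), v t ω)) hΦ
    rw [Measure.map_map hΦ ((hX hvm' t).prodMk (hvm' t)),
      Measure.map_map hΦ ((hX hv t).prodMk (hv t))] at h2
    rw [lintegral_map (f := fun a => J (D t a)) (hJm.comp (hD t)) (hX hvm' t)] at hstep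
    simp only [hDt] at hstep
    simp only [trunc_succ]
    exact h2.trans (hstep.trans (by gcongr))

end Shift

/-! ### Shifted Gaussian laws -/

section Gaussian

open InformationTheory

theorem klDiv_prod_right {α β : Type*} [MeasurableSpace α] [MeasurableSpace β] (μ ν : Measure α)
    (τ : Measure β) [IsFiniteMeasure μ] [IsFiniteMeasure ν] [IsProbabilityMeasure τ] :
    klDiv (μ.prod τ) (ν.prod τ) = klDiv μ ν := by
  rw [← Measure.compProd_const, ← Measure.compProd_const, klDiv_compProd_left]

theorem gaussianReal_eq_withDensity (m : ℝ) {v : NNReal} (hv : v ≠ 0) :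
    gaussianReal m v = (gaussianReal 0 v).withDensity
      fun x => ENNReal.ofReal (Real.exp ((m * x - m ^ 2 / 2) / v)) := by
  rw [gaussianReal_of_var_ne_zero _ hv, gaussianReal_of_var_ne_zero _ hv,
    ← withDensity_mul _ (measurable_gaussianPDF _ _) (by fun_prop)]
  congr 1
  ext x
  have hv' : (v : ℝ) ≠ 0 := by exact_mod_cast hv
  rw [Pi.mul_apply, gaussianPDF, gaussianPDF, ← ENNReal.ofReal_mul (gaussianPDFReal_nonneg _ _ _),
    gaussianPDFReal, gaussianPDFReal, mul_assoc (√_)⁻¹ _ (Real.exp _), ← Real.exp_add]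
  congr 3
  field_simp
  ring

/-- The log-likelihood ratio is affine, so only the mean of the shifted law enters. -/
theorem klDiv_gaussianReal (m : ℝ) {v : NNReal} (hv : v ≠ 0) :
    klDiv (gaussianReal m v) (gaussianReal 0 v) = ENNReal.ofReal (m ^ 2 / (2 * v)) := by
  have hw := gaussianReal_eq_withDensity m hv
  have hac : gaussianReal m v ≪ gaussianReal 0 v := by
    rw [hw]
    exact withDensity_absolutelyContinuous _ _
  have hllr : llr (gaussianReal m v) (gaussianReal 0 v) =ᵐ[gaussianReal m v]
      fun x => (m * x - m ^ 2 / 2) / v := by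
    refine hac.ae_le ?_
    have := Measure.rnDeriv_withDensity (gaussianReal 0 v)
      (f := fun x => ENNReal.ofReal (Real.exp ((m * x - m ^ 2 / 2) / v))) (by fun_prop)
    rw [← hw] at this
    filter_upwards [this] with x hx
    rw [llr, hx, ENNReal.toReal_ofReal (Real.exp_pos _).le, Real.log_exp]
  have hid : Integrable (fun x : ℝ => x) (gaussianReal m v) :=
    (memLp_id_gaussianReal 1).integrable le_rfl
  have hint : Integrable (fun x => (m * x - m ^ 2 / 2) / v) (gaussianReal m v) :=
    ((hid.const_mul m).sub (integrable_const _)).div_const _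
  rw [klDiv_of_ac_of_integrable hac ((integrable_congr hllr).2 hint), integral_congr_ae hllr,
    integral_div, integral_sub (hid.const_mul m) (integrable_const _), integral_const_mul,
    integral_id_gaussianReal]
  simp
  congr 1
  field_simp
  ring

end Gaussian

/-! ### Shifted Gaussian vectors -/

section GaussianShift

open InformationTheory

variable {Ω : Type*} [MeasurableSpace Ω] {P : Measure Ω}

/-- The divergence between a Gaussian law and its shift along a vector of its Cameron-Martin
space. -/
theorem klDiv_map_add_le_of_cameronMartin {E : Type*} [NormedAddCommGroup E] [NormedSpace ℝ E]
    [CompleteSpace E] [SecondCountableTopology E] [MeasurableSpace E] [BorelSpace E]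
    {V : Ω → E} (hVm : Measurable V) (hV : HasGaussianLaw V P) (L : StrongDual ℝ E) (a : E)
    (hL0 : ∫ ω, L (V ω) ∂P = 0)
    (hLa : ∀ M : StrongDual ℝ E, ∫ ω, M (V ω) * L (V ω) ∂P = M a) :
    klDiv ((P.map V).map (· + a)) (P.map V) ≤ ENNReal.ofReal (L a / 2) := by
  have hP := hV.isProbabilityMeasure
  have := hV.isGaussian_map
  have hLp : ∀ M : StrongDual ℝ E, MemLp (fun ω => M (V ω)) 2 P :=
    fun M => (hV.map_fun M).memLp_two
  have hs0 : 0 ≤ L a := by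
    rw [← hLa]
    exact integral_nonneg fun ω => mul_self_nonneg _
  -- If `L a = 0` then `L V = 0` almost surely, so every functional kills `a` and there is no shift.
  rcases hs0.eq_or_lt with hs | hs
  · have h0 : (fun ω => L (V ω) * L (V ω)) =ᵐ[P] 0 := by
      rw [← integral_eq_zero_iff_of_nonneg (fun ω => mul_self_nonneg _)
        ((hLp L).integrable_mul (hLp L)), hLa, hs]
    have ha : a = 0 := by
      by_contra ha
      obtain ⟨M, hM⟩ := SeparatingDual.exists_ne_zero (R := ℝ) ha
      refine hM ?_
      rw [← hLa, ← integral_zero Ω ℝ (μ := P)]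
      refine integral_congr_ae ?_
      filter_upwards [h0] with ω hω
      rw [mul_self_eq_zero.1 hω, mul_zero]
    simp [ha]
  set s := L a with hs_def
  set ξ : Ω → ℝ := fun ω => L (V ω) with hξ
  -- `V'` is uncorrelated with `ξ`, hence independent of it by joint normality. Translating `V` by
  -- `a` translates `ξ` by `s` and leaves `V'` alone, so the problem is one-dimensional with mean
  -- and variance `s`.
  set V' : Ω → E := fun ω => V ω - (ξ ω / s) • a with hV'
  have hξm : Measurable ξ := L.continuous.measurable.comp hVm
  have hVm' : Measurable V' := hVm.sub ((hξm.div_const s).smul_const a)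
  have hpair : HasGaussianLaw (fun ω => (ξ ω, V' ω)) P := by
    have := hV.map_fun
      (L.prod (ContinuousLinearMap.id ℝ E - (s⁻¹ • L).smulRight a))
    refine this.congr (Eventually.of_forall fun ω => ?_)
    simp [hξ, hV', div_eq_inv_mul]
  have hind : IndepFun ξ V' P := by
    refine hpair.indepFun_of_covariance_strongDual fun M₁ M₂ => ?_
    have e1 : ⇑M₁ ∘ ξ = M₁ 1 • ξ := by
      ext ω
      have := M₁.map_smul (ξ ω) 1
      simp only [smul_eq_mul, mul_one] at this
      simp [this, mul_comm]
    have e2 : ⇑M₂ ∘ V' = (fun ω => M₂ (V ω)) - (M₂ a / s) • ξ := by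
      ext ω
      simp [hV']
      ring
    have c1 : cov[ξ, fun ω => M₂ (V ω); P] = M₂ a := by
      rw [covariance_comm, covariance_eq_sub (hLp M₂) (hLp L), hL0, mul_zero, sub_zero]
      exact hLa M₂
    have c2 : cov[ξ, ξ; P] = s := by
      rw [covariance_eq_sub (hLp L) (hLp L), hL0, mul_zero, sub_zero]
      exact hLa L
    rw [e1, e2, covariance_smul_left, covariance_sub_right (hLp L) (hLp M₂)
      ((hLp L).const_smul _), covariance_smul_right, c1, c2, div_mul_cancel₀ _ hs.ne', sub_self,
      mul_zero]
  have hξlaw : P.map ξ = gaussianReal 0 s.toNNReal := by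
    have h := (hV.map_fun L).map_eq_gaussianReal
    rw [hL0, variance_of_integral_eq_zero hξm.aemeasurable hL0] at h
    have : ∫ ω, ξ ω ^ 2 ∂P = s := by
      simp only [pow_two]
      exact hLa L
    rw [this] at h
    exact h
  have hprod : P.map (fun ω => (ξ ω, V' ω)) = (P.map ξ).prod (P.map V') :=
    (indepFun_iff_map_prod_eq_prod_map_map hξm.aemeasurable hVm'.aemeasurable).1 hind
  have hΨ : Measurable fun q : ℝ × E => (q.1 / s) • a + q.2 :=
    ((measurable_fst.div_const s).smul_const a).add measurable_snd
  have := Measure.isProbabilityMeasure_map hξm.aemeasurable (μ := P)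
  have := Measure.isProbabilityMeasure_map hVm'.aemeasurable (μ := P)
  have e1 : P.map V = ((gaussianReal 0 s.toNNReal).prod (P.map V')).map
      fun q : ℝ × E => (q.1 / s) • a + q.2 := by
    rw [← hξlaw, ← hprod, Measure.map_map hΨ (hξm.prodMk hVm')]
    congr 1
    ext ω
    simp [hV']
  have e2 : (P.map V).map (· + a) = ((gaussianReal s s.toNNReal).prod (P.map V')).map
      fun q : ℝ × E => (q.1 / s) • a + q.2 := by
    have h1 : gaussianReal s s.toNNReal = (gaussianReal 0 s.toNNReal).map (· + s) := by
      rw [gaussianReal_map_add_const, zero_add]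
    rw [h1, ← Measure.map_id (μ := P.map V'), Measure.map_prod_map _ _ (by fun_prop) measurable_id,
      Measure.map_map hΨ (by fun_prop), e1, Measure.map_map (by fun_prop) hΨ]
    congr 1
    ext q
    simp only [Function.comp_apply, Prod.map_fst, Prod.map_snd, id, add_div, div_self hs.ne',
      add_smul, one_smul]
    abel
  rw [e2, e1]
  refine (klDiv_map_le _ _ hΨ).trans ?_
  rw [klDiv_prod_right, klDiv_gaussianReal _ (by simpa using hs), Real.coe_toNNReal _ hs.le]
  refine ENNReal.ofReal_le_ofReal (le_of_eq ?_)
  field_simp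

theorem sum_norm_mulVec_sq_le {𝕜 : Type*} [RCLike 𝕜] {a b : ℕ} (M : Matrix (Fin a) (Fin b) 𝕜)
    (x : Fin b → 𝕜) : ∑ i, ‖M.mulVec x i‖ ^ 2 ≤ frob M ^ 2 * ∑ j, ‖x j‖ ^ 2 := by
  rw [frob_sq, Finset.sum_mul]
  refine Finset.sum_le_sum fun i _ => ?_
  refine le_trans ?_ (Finset.sum_mul_sq_le_sq_mul_sq Finset.univ (fun j => ‖M i j‖) fun j => ‖x j‖)
  gcongr
  calc ‖M.mulVec x i‖ ≤ ∑ j, ‖M i j * x j‖ :=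
        norm_sum_le Finset.univ fun j => M i j * x j
    _ = ∑ j, ‖M i j‖ * ‖x j‖ := by simp only [norm_mul]

theorem norm_sum_conj_mulVec_mul_le {𝕜 : Type*} [RCLike 𝕜] {a : ℕ} (M : Matrix (Fin a) (Fin a) 𝕜)
    (x : Fin a → 𝕜) : ‖∑ i, conj (M.mulVec x i) * x i‖ ≤ frob M * ∑ j, ‖x j‖ ^ 2 := by
  have h0 : 0 ≤ ∑ j, ‖x j‖ ^ 2 := Finset.sum_nonneg fun _ _ => by positivity
  refine (norm_sum_le _ _).trans ?_
  simp only [norm_mul, RCLike.norm_conj]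
  refine abs_le_of_sq_le_sq' ?_ (mul_nonneg (frob_nonneg _) h0) |>.2
  refine (Finset.sum_mul_sq_le_sq_mul_sq _ _ _).trans ?_
  refine (mul_le_mul_of_nonneg_right (sum_norm_mulVec_sq_le M x) h0).trans (le_of_eq ?_)
  ring

/-- The divergence between a nondegenerate Gaussian law (circularly symmetric in the complex case)
and its shifts. -/
theorem klDiv_map_add_le_of_posDef {𝕜 : Type*} [RCLike 𝕜] {p : ℕ} {V : Ω → Fin p → 𝕜}
    {Γ : Matrix (Fin p) (Fin p) 𝕜} {g : ℝ} (hVm : Measurable V) (hV : IsGaussian (P.map V))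
    (h0 : ∀ i, ∫ ω, V ω i ∂P = 0) (hcov : ∀ i j, ∫ ω, V ω i * conj (V ω j) ∂P = Γ i j)
    (hcirc : (RCLike.I : 𝕜) ≠ 0 → ∀ i j, ∫ ω, V ω i * V ω j ∂P = 0)
    (hΓ : Γ.PosDef) (hg : frob Γ⁻¹ ≤ g) (a : Fin p → 𝕜) :
    klDiv ((P.map V).map (· + a)) (P.map V) ≤ ENNReal.ofReal (g * ∑ i, ‖a i‖ ^ 2) := by
  have hVl : HasGaussianLaw V P := ⟨hV⟩
  have hP := hVl.isProbabilityMeasure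
  set w := Γ⁻¹.mulVec a with hw
  have hΓw : Γ.mulVec w = a := by
    rw [hw, Matrix.mulVec_mulVec, Matrix.mul_nonsing_inv _ ((Matrix.isUnit_iff_isUnit_det _).1 hΓ.isUnit), Matrix.one_mulVec]
  -- For a circular complex law the real part of `conj (w j) * V j` captures half of the covariance;
  -- the factor `2` restores `E[L(V) V] = Γ w = a`.
  set α : ℝ := if (RCLike.I : 𝕜) = 0 then 1 else 2 with hα
  set L : StrongDual ℝ (Fin p → 𝕜) :=
    α • ∑ j, (RCLike.reCLM.comp ((ContinuousLinearMap.mul ℝ 𝕜 (conj (w j))).comp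
      (ContinuousLinearMap.proj j : (Fin p → 𝕜) →L[ℝ] 𝕜))) with hL
  have hLx : ∀ x, L x = α * ∑ j, RCLike.re (conj (w j) * x j) := fun x => by
    simp [hL]
  have hmem : ∀ i, MemLp (fun ω => V ω i) 2 P := fun i =>
    (hVl.map_fun (ContinuousLinearMap.proj i : (Fin p → 𝕜) →L[ℝ] 𝕜)).memLp_two
  have hmemc : ∀ i, MemLp (fun ω => conj (V ω i)) 2 P := fun i => (hmem i).star
  have hmemL : MemLp (fun ω => L (V ω)) 2 P := (hVl.map_fun L).memLp_two
  have hLV : ∀ i, ∫ ω, ((L (V ω) : ℝ) : 𝕜) * V ω i ∂P = a i := by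
    intro i
    have e1 : ∀ ω, ((L (V ω) : ℝ) : 𝕜) * V ω i = ∑ j, ((α / 2 : ℝ) : 𝕜) *
        (conj (w j) * (V ω i * V ω j) + w j * (V ω i * conj (V ω j))) := fun ω => by
      rw [hLx, ← Finset.mul_sum]
      push_cast
      rw [Finset.mul_sum, Finset.sum_mul, Finset.mul_sum]
      refine Finset.sum_congr rfl fun j _ => ?_
      have := RCLike.re_eq_add_conj (conj (w j) * V ω j)
      rw [map_mul conj, RCLike.conj_conj] at this
      linear_combination (α : 𝕜) * V ω i * this
    have i1 : ∀ j, Integrable (fun ω => V ω i * V ω j) P := fun j =>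
      (hmem i).integrable_mul (hmem j)
    have i2 : ∀ j, Integrable (fun ω => V ω i * conj (V ω j)) P := fun j =>
      (hmem i).integrable_mul (hmemc j)
    simp only [e1]
    have i3 : ∀ j, Integrable (fun ω => ((α / 2 : ℝ) : 𝕜) *
        (conj (w j) * (V ω i * V ω j) + w j * (V ω i * conj (V ω j)))) P := fun j =>
      Integrable.const_mul (Integrable.add ((i1 j).const_mul _) ((i2 j).const_mul _)) _
    rw [integral_finsetSum _ fun j _ => i3 j]
    conv_rhs => rw [← hΓw]
    refine Finset.sum_congr rfl fun j _ => ?_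
    rw [integral_const_mul, integral_add ((i1 j).const_mul _) ((i2 j).const_mul _),
      integral_const_mul, integral_const_mul, hcov]
    by_cases hI : (RCLike.I : 𝕜) = 0
    · have hc : ∀ z : 𝕜, conj z = z := fun z => RCLike.conj_eq_iff_im.2 (RCLike.im_eq_zero hI z)
      have : ∫ ω, V ω i * V ω j ∂P = Γ i j := by
        rw [← hcov]
        simp only [hc]
      rw [this, hc, hα, if_pos hI]
      push_cast
      ring
    · rw [hcirc hI, hα, if_neg hI]
      push_cast
      ring
  have hLa := klDiv_map_add_le_of_cameronMartin hVm hVl L a (by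
      rw [L.integral_comp_comm hVl.integrable]
      have : ∫ ω, V ω ∂P = 0 := by
        ext i
        rw [eval_integral fun i => (hmem i).integrable one_le_two, h0 i, Pi.zero_apply]
      rw [this, map_zero]) fun M => by
    have e : ∀ ω, M (V ω) * L (V ω) = M (L (V ω) • V ω) := fun ω => by
      rw [map_smul, smul_eq_mul, mul_comm]
    have hi : ∀ i, Integrable (fun ω => (L (V ω) • V ω) i) P := fun i => by
      have := (hmemL.ofReal (K := 𝕜)).integrable_mul (hmem i)
      refine this.congr (Eventually.of_forall fun ω => ?_)
      simp [RCLike.real_smul_eq_coe_mul]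
    simp only [e]
    rw [M.integral_comp_comm (Integrable.of_eval hi)]
    congr 1
    ext i
    rw [eval_integral hi, ← hLV i]
    simp only [Pi.smul_apply, RCLike.real_smul_eq_coe_mul]
  refine hLa.trans (ENNReal.ofReal_le_ofReal ?_)
  have h1 : ∑ j, RCLike.re (conj (w j) * a j) ≤ frob Γ⁻¹ * ∑ j, ‖a j‖ ^ 2 := by
    rw [← map_sum]
    exact (RCLike.re_le_norm _).trans (norm_sum_conj_mulVec_mul_le _ _)
  have hα' : α / 2 ≤ 1 ∧ 0 ≤ α / 2 := by
    rw [hα]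
    split_ifs <;> norm_num
  have h2 : 0 ≤ ∑ j, ‖a j‖ ^ 2 := Finset.sum_nonneg fun _ _ => by positivity
  have h3 := mul_nonneg (frob_nonneg Γ⁻¹) h2
  have h4 : frob Γ⁻¹ * ∑ j, ‖a j‖ ^ 2 ≤ g * ∑ j, ‖a j‖ ^ 2 := by gcongr
  rw [hLx]
  nlinarith [mul_le_mul_of_nonneg_left h1 hα'.2, mul_nonneg (sub_nonneg.2 hα'.1) h3]

end GaussianShift

/-! ### Replaying the closed loop of one system by another -/

section Replay

variable {𝕜 : Type*} [RCLike 𝕜] {n d m p : ℕ}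

/-- The state of the system driven from `0` by the input `u`. -/
def drivenState (T : StateSpace 𝕜 n m p) (u : ℕ → Fin m → 𝕜) : ℕ → Fin n → 𝕜
  | 0 => 0
  | t + 1 => T.A.mulVec (drivenState T u t) + T.B.mulVec (u t)

theorem drivenState_congr (T : StateSpace 𝕜 n m p) {u u' : ℕ → Fin m → 𝕜} {t : ℕ}
    (h : ∀ s < t, u s = u' s) : drivenState T u t = drivenState T u' t := by
  induction t with
  | zero => rfl
  | succ t ih =>
    rw [drivenState, drivenState, ih fun s hs => h s (hs.trans t.lt_succ_self),
      h t t.lt_succ_self]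

theorem drivenState_eq_sum (T : StateSpace 𝕜 n m p) (u : ℕ → Fin m → 𝕜) (t : ℕ) :
    drivenState T u t = ∑ k ∈ Finset.range t, (T.A ^ k * T.B).mulVec (u (t - 1 - k)) := by
  induction t with
  | zero => rfl
  | succ t ih =>
    rw [drivenState, ih, Finset.sum_range_succ', Matrix.mulVec_sum]
    congr 1
    · refine Finset.sum_congr rfl fun k _ => ?_
      rw [Matrix.mulVec_mulVec, ← Matrix.mul_assoc, ← pow_succ']
      congr 2
      omega
    · simp

theorem mulVec_drivenState (T : StateSpace 𝕜 n m p) (u : ℕ → Fin m → 𝕜) (t : ℕ) :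
    T.C.mulVec (drivenState T u t) =
      ∑ k ∈ Finset.range t, (markov T k).mulVec (u (t - 1 - k)) := by
  rw [drivenState_eq_sum, Matrix.mulVec_sum]
  refine Finset.sum_congr rfl fun k _ => ?_
  rw [Matrix.mulVec_mulVec, markov, Matrix.mul_assoc]

/-- The difference of the noise-free outputs of two systems driven by the input `u`. -/
def outputGap (S T : StateSpace 𝕜 n m p) (u : ℕ → Fin m → 𝕜) (t : ℕ) : Fin p → 𝕜 :=
  S.C.mulVec (drivenState S u t) - T.C.mulVec (drivenState T u t)

theorem outputGap_eq_sum (S T : StateSpace 𝕜 n m p) (u : ℕ → Fin m → 𝕜) (t : ℕ) :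
    outputGap S T u t =
      ∑ k ∈ Finset.range t, (markov S k - markov T k).mulVec (u (t - 1 - k)) := by
  rw [outputGap, mulVec_drivenState, mulVec_drivenState, ← Finset.sum_sub_distrib]
  simp only [Matrix.sub_mulVec]

theorem loopState_congr (S : StateSpace 𝕜 n m p) (K : Controller 𝕜 d m p) (r : ℕ → Fin m → 𝕜)
    {v v' : ℕ → Fin p → 𝕜} {t : ℕ} (h : ∀ s < t, v s = v' s) :
    loopState S K r v t = loopState S K r v' t := by
  induction t with
  | zero => rfl
  | succ t ih =>
    simp only [loopState]
    rw [ih fun s hs => h s (hs.trans t.lt_succ_self), h t t.lt_succ_self]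

theorem output_congr (S : StateSpace 𝕜 n m p) (K : Controller 𝕜 d m p) (r : ℕ → Fin m → 𝕜)
    {v v' : ℕ → Fin p → 𝕜} {t : ℕ} (h : ∀ s ≤ t, v s = v' s) :
    output S K r v t = output S K r v' t := by
  rw [output, output, loopState_congr S K r fun s hs => h s (le_of_lt hs), h t le_rfl]

theorem input_congr (S : StateSpace 𝕜 n m p) (K : Controller 𝕜 d m p) (r : ℕ → Fin m → 𝕜)
    {v v' : ℕ → Fin p → 𝕜} {t : ℕ} (h : ∀ s ≤ t, v s = v' s) :
    input S K r v t = input S K r v' t := by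
  rw [input, input, loopState_congr S K r fun s hs => h s (le_of_lt hs), output_congr S K r h]

theorem loopState_fst (S : StateSpace 𝕜 n m p) (K : Controller 𝕜 d m p) (r : ℕ → Fin m → 𝕜)
    (v : ℕ → Fin p → 𝕜) (t : ℕ) :
    (loopState S K r v t).1 = drivenState S (input S K r v) t := by
  induction t with
  | zero => rfl
  | succ t ih => rw [drivenState, ← ih]; rfl

/-- The gap makes up for the difference of the noise-free outputs at each step, so the controller
receives the same output and, inductively, sends the same input. -/
theorem loopState_replay (S T : StateSpace 𝕜 n m p) (K : Controller 𝕜 d m p)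
    (r : ℕ → Fin m → 𝕜) (v : ℕ → Fin p → 𝕜) (t : ℕ) :
    loopState T K r (fun s => v s + outputGap S T (input S K r v) s) t =
      (drivenState T (input S K r v) t, (loopState S K r v t).2) := by
  induction t with
  | zero => rfl
  | succ t ih =>
    have hy : outputOf T (drivenState T (input S K r v) t)
        (v t + outputGap S T (input S K r v) t) = outputOf S (loopState S K r v t).1 (v t) := by
      rw [outputOf, outputOf, outputGap, loopState_fst]
      abel
    simp only [loopState, ih, drivenState, hy]
    rfl

/-- With its noise shifted by the output gap, the system `T` reproduces the outputs of `S`. -/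
theorem output_replay (S T : StateSpace 𝕜 n m p) (K : Controller 𝕜 d m p)
    (r : ℕ → Fin m → 𝕜) (v : ℕ → Fin p → 𝕜) (t : ℕ) :
    output T K r (fun s => v s + outputGap S T (input S K r v) s) t = output S K r v t := by
  rw [output, loopState_replay, output, outputOf, outputOf, outputGap, loopState_fst]
  abel

/-- With its noise shifted by the output gap, the system `T` reproduces the inputs of `S`. -/
theorem input_replay (S T : StateSpace 𝕜 n m p) (K : Controller 𝕜 d m p)
    (r : ℕ → Fin m → 𝕜) (v : ℕ → Fin p → 𝕜) :
    input T K r (fun s => v s + outputGap S T (input S K r v) s) = input S K r v := by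
  ext1 t
  rw [input, loopState_replay, output_replay]
  rfl

section Measurability

variable {α : Type*} [MeasurableSpace α]

theorem measurable_mulVec {a b : ℕ} (M : Matrix (Fin a) (Fin b) 𝕜) {f : α → Fin b → 𝕜}
    (hf : Measurable f) : Measurable fun x => M.mulVec (f x) :=
  (Continuous.matrix_mulVec (A := fun _ : Fin b → 𝕜 => M) continuous_const
    continuous_id).measurable.comp hf

theorem measurable_loopState (S : StateSpace 𝕜 n m p) (K : Controller 𝕜 d m p)
    {r : α → ℕ → Fin m → 𝕜} {v : α → ℕ → Fin p → 𝕜} (hr : ∀ t, Measurable fun x => r x t)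
    (hv : ∀ t, Measurable fun x => v x t) (t : ℕ) :
    Measurable fun x => loopState S K (r x) (v x) t := by
  induction t with
  | zero => exact measurable_const
  | succ t ih =>
    have hy : Measurable fun x => outputOf S (loopState S K (r x) (v x) t).1 (v x t) :=
      (measurable_mulVec _ ih.fst).add (hv t)
    exact ((measurable_mulVec _ ih.fst).add (measurable_mulVec _
      (((measurable_mulVec _ ih.snd).add (measurable_mulVec _ hy)).add (hr t)))).prodMk
        ((measurable_mulVec _ ih.snd).add (measurable_mulVec _ hy))

theorem measurable_output (S : StateSpace 𝕜 n m p) (K : Controller 𝕜 d m p)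
    {r : α → ℕ → Fin m → 𝕜} {v : α → ℕ → Fin p → 𝕜} (hr : ∀ t, Measurable fun x => r x t)
    (hv : ∀ t, Measurable fun x => v x t) (t : ℕ) :
    Measurable fun x => output S K (r x) (v x) t :=
  (measurable_mulVec _ (measurable_loopState S K hr hv t).fst).add (hv t)

theorem measurable_input (S : StateSpace 𝕜 n m p) (K : Controller 𝕜 d m p)
    {r : α → ℕ → Fin m → 𝕜} {v : α → ℕ → Fin p → 𝕜} (hr : ∀ t, Measurable fun x => r x t)
    (hv : ∀ t, Measurable fun x => v x t) (t : ℕ) :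
    Measurable fun x => input S K (r x) (v x) t :=
  ((measurable_mulVec _ (measurable_loopState S K hr hv t).snd).add
    (measurable_mulVec _ (measurable_output S K hr hv t))).add (hr t)

theorem measurable_drivenState (T : StateSpace 𝕜 n m p) {u : α → ℕ → Fin m → 𝕜}
    (hu : ∀ t, Measurable fun x => u x t) (t : ℕ) : Measurable fun x => drivenState T (u x) t := by
  induction t with
  | zero => exact measurable_const
  | succ t ih => exact (measurable_mulVec _ ih).add (measurable_mulVec _ (hu t))

theorem measurable_outputGap (S T : StateSpace 𝕜 n m p) {u : α → ℕ → Fin m → 𝕜}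
    (hu : ∀ t, Measurable fun x => u x t) (t : ℕ) : Measurable fun x => outputGap S T (u x) t :=
  (measurable_mulVec _ (measurable_drivenState S hu t)).sub
    (measurable_mulVec _ (measurable_drivenState T hu t))

end Measurability

theorem outputGap_congr (S T : StateSpace 𝕜 n m p) {u u' : ℕ → Fin m → 𝕜} {t : ℕ}
    (h : ∀ s < t, u s = u' s) : outputGap S T u t = outputGap S T u' t := by
  rw [outputGap, outputGap, drivenState_congr S h, drivenState_congr T h]

/-- The expected divergence is at most the sum of the expected divergences due to the output
gaps. -/
theorem expectedKL_le_sum {Ω : Type*} [MeasurableSpace Ω] {P : Measure Ω} [IsProbabilityMeasure P]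
    (S T : StateSpace 𝕜 n m p) (K : Controller 𝕜 d m p) {r : ℕ → Ω → Fin m → 𝕜}
    {v : ℕ → Ω → Fin p → 𝕜} {Γ : Matrix (Fin p) (Fin p) 𝕜} {g : ℝ} (hΓ : Γ.PosDef)
    (hg : frob Γ⁻¹ ≤ g) (hv : IsGaussianWhiteNoise v Γ P) (hr : ∀ t, Measurable (r t))
    (hrv : IndepFun (fun ω t => r t ω) (fun ω t => v t ω) P) (N : ℕ) :
    expectedKL S T K r v P N ≤ ∑ t ∈ Finset.range (N + 1), ∫⁻ ω, ENNReal.ofReal (g * ∑ i,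
      ‖outputGap S T (input S K (fun s => r s ω) (fun s => v s ω)) t i‖ ^ 2) ∂P := by
  have hin : ∀ (S : StateSpace 𝕜 n m p) (t : ℕ),
      Measurable fun ω => input S K (fun s => r s ω) (fun s => v s ω) t :=
    fun S => measurable_input S K hr hv.measurable
  have hX : ∀ S : StateSpace 𝕜 n m p, Measurable (inputSamples S K r v N) := fun S =>
    measurable_pi_lambda _ fun i => hin S i
  have hY : ∀ S : StateSpace 𝕜 n m p, Measurable (outputSamples S K r v N) := fun S =>
    measurable_pi_lambda _ fun i => measurable_output S K hr hv.measurable (i + 1)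
  refine (lintegral_klDiv_condDistrib_le (hX S) (hX T) (hY S) (hY T)).trans ?_
  set v' : ℕ → Ω → Fin p → 𝕜 := fun t ω =>
    v t ω + outputGap S T (input S K (fun s => r s ω) (fun s => v s ω)) t with hv'
  have hvm' : ∀ t, Measurable (v' t) := fun t =>
    (hv.measurable t).add (measurable_outputGap S T (hin S) t)
  -- Both sets of samples come from the loop of `T`: those of `S` from the shifted noise `v'`, those
  -- of `T` from `v`. Data processing then leaves the noises to be compared.
  set Φ : (ℕ → Fin m → 𝕜) × (ℕ → Fin p → 𝕜) → (Fin N → Fin m → 𝕜) × (Fin N → Fin p → 𝕜) :=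
    fun q => (fun i => input T K q.1 q.2 i, fun i => output T K q.1 q.2 (i + 1)) with hΦ
  have hm1 : ∀ t, Measurable fun q : (ℕ → Fin m → 𝕜) × (ℕ → Fin p → 𝕜) => q.1 t := fun t =>
    (measurable_pi_apply t).comp measurable_fst
  have hm2 : ∀ t, Measurable fun q : (ℕ → Fin m → 𝕜) × (ℕ → Fin p → 𝕜) => q.2 t := fun t =>
    (measurable_pi_apply t).comp measurable_snd
  have hΦm : Measurable Φ :=
    (measurable_pi_lambda _ fun i : Fin N => measurable_input T K hm1 hm2 i).prodMk
      (measurable_pi_lambda _ fun i : Fin N => measurable_output T K hm1 hm2 (i + 1))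
  -- The last output `y_N` contains `v_N`, so `N + 1` noise samples matter.
  have hΦt : ∀ ρ w, Φ (ρ, trunc (N + 1) w) = Φ (ρ, w) := fun ρ w => by
    refine Prod.ext (funext fun i => input_congr _ _ _ fun s hs => ?_)
      (funext fun i => output_congr _ _ _ fun s hs => ?_)
    · exact trunc_apply (by omega) w
    · exact trunc_apply (by omega) w
  have hrm : Measurable fun ω t => r t ω := measurable_pi_lambda _ hr
  have hmeas : ∀ {w : ℕ → Ω → Fin p → 𝕜}, (∀ t, Measurable (w t)) →
      Measurable fun ω => ((fun t => r t ω), trunc (N + 1) fun s => w s ω) := fun hw =>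
    hrm.prodMk ((measurable_trunc _).comp (measurable_pi_lambda _ hw))
  have e0 : (P.map fun ω => (inputSamples S K r v N ω, outputSamples S K r v N ω)) =
      (P.map fun ω => ((fun t => r t ω), trunc (N + 1) fun s => v' s ω)).map Φ := by
    rw [Measure.map_map hΦm (hmeas hvm')]
    congr 1
    ext1 ω
    rw [Function.comp_apply, hΦt]
    refine Prod.ext (funext fun i => ?_) (funext fun i => ?_)
    · exact (congrFun (input_replay S T K _ _) i).symm
    · exact (output_replay S T K _ _ _).symm
  have e1 : (P.map fun ω => (inputSamples T K r v N ω, outputSamples T K r v N ω)) =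
      (P.map fun ω => ((fun t => r t ω), trunc (N + 1) fun s => v s ω)).map Φ := by
    rw [Measure.map_map hΦm (hmeas hv.measurable)]
    congr 1
    ext1 ω
    rw [Function.comp_apply, hΦt]
    rfl
  have := Measure.isProbabilityMeasure_map (hmeas hvm').aemeasurable (μ := P)
  have := Measure.isProbabilityMeasure_map (hmeas hv.measurable).aemeasurable (μ := P)
  rw [e0, e1]
  refine (InformationTheory.klDiv_map_le _ _ hΦm).trans ?_
  have hD : ∀ t, Measurable fun q : (ℕ → Fin m → 𝕜) × (ℕ → Fin p → 𝕜) =>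
      outputGap S T (input T K q.1 q.2) t := fun t =>
    measurable_outputGap S T (measurable_input T K hm1 hm2) t
  have hrep : ∀ ω, input T K (fun s => r s ω) (fun s => v' s ω) =
      input S K (fun s => r s ω) fun s => v s ω := fun ω => input_replay S T K _ _
  -- Causality: the gap at time `t` depends on inputs, hence on noise, strictly before `t`.
  have key := klDiv_map_trunc_le hrm hv.measurable hvm' hv.indep hrv hD
    (fun t ρ w => outputGap_congr S T fun s hs => input_congr _ _ _ fun i hi =>
      trunc_apply (hi.trans_lt hs) w)
    (fun t ω => by
      change v' t ω = v t ω + outputGap S T (input T K (fun s => r s ω) fun s => v' s ω) t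
      rw [hrep])
    (J := fun a => ENNReal.ofReal (g * ∑ i, ‖a i‖ ^ 2))
    (by fun_prop) (fun _ => ENNReal.ofReal_ne_top)
    (fun t a => klDiv_map_add_le_of_posDef (hv.measurable t) (hv.gaussian t) (hv.mean_zero t)
      (hv.cov t) (fun h => hv.circular h t) hΓ hg a) (N + 1)
  simpa only [hrep] using key

end Replay

/-! ### Filtered stationary signals -/

section Spectral

open Complex (I)

theorem norm_sum_mul_mul_conj_le {a : ℕ} (M : Matrix (Fin a) (Fin a) ℂ) (g : Fin a → ℂ) :
    ‖∑ i, ∑ j, g i * M i j * conj (g j)‖ ≤ frob M * ∑ j, ‖g j‖ ^ 2 := by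
  have h := norm_sum_conj_mulVec_mul_le M fun j => conj (g j)
  simp only [RCLike.norm_conj] at h
  refine le_trans (le_of_eq ?_) h
  rw [← RCLike.norm_conj, map_sum]
  congr 1
  refine Finset.sum_congr rfl fun i _ => ?_
  rw [Matrix.mulVec, dotProduct, map_sum, map_sum, Finset.sum_mul]
  refine Finset.sum_congr rfl fun j _ => ?_
  simp only [map_mul]
  ring

theorem norm_circleMean_le {f : ℝ → ℂ} {g : ℝ → ℝ}
    (h : ∀ᵐ w ∂(volume.restrict (Set.Ioc 0 (2 * Real.pi))), ‖f w‖ ≤ g w)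
    (hg : IntervalIntegrable g volume 0 (2 * Real.pi)) : ‖circleMean f‖ ≤ circleMean g := by
  rw [circleMean, circleMean, norm_smul, smul_eq_mul,
    Real.norm_of_nonneg (inv_nonneg.2 Real.two_pi_pos.le)]
  refine mul_le_mul_of_nonneg_left ?_ (inv_nonneg.2 Real.two_pi_pos.le)
  refine intervalIntegral.norm_integral_le_of_norm_le Real.two_pi_pos.le ?_ hg
  rwa [ae_restrict_iff' measurableSet_Ioc] at h

theorem norm_apply_le_frob {𝕜 : Type*} [RCLike 𝕜] {a b : ℕ} (M : Matrix (Fin a) (Fin b) 𝕜)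
    (i : Fin a) (j : Fin b) : ‖M i j‖ ≤ frob M := by
  refine abs_le_of_sq_le_sq' ?_ (frob_nonneg M) |>.2
  rw [frob_sq]
  refine (Finset.single_le_sum (f := fun j => ‖M i j‖ ^ 2) (fun _ _ => sq_nonneg _)
    (Finset.mem_univ j)).trans ?_
  exact Finset.single_le_sum (f := fun i => ∑ j, ‖M i j‖ ^ 2)
    (fun _ _ => Finset.sum_nonneg fun _ _ => sq_nonneg _) (Finset.mem_univ i)

variable {𝕜 Ω : Type*} [RCLike 𝕜] [MeasurableSpace Ω] {P : Measure Ω} {m p : ℕ}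

theorem IsStationaryWithPSDBound.nonneg {u : ℕ → Ω → Fin m → 𝕜} {c : ℝ}
    (hu : IsStationaryWithPSDBound u P c) : 0 ≤ c := by
  obtain ⟨-, Ru, -, Φ, -, hΦ, -⟩ := hu
  have : (ae (volume.restrict (Set.Ioc 0 (2 * Real.pi)))).NeBot := by
    rw [ae_neBot, Ne, Measure.restrict_eq_zero]
    simp [Real.pi_pos]
  obtain ⟨w, hw⟩ := hΦ.exists
  exact (frob_nonneg _).trans hw

/-- The mean square of a linear functional of the past inputs. -/
theorem IsStationaryWithPSDBound.integral_norm_sq_le {u : ℕ → Ω → Fin m → 𝕜} {c : ℝ}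
    (hu : IsStationaryWithPSDBound u P c) (h : ℕ → Fin m → 𝕜) (t : ℕ) :
    ∫ ω, ‖∑ k ∈ Finset.range t, ∑ a, h k a * u (t - 1 - k) ω a‖ ^ 2 ∂P ≤
      c * ∑ k ∈ Finset.range t, ∑ a, ‖h k a‖ ^ 2 := by
  obtain ⟨hmem, Ru, hRu, Φ, hΦm, hΦc, hΦ⟩ := hu
  set f : ℕ × Fin m → ℂ := fun x => toC 𝕜 (h x.1 x.2) with hf
  set U : ℕ × Fin m → Ω → 𝕜 := fun x ω => u (t - 1 - x.1) ω x.2 with hU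
  set s : Finset (ℕ × Fin m) := Finset.range t ×ˢ Finset.univ with hs
  have hUmem : ∀ x, MemLp (U x) 2 P := fun x => (memLp_pi_iff.1 (hmem _)) x.2
  have hUint : ∀ x y, Integrable (fun ω => U x ω * conj (U y ω)) P := fun x y =>
    (hUmem x).integrable_mul (hUmem y).star
  set g : Fin m → ℝ → ℂ := fun a => trigPoly (fun k => toC 𝕜 (h k a)) t with hg
  have hgc : ∀ a, Continuous (g a) := fun a => continuous_trigPoly _ _
  have hΦint : ∀ a b, IntervalIntegrable (fun w => Φ w a b) volume 0 (2 * Real.pi) := fun a b => by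
    rw [intervalIntegrable_iff_integrableOn_Ioc_of_le Real.two_pi_pos.le]
    refine Integrable.of_bound (hΦm a b) c ?_
    filter_upwards [hΦc] with w hw
    exact (norm_apply_le_frob _ _ _).trans hw
  have hexp : ∀ ω, ((‖∑ k ∈ Finset.range t, ∑ a, h k a * u (t - 1 - k) ω a‖ ^ 2 : ℝ) : ℂ) =
      ∑ x ∈ s, ∑ y ∈ s, f x * conj (f y) * toC 𝕜 (U x ω * conj (U y ω)) := fun ω => by
    rw [← norm_toC, ← Complex.normSq_eq_norm_sq, Complex.normSq_eq_conj_mul_self, ← Finset.sum_product',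
      map_sum, map_sum, mul_comm, Finset.sum_mul_sum]
    refine Finset.sum_congr rfl fun x _ => Finset.sum_congr rfl fun y _ => ?_
    simp only [map_mul, toC_conj, hf, hU]
    ring
  have hcorr : ∀ x ∈ s, ∀ y ∈ s, ∫ ω, toC 𝕜 (U x ω * conj (U y ω)) ∂P =
      circleMean fun w => Φ w x.2 y.2 * (Complex.exp (x.1 * w * I) *
        Complex.exp (-(y.1 * w * I))) := fun x hx y hy => by
    have hx' := Finset.mem_range.1 (Finset.mem_product.1 hx).1
    have hy' := Finset.mem_range.1 (Finset.mem_product.1 hy).1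
    -- Both indices are below `t`, so the truncated subtractions are genuine.
    have hk : ((t - 1 - x.1 : ℕ) : ℤ) - ((t - 1 - y.1 : ℕ) : ℤ) = (y.1 : ℤ) - x.1 := by omega
    have h1 := (RCLike.map 𝕜 ℂ).integral_comp_comm (hUint x y)
    rw [hRu, hk, hΦ] at h1
    rw [← coe_toC] at h1
    refine h1.trans ?_
    rw [circleMean, Complex.real_smul]
    push_cast
    congr 2
    ext1 w
    rw [← Complex.exp_add]
    congr 2
    ring
  have hT : ∀ x y : ℕ × Fin m, IntervalIntegrable (fun w => f x * conj (f y) *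
      (Φ w x.2 y.2 * (Complex.exp (x.1 * w * I) * Complex.exp (-(y.1 * w * I))))) volume 0
      (2 * Real.pi) := fun x y =>
    ((hΦint x.2 y.2).mul_continuousOn (Continuous.continuousOn (by fun_prop))).const_mul _
  -- The mean square is the circle mean of the quadratic form of `Φ` at the frequency response `g`
  -- of the filter. Bounding `Φ` by `c` and applying Parseval finishes.
  have hmain : ((∫ ω, ‖∑ k ∈ Finset.range t, ∑ a, h k a * u (t - 1 - k) ω a‖ ^ 2 ∂P : ℝ) : ℂ) =
      circleMean fun w => ∑ a, ∑ b, g a w * Φ w a b * conj (g b w) := by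
    rw [← integral_complex_ofReal]
    simp only [hexp]
    have e1 : ∀ w, ∑ a, ∑ b, g a w * Φ w a b * conj (g b w) = ∑ x ∈ s, ∑ y ∈ s,
        f x * conj (f y) *
          (Φ w x.2 y.2 * (Complex.exp (x.1 * w * I) * Complex.exp (-(y.1 * w * I)))) := fun w => by
      rw [hs, Finset.sum_product_right]
      refine Finset.sum_congr rfl fun a _ => ?_
      simp only [Finset.sum_product_right (s := Finset.range t)]
      rw [Finset.sum_comm]
      refine Finset.sum_congr rfl fun b _ => ?_
      simp only [hg, trigPoly, map_sum, Finset.sum_mul, Finset.mul_sum, map_mul, conj_exp_mul_I, hf]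
      rw [Finset.sum_comm]
      refine Finset.sum_congr rfl fun k _ => Finset.sum_congr rfl fun l _ => ?_
      ring
    simp only [e1]
    have hI : ∀ x y, Integrable
        (fun ω => f x * conj (f y) * toC 𝕜 (U x ω * conj (U y ω))) P := fun x y =>
      ((RCLike.map 𝕜 ℂ).integrable_comp (hUint x y)).const_mul _
    have hT' : ∀ x, IntervalIntegrable (fun w => ∑ y ∈ s, f x * conj (f y) *
        (Φ w x.2 y.2 * (Complex.exp (x.1 * w * I) * Complex.exp (-(y.1 * w * I))))) volume 0
        (2 * Real.pi) := fun x => by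
      have h1 := IntervalIntegrable.sum s fun y _ => hT x y
      refine h1.congr fun w _ => ?_
      exact Finset.sum_apply _ _ _
    rw [integral_finsetSum _ fun x _ => integrable_finsetSum _ fun y _ => hI x y,
      circleMean_sum fun x _ => hT' x]
    refine Finset.sum_congr rfl fun x hx => ?_
    rw [integral_finsetSum _ fun y _ => hI x y, circleMean_sum fun y _ => hT x y]
    refine Finset.sum_congr rfl fun y hy => ?_
    rw [integral_const_mul, circleMean_const_mul, hcorr x hx y hy]
  have hle : ‖circleMean fun w => ∑ a, ∑ b, g a w * Φ w a b * conj (g b w)‖ ≤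
      circleMean fun w => c * ∑ a, ‖g a w‖ ^ 2 := by
    refine norm_circleMean_le ?_ (Continuous.intervalIntegrable (by fun_prop) _ _)
    filter_upwards [hΦc] with w hw
    refine (norm_sum_mul_mul_conj_le _ _).trans ?_
    gcongr
  rw [← hmain, Complex.norm_real, Real.norm_of_nonneg (integral_nonneg fun _ => by positivity)] at hle
  refine hle.trans (le_of_eq ?_)
  have e2 : circleMean (fun w => c * ∑ a, ‖g a w‖ ^ 2) =
      c * circleMean fun w => ∑ a, ‖g a w‖ ^ 2 := by
    rw [circleMean, intervalIntegral.integral_const_mul, circleMean, smul_eq_mul, smul_eq_mul]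
    ring
  rw [e2, circleMean_sum fun a _ => (Continuous.intervalIntegrable (by fun_prop) _ _),
    Finset.sum_comm]
  simp only [hg, circleMean_norm_trigPoly_sq, norm_toC]

/-- Each entry of the gap is a finite filter of past inputs whose coefficients are a row of the
Markov parameter differences. -/
theorem IsStationaryWithPSDBound.lintegral_outputGap_le {n : ℕ} {u : ℕ → Ω → Fin m → 𝕜} {c g : ℝ}
    (hu : IsStationaryWithPSDBound u P c) (hg : 0 ≤ g) (S T : StateSpace 𝕜 n m p) (t : ℕ) :
    ∫⁻ ω, ENNReal.ofReal (g * ∑ i, ‖outputGap S T (fun s => u s ω) t i‖ ^ 2) ∂P ≤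
      ENNReal.ofReal (g * (c * ∑ k ∈ Finset.range t, frob (markov S k - markov T k) ^ 2)) := by
  have hgap : ∀ ω i, outputGap S T (fun s => u s ω) t i =
      ∑ k ∈ Finset.range t, ∑ a, (markov S k - markov T k) i a * u (t - 1 - k) ω a := fun ω i => by
    rw [outputGap_eq_sum, Finset.sum_apply]
    rfl
  have hmem : ∀ i, MemLp (fun ω => outputGap S T (fun s => u s ω) t i) 2 P := fun i => by
    simp only [hgap]
    exact memLp_finsetSum _ fun k _ => memLp_finsetSum _ fun a _ =>
      ((memLp_pi_iff.1 (hu.1 _)) a).const_mul _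
  have hint : ∀ i, Integrable (fun ω => ‖outputGap S T (fun s => u s ω) t i‖ ^ 2) P := fun i =>
    (hmem i).norm.integrable_sq
  rw [← ofReal_integral_eq_lintegral_ofReal ((integrable_finsetSum _ fun i _ => hint i).const_mul g)
    (Eventually.of_forall fun ω => by positivity), integral_const_mul,
    integral_finsetSum _ fun i _ => hint i]
  refine ENNReal.ofReal_le_ofReal (mul_le_mul_of_nonneg_left ?_ hg)
  simp only [frob_sq]
  rw [Finset.sum_comm, Finset.mul_sum]
  refine Finset.sum_le_sum fun i _ => ?_
  simp only [hgap]
  exact hu.integral_norm_sq_le (fun k a => (markov S k - markov T k) i a) t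

end Spectral

/-! ### Sample complexity -/

section SampleComplexity

variable {𝕜 Ω : Type*} [RCLike 𝕜] [MeasurableSpace Ω] {P : Measure Ω} [IsProbabilityMeasure P]
  {n d m p : ℕ}

theorem expectedKL_le_mul {S T : StateSpace 𝕜 n m p} {K : Controller 𝕜 d m p}
    {r : ℕ → Ω → Fin m → 𝕜} {v : ℕ → Ω → Fin p → 𝕜} {Γ : Matrix (Fin p) (Fin p) 𝕜} {g c b : ℝ}
    (hΓ : Γ.PosDef) (hg : frob Γ⁻¹ ≤ g) (hv : IsGaussianWhiteNoise v Γ P)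
    (hr : ∀ t, Measurable (r t)) (hrv : IndepFun (fun ω t => r t ω) (fun ω t => v t ω) P)
    (hu : IsStationaryWithPSDBound
      (fun t ω => input S K (fun s => r s ω) (fun s => v s ω) t) P c)
    (hb : ∀ t, ∑ k ∈ Finset.range t, frob (markov S k - markov T k) ^ 2 ≤ b) (N : ℕ) :
    expectedKL S T K r v P N ≤ N * ENNReal.ofReal (g * (c * b)) := by
  have hg0 : 0 ≤ g := (frob_nonneg _).trans hg
  refine (expectedKL_le_sum S T K hΓ hg hv hr hrv N).trans ?_
  rw [Finset.sum_range_succ']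
  -- Both systems start at rest, so the term at time `0` vanishes and `N` of the `N + 1` terms
  -- remain.
  have h0 := hu.lintegral_outputGap_le hg0 S T 0
  simp only [Finset.range_zero, Finset.sum_empty, mul_zero, ENNReal.ofReal_zero,
    nonpos_iff_eq_zero] at h0
  refine (add_le_add (Finset.sum_le_card_nsmul _ _ (ENNReal.ofReal (g * (c * b))) fun t _ => ?_)
    h0.le).trans (by simp)
  refine (hu.lintegral_outputGap_le hg0 S T (t + 1)).trans (ENNReal.ofReal_le_ofReal ?_)
  have := hu.nonneg
  gcongr
  exact hb _

theorem div_le_sampleComplexity {S T : StateSpace 𝕜 n m p} {K : Controller 𝕜 d m p}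
    {r : ℕ → Ω → Fin m → 𝕜} {v : ℕ → Ω → Fin p → 𝕜} {b : ℝ≥0∞}
    (h : ∀ N : ℕ, expectedKL S T K r v P N ≤ N * b) (δ : ℝ) :
    ENNReal.ofReal δ / b ≤ sampleComplexity S T K r v P δ :=
  le_iInf₂ fun N hN => ENNReal.div_le_of_le_mul (hN.trans (h N))

end SampleComplexity

/-! ### Root asymptotics and the lower bound on the sample complexity -/

theorem exists_forall_norm_le_lt_one {D : Set ℂ} (hc : IsClosed D)
    (hD : D ⊆ Metric.ball (0 : ℂ) 1) : ∃ ρ < 1, ∀ z ∈ D, ‖z‖ ≤ ρ := by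
  rcases D.eq_empty_or_nonempty with rfl | hne
  · exact ⟨0, one_pos, by simp⟩
  obtain ⟨z, hz, hmax⟩ := (isCompact_of_isClosed_subset_ball hc hD).exists_isMaxOn hne
    continuous_norm.continuousOn
  exact ⟨‖z‖, norm_lt_one_of_mem hD hz, fun w hw => hmax hw⟩

/-- Root asymptotics of an exponential lower bound. -/
theorem inv_le_liminf_rpow {τ a : ℝ} {T : ℕ → ℝ} (hT : Tendsto T atTop (𝓝 τ)) (ha : 0 < a)
    {q : ℕ → ℕ} (hq : Tendsto q atTop atTop) {N : ℕ → ℝ≥0∞}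
    (hN : ∀ n, ENNReal.ofReal a * (ENNReal.ofReal (T (q n)) ^ (2 * q n))⁻¹ ≤ N n) :
    (ENNReal.ofReal τ)⁻¹ ≤ liminf (fun n => N n ^ (1 / (2 * (q n : ℝ)))) atTop := by
  have hq' : Tendsto (fun n => (q n : ℝ)) atTop atTop := tendsto_natCast_atTop_atTop.comp hq
  have he : Tendsto (fun n => 1 / (2 * (q n : ℝ))) atTop (𝓝 0) :=
    (tendsto_const_nhds (x := (1 : ℝ))).div_atTop (hq'.const_mul_atTop two_pos)
  have h1 : Tendsto (fun n => ENNReal.ofReal (a ^ (1 / (2 * (q n : ℝ))))) atTop (𝓝 1) := by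
    have h := ((Real.continuous_const_rpow ha.ne').tendsto 0).comp he
    rw [Real.rpow_zero] at h
    rw [← ENNReal.ofReal_one]
    exact ENNReal.tendsto_ofReal h
  -- Inversion is continuous on `ℝ≥0∞` even at `0`, so `τ = 0` needs no separate treatment.
  have h2 : Tendsto (fun n => (ENNReal.ofReal (T (q n)))⁻¹) atTop (𝓝 (ENNReal.ofReal τ)⁻¹) :=
    tendsto_inv_iff.2 (ENNReal.tendsto_ofReal (hT.comp hq))
  have h3 := ENNReal.Tendsto.mul h1 (Or.inl one_ne_zero) h2 (Or.inr ENNReal.one_ne_top)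
  rw [one_mul] at h3
  rw [← h3.liminf_eq]
  refine liminf_le_liminf ?_
  filter_upwards [hq.eventually_gt_atTop 0] with n hn
  have hn' : (0 : ℝ) < q n := by exact_mod_cast hn
  have hpos : (0 : ℝ) ≤ 1 / (2 * (q n : ℝ)) := by positivity
  refine le_trans (le_of_eq ?_) (ENNReal.rpow_le_rpow (hN n) hpos)
  rw [ENNReal.mul_rpow_of_nonneg _ _ hpos, ENNReal.ofReal_rpow_of_pos ha, ENNReal.inv_rpow,
    ← ENNReal.rpow_natCast, ← ENNReal.rpow_mul]
  congr 2
  push_cast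
  rw [mul_one_div_cancel (by positivity), ENNReal.rpow_one]

end SysId

end

theorem mainTheorem7 {𝕜 : Type*} [RCLike 𝕜] {m p : ℕ} (hm : 0 < m) (hp : 0 < p)
    -- the pole region, a closed continuum in the open unit disk
    (D : Set ℂ) (hD_closed : IsClosed D) (hD_conn : IsConnected D)
    (hD_disk : D ⊆ Metric.ball (0 : ℂ) 1)
    -- the KL threshold, and bounds that do not depend on the dimension `n`
    (δ : ℝ) (hδ : 0 < δ) (Rbar gam c : ℝ)
    -- the true `n`-dimensional models, with simple poles in `D`
    (S : ∀ n : ℕ, StateSpace 𝕜 n m p) (κ : ℕ → ℕ) (pole : ∀ n : ℕ, Fin (κ n) → ℂ)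
    (R : ∀ n : ℕ, Fin (κ n) → Matrix (Fin p) (Fin m) ℂ)
    (hS : ∀ n, HasSimplePoles (S n) (pole n) (R n))
    (hpole : ∀ n j, pole n j ∈ D)
    (hR : ∀ n, ∑ j, frob (R n j) ≤ Rbar)
    -- the feedback, the probing signal and the noise
    {Ω : ℕ → Type*} [∀ n, MeasurableSpace (Ω n)]
    (P : ∀ n, Measure (Ω n)) [∀ n, IsProbabilityMeasure (P n)]
    (d : ℕ → ℕ) (K : ∀ n, Controller 𝕜 (d n) m p)
    (r : ∀ n : ℕ, ℕ → Ω n → Fin m → 𝕜) (v : ∀ n : ℕ, ℕ → Ω n → Fin p → 𝕜)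
    (Γ : ℕ → Matrix (Fin p) (Fin p) 𝕜)
    (hΓ : ∀ n, (Γ n).PosDef) (hΓ_inv : ∀ n, frob (Γ n)⁻¹ ≤ gam)
    (hv : ∀ n, IsGaussianWhiteNoise (v n) (Γ n) (P n))
    (hr : ∀ n t, Measurable (r n t))
    (hrv : ∀ n, IndepFun (fun ω t => r n t ω) (fun ω t => v n t ω) (P n))
    (hu : ∀ n, IsStationaryWithPSDBound
      (fun t ω => input (S n) (K n) (fun s => r n s ω) (fun s => v n s ω) t) (P n) c)
    -- the surrogate, with `⌊n / min(p, m)⌋` minimax poles and `H₂`-optimal coefficients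
    (μ : ∀ n : ℕ, Fin (n / min p m) → ℂ)
    (hμ : ∀ n, IsMinimaxPoles D (μ n)) (hμ_field : ∀ n, IsDefinedOver 𝕜 (μ n))
    (Q : ∀ n : ℕ, Fin (n / min p m) → Matrix (Fin p) (Fin m) ℂ)
    (hQ : ∀ n, IsOptimalCoeff (S n).transfer (μ n) (Q n)) :
    ∃ T : ∀ n : ℕ, StateSpace 𝕜 n m p,
      (∀ n, Realizes (T n) (μ n) (Q n)) ∧
      (ENNReal.ofReal (chebyshev D))⁻¹ ≤
        liminf (fun n : ℕ =>
          sampleComplexity (S n) (T n) (K n) (r n) (v n) (P n) δ ^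
            (1 / (2 * ((n / min p m : ℕ) : ℝ)))) atTop := by
  obtain ⟨ρ, hρ, hDρ⟩ := exists_forall_norm_le_lt_one hD_closed hD_disk
  have hμ1 : ∀ n k, ‖μ n k‖ < 1 := fun n k => norm_lt_one_of_mem hD_disk ((hμ n).1 k)
  have hp1 : ∀ n j, ‖pole n j‖ < 1 := fun n j => norm_lt_one_of_mem hD_disk (hpole n j)
  choose T hT using fun n => (hQ n).exists_realizes (hS n) (hp1 n) (hμ1 n) (hμ_field n)
    (Nat.div_mul_le_self n (min p m))
  refine ⟨T, hT, ?_⟩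
  have hgam : 0 ≤ gam := (frob_nonneg _).trans (hΓ_inv 0)
  have hc : 0 ≤ c := (hu 0).nonneg
  set C := gam * (c * (1 / (1 - ρ) * Rbar) ^ 2) with hC
  have hC0 : 0 ≤ C := by positivity
  refine inv_le_liminf_rpow (tendsto_finiteChebyshev hD_conn.nonempty hD_disk)
    -- `C` may be zero; `C + 1` keeps the constant well defined and positive.
    (a := δ / (C + 1)) (by positivity)
    (Nat.tendsto_div_const_atTop (lt_min hp hm).ne') fun n => ?_
  set q := n / min p m with hq
  set τ := finiteChebyshev D q with hτ
  have hτ0 : 0 ≤ τ := finiteChebyshev_nonneg D q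
  have hρ1 : 0 < 1 - ρ := by linarith
  have hh : h2Norm (fun z => (S n).transfer z - obfModel (μ n) (Q n) z) ≤
      τ ^ q * (1 / (1 - ρ) * Rbar) := by
    refine (h2Norm_transfer_sub_obfModel_le hD_closed hD_disk hρ hDρ (hS n) (hpole n) (hμ n).1
      (hQ n) (minimaxObjective_le_finiteChebyshev_pow hD_conn.nonempty hD_closed hD_disk (hμ n))
      (by positivity)).trans ?_
    rw [div_eq_mul_one_div, mul_assoc]
    gcongr
    exact hR n
  have hmarkov : ∀ t, ∑ k ∈ Finset.range t, frob (markov (S n) k - markov (T n) k) ^ 2 ≤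
      (τ ^ q * (1 / (1 - ρ) * Rbar)) ^ 2 := fun t =>
    (sum_frob_markov_sub_sq_le (hS n) (hp1 n) (hμ1 n) (hT n) t).trans
      (pow_le_pow_left₀ (h2Norm_nonneg _) hh 2)
  refine le_trans ?_ (div_le_sampleComplexity (expectedKL_le_mul (hΓ n) (hΓ_inv n) (hv n) (hr n)
    (hrv n) (hu n) hmarkov) δ)
  have e : gam * (c * (τ ^ q * (1 / (1 - ρ) * Rbar)) ^ 2) = C * τ ^ (2 * q) := by
    rw [hC]
    ring
  rw [e, ← ENNReal.ofReal_pow hτ0, ENNReal.ofReal_div_of_pos (by positivity), div_eq_mul_inv,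
    mul_assoc, div_eq_mul_inv]
  gcongr
  rw [← ENNReal.mul_inv (Or.inl (by simp; positivity)) (Or.inl ENNReal.ofReal_ne_top),
    ← ENNReal.ofReal_mul (by positivity)]
  gcongr
  linarith
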